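/- Let $q,\xi\in[0,1)$. For a partition $\lambda=(\lambda_1\ge\lambda_2\ge\cdots\ge\lambda_\ell>0)$ write $\ell(\lambda)=\ell$ for its length, $|\lambda|=\sum_i\lambda_i$, $b(\lambda)=\sum_{i=1}^{\ell(\lambda)}(i-1)\lambda_i$, and, for a cell $(i,j)$ of its Young diagram, $h(i,j)=\lambda_i+\lambda^{\mathrm T}_j-i-j+1$ for the hook length, where $\lambda^{\mathrm T}$ is the transposed partition ($\lambda_1=0$ for the empty partition). Let $M(\xi;q)=\prod_{n\ge1}(1-\xi^2q^n)^{-n}$ be the modified MacMahon function. The squared type $q$-Plancherel measure on the set of all partitions is $$\mu[\lambda]=M(\xi;q)^{-1}(\xi^2q)^{|\lambda|}\,q^{2b(\lambda)}\prod_{(i,j)\in\lambda}\frac{1}{(1-q^{h(i,j)})^2}$$ (with $0^0=1$). With $(x;q)_\infty=\prod_{k\ge0}(1-xq^k)$ put $$\mathbb I(z;\xi)=\frac{1}{(\xi q^{1/2}z;q)_\infty(\xi q^{1/2}z^{-1};q)_\infty},\qquad \check{\mathbb I}(z;\xi)=(-\xi q^{1/2}z;q)_\infty(-\xi q^{1/2}z^{-1};q)_\infty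 ,$$ and, for integers $N\ge0$, $$Z_N=\int_{\mathrm U(N)}\det\mathbb I(U;\xi)\,dU,\qquad \check Z_N=\int_{\mathrm U(N)}\det\check{\mathbb I}(U;\xi)\,dU,$$ where $dU$ is the Haar probability measure on the unitary group $\mathrm U(N)$ and $\mathbb I(U;\xi)$, $\check{\mathbb I}(U;\xi)$ are defined by functional calculus. Then $\mu$ is a probability measure; the limits $Z_\infty=\lim_{N\to\infty}Z_N$ and $\check Z_\infty=\lim_{N\to\infty}\check Z_N$ exist and $Z_\infty=\check Z_\infty=M(\xi;q)$; and for every $N\ge0$ $$\mathbb P_\mu[\ell(\lambda)\le N]=\frac{Z_N}{Z_\infty},\qquad \mathbb P_\mu[\lambda_1\le N]=\frac{\check Z_N}{\check Z_\infty}.$$ Moreover, if $q>0$, then for all $z\in\mathbb C$ with $\xi q^{1/2}<|z|$ and $\xi q^{1/2}|z|<1$ (in particular on the unit circle) $$\mathbb I(z;\xi)=\exp\Big(-\sum_{n\ge1}\frac{\xi^n(z^n+z^{-n})}{n(q^{n/2}-q^{-n/2})}\Big),\qquad \check{\mathbb I}(z;\xi)=\exp\Big(\sum_{n\ge1}\frac{(-\xi)^n(z^n+z^{-n})}{n(q^{n/2}-q^{-n/2})}\Big),$$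 with convergent series. -/

import Mathlib

/-! ### Partitions and the squared type q-Plancherel measure

A partition is a `YoungDiagram`; rows and columns are indexed from `0`, so that `lam.rowLen i` is the
`(i+1)`-st part, `lam.colLen j` the `(j+1)`-st part of the transposed partition, `lam.rowLen 0` the
largest part, and `lam.colLen 0` the length. -/

/-- The largest part (`0` for the empty partition). -/
def largestPart (lam : YoungDiagram) : ℕ := lam.rowLen 0

/-- The number of non-zero parts. -/
def partLength (lam : YoungDiagram) : ℕ := lam.colLen 0

/-- `b(λ) = ∑_{i ≥ 1} (i - 1) λ_i`. -/
def bStat (lam : YoungDiagram) : ℕ := ∑ i ∈ Finset.range (partLength lam), i * lam.rowLen i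

/-- The hook length of the cell in row `c.1` and column `c.2` (indexed from `0`). For a cell of the
diagram the subtraction does not truncate. -/
def hookLen (lam : YoungDiagram) (c : ℕ × ℕ) : ℕ :=
  lam.rowLen c.1 + lam.colLen c.2 - c.1 - c.2 - 1

/-- The modified MacMahon function `M(ξ;q) = ∏_{n ≥ 1} (1 - ξ² qⁿ)⁻ⁿ`. -/
noncomputable def macMahon (ξ q : ℝ) : ℝ :=
  ∏' n : ℕ, 1 / (1 - ξ ^ 2 * q ^ (n + 1)) ^ (n + 1)

/-- The mass of `λ` under the squared type q-Plancherel measure. -/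
noncomputable def qPlancherelMass (ξ q : ℝ) (lam : YoungDiagram) : ℝ :=
  (macMahon ξ q)⁻¹ * (ξ ^ 2 * q) ^ lam.card * q ^ (2 * bStat lam) *
    ∏ c ∈ lam.cells, 1 / (1 - q ^ hookLen lam c) ^ 2

/-- All sets of partitions are measurable. -/
instance instMeasurableSpaceYoungDiagram : MeasurableSpace YoungDiagram := ⊤

/-- The squared type q-Plancherel measure on the set of all partitions. -/
noncomputable def qPlancherel (ξ q : ℝ) : MeasureTheory.Measure YoungDiagram :=
  MeasureTheory.Measure.sum fun lam =>
    ENNReal.ofReal (qPlancherelMass ξ q lam) • MeasureTheory.Measure.dirac lam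

/-! ### Weight functions -/

/-- `(x;q)_∞ = ∏_{k ≥ 0} (1 - x qᵏ)`. -/
noncomputable def qPochInf (x : ℂ) (q : ℝ) : ℂ := ∏' k : ℕ, (1 - x * (q : ℂ) ^ k)

/-- `𝕀(z;ξ) = (ξ q^{1/2} z, ξ q^{1/2} z⁻¹; q)_∞⁻¹`. -/
noncomputable def weight (ξ q : ℝ) (z : ℂ) : ℂ :=
  (qPochInf (ξ * √q * z) q * qPochInf (ξ * √q * z⁻¹) q)⁻¹

/-- `𝕀̌(z;ξ) = (-ξ q^{1/2} z, -ξ q^{1/2} z⁻¹; q)_∞`. -/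
noncomputable def weightCheck (ξ q : ℝ) (z : ℂ) : ℂ :=
  qPochInf (-(ξ * √q * z)) q * qPochInf (-(ξ * √q * z⁻¹)) q

/-- The term `a^n (z^n + z^{-n}) / (n (q^{n/2} - q^{-n/2}))` of the exponents in the exponential
formulas for the weights; it is used for `n ≥ 1`. -/
noncomputable def expTerm (a q : ℝ) (z : ℂ) (n : ℕ) : ℂ :=
  (a : ℂ) ^ n * (z ^ n + (z ^ n)⁻¹) / (n * ((√q : ℂ) ^ n - ((√q : ℂ) ^ n)⁻¹))

/-! ### Integrals over the unitary group -/

/-- The unitary group carries the topology of the space of matrices and its Borel sets. -/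
noncomputable instance instMeasurableSpaceUnitaryGroup (N : ℕ) :
    MeasurableSpace (Matrix.unitaryGroup (Fin N) ℂ) := borel _

instance instBorelSpaceUnitaryGroup (N : ℕ) : BorelSpace (Matrix.unitaryGroup (Fin N) ℂ) := ⟨rfl⟩

instance instCompactSpaceUnitaryGroup (N : ℕ) :
    CompactSpace (Matrix.unitaryGroup (Fin N) ℂ) := by
  have hclosed : IsClosed (Matrix.unitaryGroup (Fin N) ℂ : Set (Matrix (Fin N) (Fin N) ℂ)) := by
    have h : (Matrix.unitaryGroup (Fin N) ℂ : Set (Matrix (Fin N) (Fin N) ℂ)) =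
        {A | A * star A = 1} := by
      ext A
      exact Matrix.mem_unitaryGroup_iff
    rw [h]
    exact isClosed_eq (continuous_id.mul continuous_star) continuous_const
  have hK : IsCompact (Set.univ.pi fun _ : Fin N => Set.univ.pi fun _ : Fin N =>
      Metric.closedBall (0 : ℂ) 1) :=
    isCompact_univ_pi fun _ => isCompact_univ_pi fun _ => isCompact_closedBall 0 1
  refine isCompact_iff_compactSpace.mp (IsCompact.of_isClosed_subset hK hclosed ?_)
  intro A hA i _ j _
  simpa using entry_norm_bound_of_unitary hA i j

/-- The Haar measure on `U(N)`, normalized to total mass `1`. -/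
noncomputable def haarU (N : ℕ) : MeasureTheory.Measure (Matrix.unitaryGroup (Fin N) ℂ) :=
  MeasureTheory.Measure.haarMeasure ⊤

section MatrixFunctions

open scoped Matrix.Norms.L2Operator

/-- The matrix `f(A)`, for a normal matrix `A`, by the continuous functional calculus (the norm of
the matrix algebra being the operator norm): `f` acts on the eigenvalues of `A`. -/
noncomputable def matrixFun {N : ℕ} (f : ℂ → ℂ) (A : Matrix (Fin N) (Fin N) ℂ) :
    Matrix (Fin N) (Fin N) ℂ := cfc f A

end MatrixFunctions

/-- `Z_N = ∫_{U(N)} det 𝕀(U;ξ) dU`. -/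
noncomputable def Zint (ξ q : ℝ) (N : ℕ) : ℂ :=
  ∫ U : Matrix.unitaryGroup (Fin N) ℂ,
    (matrixFun (weight ξ q) (U : Matrix (Fin N) (Fin N) ℂ)).det ∂(haarU N)

/-- `Ž_N = ∫_{U(N)} det 𝕀̌(U;ξ) dU`. -/
noncomputable def ZintCheck (ξ q : ℝ) (N : ℕ) : ℂ :=
  ∫ U : Matrix.unitaryGroup (Fin N) ℂ,
    (matrixFun (weightCheck ξ q) (U : Matrix (Fin N) (Fin N) ℂ)).det ∂(haarU N)

/-! Both matrix integrals have a symbol of the form `F(z) * star (F z)` on the unit circle, with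
`F(z) = ∑ h_r z^r` and `h` real and absolutely summable. Heine's identity (`integral_det_matrixFun`)
turns the integral into the determinant of the Gram matrix `∑_s h_{s-i} h_{s-j}`. Cauchy–Binet
expands that determinant as a sum of squared `N × N` minors over strictly increasing sequences, that
is, over partitions with at most `N` parts. By Euler's two expansions `h_r` is `x^r / (q;q)_r` for
`weight` and `q^(r choose 2) x^r / (q;q)_r` for `weightCheck`, with `x = ξ √q`. Each minor is then a
Vandermonde determinant in `q^s` or `q^{-s}`, and up to sign it equals `x^|λ| q^{b(λ)} ∏ (1 -
q^h)⁻¹` at `λ` or at its transpose (a principally specialized Jacobi–Trudi formula). Hence `Z_N` and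
`Ž_N` are the partial sums of one non-negative series, over `ℓ(λ) ≤ N` and over `λ₁ ≤ N`, and the
probabilities and limits follow once its sum is known to be `M(ξ;q)`.

Heine's identity is derived from left invariance of Haar measure, without passing to eigenvalue
coordinates. Multiplying `U` by a complex reflection `1 + s v v*` changes each value of its
characteristic polynomial affinely in `s`. Comparing powers of `s` in the mean `H` of `det U ^ (-m)
* ∏ χ_U(x_k)`, and summing over suitable vectors `v`, gives one first-order and one second-order
(Casimir) differential equation for `H`. After multiplication by the Vandermonde polynomial these
say that all occurring exponent vectors have the same sum and the same sum of squares
(`exists_coeff_vdmPoly_mul_haarMean`). Among sets of `n` exponents below `N + n`, those two numbers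
single out the set that omits exactly `m, …, m + N - 1` (`exists_perm_of_gap`). So the Vandermonde
polynomial times `H` is one alternant, and its quotient by the Vandermonde polynomial is a Toeplitz
determinant up to sign. Factoring polynomials into linear factors and letting the truncation degree
of `F` tend to infinity gives the identity; signs are harmless because both sides of the limit are
non-negative.

The total mass comes from the Cauchy identity at `x, xq, …, xq^{N-1}`, itself a Cauchy determinant
expanded by Cauchy–Binet. The finite specialization is the infinite one times `qFactRatio`, which is
at most `1` and tends to `1`, so the sum is squeezed onto the limit of the products. -/

/-! ### Rank-one perturbations and resolvent identities for matrices. -/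

section MatrixAlgebra

open Matrix Polynomial

/-- The matrix determinant lemma for an arbitrary complex matrix. -/
theorem det_add_vecMulVec_adjugate {n : Type*} [Fintype n] [DecidableEq n]
    (A : Matrix n n ℂ) (u v : n → ℂ) :
    (A + vecMulVec u v).det = A.det + v ⬝ᵥ (A.adjugate *ᵥ u) := by
  have key : ∀ B : Matrix n n ℂ, B.det ≠ 0 →
      (B + vecMulVec u v).det = B.det + v ⬝ᵥ (B.adjugate *ᵥ u) := by
    intro B hB
    have h := Matrix.det_add_replicateCol_mul_replicateRow (ι := Unit) (isUnit_iff_ne_zero.2 hB) u v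
    have h1 : replicateCol Unit u * replicateRow Unit v = vecMulVec u v := by
      ext i j; simp [vecMulVec, Matrix.mul_apply]
    rw [h1] at h
    rw [h]
    have h2 : B.adjugate = B.det • B⁻¹ := by
      rw [Matrix.inv_def, smul_smul, Ring.mul_inverse_cancel _ (isUnit_iff_ne_zero.2 hB), one_smul]
    rw [h2, Matrix.smul_mulVec, dotProduct_smul, smul_eq_mul]
    have h3 : ((1 : Matrix Unit Unit ℂ) + replicateRow Unit v * B⁻¹ * replicateCol Unit u).det =
        1 + v ⬝ᵥ (B⁻¹ *ᵥ u) := by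
      rw [Matrix.mul_assoc, Matrix.det_unique]
      simp [Matrix.add_apply, Matrix.mul_apply, dotProduct, mulVec]
    rw [h3]; ring
  -- A singular `A` is reached as the limit of `A + t • 1`, which is singular only when `t` is a
  -- root of the characteristic polynomial of `-A`; both sides are continuous in `t`.
  have hev : ∀ᶠ t : ℂ in nhdsWithin 0 {0}ᶜ, (A + t • (1 : Matrix n n ℂ)).det ≠ 0 := by
    have hfin : ((-A).charpoly.roots.toFinset : Set ℂ).Finite := Finset.finite_toSet _
    have h0 : ∀ᶠ t : ℂ in nhdsWithin 0 {0}ᶜ, t ∉ ((-A).charpoly.roots.toFinset : Set ℂ) := by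
      have : ∀ᶠ t : ℂ in nhdsWithin 0 {0}ᶜ,
          t ∉ (((-A).charpoly.roots.toFinset : Set ℂ) \ {0}) :=
        mem_nhdsWithin_of_mem_nhds ((hfin.subset Set.sdiff_subset).isClosed.isOpen_compl.mem_nhds
          (by simp))
      filter_upwards [this, self_mem_nhdsWithin] with t ht ht0 h
      exact ht ⟨h, ht0⟩
    filter_upwards [h0] with t ht hdet
    apply ht
    simp only [Finset.mem_coe, Multiset.mem_toFinset]
    rw [Polynomial.mem_roots (-A).charpoly_monic.ne_zero, Polynomial.IsRoot, Matrix.eval_charpoly,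
      sub_neg_eq_add, add_comm]
    rwa [Matrix.smul_one_eq_diagonal] at hdet
  have c1 : Filter.Tendsto (fun t : ℂ => (A + t • (1 : Matrix n n ℂ) + vecMulVec u v).det)
      (nhdsWithin 0 {0}ᶜ) (nhds (A + vecMulVec u v).det) := by
    have : Continuous (fun t : ℂ => (A + t • (1 : Matrix n n ℂ) + vecMulVec u v).det) := by
      fun_prop
    simpa using (this.tendsto 0).mono_left nhdsWithin_le_nhds
  have c2 : Filter.Tendsto (fun t : ℂ => (A + t • (1 : Matrix n n ℂ)).det +
      v ⬝ᵥ ((A + t • (1 : Matrix n n ℂ)).adjugate *ᵥ u))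
      (nhdsWithin 0 {0}ᶜ) (nhds (A.det + v ⬝ᵥ (A.adjugate *ᵥ u))) := by
    have : Continuous (fun t : ℂ => (A + t • (1 : Matrix n n ℂ)).det +
      v ⬝ᵥ ((A + t • (1 : Matrix n n ℂ)).adjugate *ᵥ u)) := by
      fun_prop
    simpa using (this.tendsto 0).mono_left nhdsWithin_le_nhds
  refine tendsto_nhds_unique (c1.congr' ?_) c2
  filter_upwards [hev] with t ht
  exact key _ ht

/-- The derivative of the characteristic polynomial is the trace of the adjugate. -/
theorem derivative_charpoly_eq_trace_adjugate {n R : Type*} [Fintype n] [DecidableEq n] [CommRing R]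
    (A : Matrix n n R) : derivative A.charpoly = (charmatrix A).adjugate.trace := by
  have h : ∀ i, (charmatrix A).adjugate i i =
      ∑ σ : Equiv.Perm n, (Equiv.Perm.sign σ : ℤ) •
        ((∏ b ∈ Finset.univ.erase i, charmatrix A (σ b) b) * derivative (charmatrix A (σ i) i)) := by
    intro i
    rw [← Matrix.transpose_apply (adjugate _), Matrix.adjugate_transpose, Matrix.adjugate_apply,
      Matrix.updateRow_transpose, Matrix.det_transpose, Matrix.det_apply]
    refine Finset.sum_congr rfl fun σ _ => ?_
    congr 1
    rw [← Finset.prod_erase_mul _ _ (Finset.mem_univ i)]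
    congr 1
    · refine Finset.prod_congr rfl fun b hb => ?_
      rw [Matrix.updateCol_ne (Finset.ne_of_mem_erase hb)]
    · rw [Matrix.updateCol_self, Matrix.charmatrix_apply]
      by_cases h : σ i = i
      · simp [h]
      · simp [h]
  simp only [Matrix.trace, Matrix.diag, h]
  rw [Finset.sum_comm, Matrix.charpoly, Matrix.det_apply, map_sum]
  refine Finset.sum_congr rfl fun σ _ => ?_
  rw [Units.smul_def, map_zsmul, derivative_prod_finset, Finset.smul_sum]

theorem eval_derivative_charpoly {N : ℕ} (U : Matrix (Fin N) (Fin N) ℂ) (x : ℂ) :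
    (derivative U.charpoly).eval x = (scalar (Fin N) x - U).adjugate.trace := by
  rw [derivative_charpoly_eq_trace_adjugate]
  have h := RingHom.map_adjugate (Polynomial.evalRingHom x) (charmatrix U)
  have h2 : (charmatrix U).map (Polynomial.evalRingHom x) = scalar (Fin N) x - U := by
    ext i j
    by_cases hij : i = j
    · subst hij; simp
    · simp [hij, Matrix.charmatrix_apply_ne]
  have h3 : (scalar (Fin N) x - U).adjugate =
      (charmatrix U).adjugate.map (Polynomial.evalRingHom x) := by
    rw [← h2]; exact h.symm
  rw [h3]
  simp [Matrix.trace, Polynomial.eval_finsetSum]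

/-- The numerator `U * adj (x - U)` of the resolvent-type matrix `U (x - U)⁻¹`. -/
noncomputable def resolventNum {N : ℕ} (U : Matrix (Fin N) (Fin N) ℂ) (x : ℂ) :
    Matrix (Fin N) (Fin N) ℂ := U * (scalar (Fin N) x - U).adjugate

theorem resolventNum_eq {N : ℕ} (U : Matrix (Fin N) (Fin N) ℂ) (x : ℂ) :
    resolventNum U x =
      x • (scalar (Fin N) x - U).adjugate - U.charpoly.eval x • (1 : Matrix (Fin N) (Fin N) ℂ) := by
  have h := Matrix.mul_adjugate (scalar (Fin N) x - U)
  rw [← Matrix.eval_charpoly, Matrix.sub_mul] at h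
  have h2 : scalar (Fin N) x * (scalar (Fin N) x - U).adjugate =
      x • (scalar (Fin N) x - U).adjugate := by
    ext i j; simp
  rw [h2] at h
  rw [resolventNum, ← h]; abel

theorem trace_resolventNum {N : ℕ} (U : Matrix (Fin N) (Fin N) ℂ) (x : ℂ) :
    (resolventNum U x).trace =
      x * (derivative U.charpoly).eval x - N * U.charpoly.eval x := by
  rw [resolventNum_eq, eval_derivative_charpoly]
  simp [mul_comm]

/-- This is the resolvent identity for `U (x - U)⁻¹`, cleared of denominators so that it holds at
eigenvalues too. It makes the trace of a product of two such matrices linear in single traces. -/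
theorem resolventNum_mul {N : ℕ} (U : Matrix (Fin N) (Fin N) ℂ) (x y : ℂ) :
    (x - y) • (resolventNum U x * resolventNum U y) =
      (y * U.charpoly.eval x) • resolventNum U y - (x * U.charpoly.eval y) • resolventNum U x := by
  set B := (scalar (Fin N) x - U).adjugate with hB
  set D := (scalar (Fin N) y - U).adjugate with hD
  have h1 : B * (scalar (Fin N) x - U) = U.charpoly.eval x • (1 : Matrix (Fin N) (Fin N) ℂ) := by
    rw [hB, Matrix.adjugate_mul, Matrix.eval_charpoly]
  have h2 : (scalar (Fin N) y - U) * D = U.charpoly.eval y • (1 : Matrix (Fin N) (Fin N) ℂ) := by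
    rw [hD, Matrix.mul_adjugate, Matrix.eval_charpoly]
  have h3 : (x - y) • (B * D) = U.charpoly.eval x • D - U.charpoly.eval y • B := by
    have : (x - y) • (B * D) =
        B * (scalar (Fin N) x - U) * D - B * ((scalar (Fin N) y - U) * D) := by
      rw [Matrix.mul_assoc, ← Matrix.mul_sub, ← Matrix.sub_mul]
      have : scalar (Fin N) x - U - (scalar (Fin N) y - U) =
        (x - y) • (1 : Matrix (Fin N) (Fin N) ℂ) := by
        ext i j
        by_cases hij : i = j
        · subst hij; simp
        · simp [hij]
      rw [this]; simp
    rw [this, h1, h2]; simp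
  rw [resolventNum_eq, resolventNum_eq, ← hB, ← hD]
  have h4 : (x - y) • ((x • B - U.charpoly.eval x • (1 : Matrix (Fin N) (Fin N) ℂ)) *
      (y • D - U.charpoly.eval y • (1 : Matrix (Fin N) (Fin N) ℂ))) =
      (x * y) • ((x - y) • (B * D)) - ((x - y) * x * U.charpoly.eval y) • B -
      ((x - y) * y * U.charpoly.eval x) • D +
      ((x - y) * U.charpoly.eval x * U.charpoly.eval y) • (1 : Matrix (Fin N) (Fin N) ℂ) := by
    simp only [Matrix.sub_mul, Matrix.mul_sub, Matrix.smul_mul, Matrix.mul_smul, Matrix.one_mul,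
      Matrix.mul_one, smul_sub, smul_smul]
    module
  rw [h4, h3]
  module

/-- The effect on the characteristic polynomial of multiplying by `1 + s v v*`. -/
theorem eval_charpoly_rankOne_mul {N : ℕ} (U : Matrix (Fin N) (Fin N) ℂ) (v : Fin N → ℂ) (s x : ℂ) :
    (((1 : Matrix (Fin N) (Fin N) ℂ) + s • vecMulVec v (star v)) * U).charpoly.eval x =
      U.charpoly.eval x - s * (star v ⬝ᵥ (resolventNum U x *ᵥ v)) := by
  rw [Matrix.eval_charpoly, Matrix.eval_charpoly]
  have : scalar (Fin N) x - ((1 : Matrix (Fin N) (Fin N) ℂ) + s • vecMulVec v (star v)) * U =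
      (scalar (Fin N) x - U) + vecMulVec v ((-s) • (star v ᵥ* U)) := by
    rw [Matrix.add_mul, Matrix.one_mul, Matrix.smul_mul, Matrix.vecMulVec_mul,
      Matrix.vecMulVec_smul]
    rw [neg_smul]; abel
  rw [this, det_add_vecMulVec_adjugate, resolventNum, ← Matrix.mulVec_mulVec,
    Matrix.dotProduct_mulVec (star v) U, smul_dotProduct]
  simp; ring

theorem det_one_add_rankOne {N : ℕ} (v : Fin N → ℂ) (s : ℂ) :
    ((1 : Matrix (Fin N) (Fin N) ℂ) + s • vecMulVec v (star v)).det = 1 + s * (star v ⬝ᵥ v) := by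
  rw [← Matrix.vecMulVec_smul, det_add_vecMulVec_adjugate]
  simp

/-- A complex reflection: it scales the unit vector `v` by `1 + s` and fixes its orthogonal
complement. -/
theorem rankOne_mem_unitaryGroup {N : ℕ} (v : Fin N → ℂ) (hv : star v ⬝ᵥ v = 1) (s : ℂ)
    (hs : ‖1 + s‖ = 1) :
    (1 : Matrix (Fin N) (Fin N) ℂ) + s • vecMulVec v (star v) ∈ Matrix.unitaryGroup (Fin N) ℂ := by
  rw [Matrix.mem_unitaryGroup_iff]
  have h1 : star (s • vecMulVec v (star v)) = (star s) • vecMulVec v (star v) := by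
    rw [star_smul, Matrix.star_eq_conjTranspose, Matrix.conjTranspose_vecMulVec, star_star]
  have h2 : vecMulVec v (star v) * vecMulVec v (star v) = vecMulVec v (star v) := by
    rw [Matrix.vecMulVec_mul_vecMulVec, hv]; simp
  have h3 : s + star s + s * star s = 0 := by
    have : (1 + s) * star (1 + s) = 1 := by
      have := Complex.mul_conj (1 + s)
      rw [Complex.normSq_eq_norm_sq, hs] at this
      simpa using this
    rw [star_add, star_one] at this
    linear_combination this
  rw [star_add, star_one, h1, Matrix.mul_add, Matrix.mul_one, Matrix.add_mul, Matrix.one_mul,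
    Matrix.smul_mul, Matrix.mul_smul, h2]
  have : (1 : Matrix (Fin N) (Fin N) ℂ) + s • vecMulVec v (star v) + (star s • vecMulVec v (star v)
    + s • star s • vecMulVec v (star v)) = 1 + (s + star s + s * star s) • vecMulVec v (star v) := by
    module
  rw [this, h3]; simp

end MatrixAlgebra

/-! ### Invariance of Haar measure under reflections, expanded in the reflection parameter. -/

section HaarFunctional

open Matrix Polynomial MeasureTheory

instance isProbabilityMeasure_haarU (N : ℕ) : IsProbabilityMeasure (haarU N) :=
  ⟨by simpa [haarU] using Measure.haarMeasure_self (G := Matrix.unitaryGroup (Fin N) ℂ) (K₀ := ⊤)⟩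

instance isMulLeftInvariant_haarU (N : ℕ) : (haarU N).IsMulLeftInvariant := by
  unfold haarU; infer_instance

theorem integrable_haarU_of_continuous {N : ℕ} {f : Matrix.unitaryGroup (Fin N) ℂ → ℂ}
    (hf : Continuous f) : Integrable f (haarU N) :=
  hf.integrable_of_hasCompactSupport (HasCompactSupport.of_compactSpace f)

theorem det_ne_zero_of_unitary {N : ℕ} (U : Matrix.unitaryGroup (Fin N) ℂ) :
    (U : Matrix (Fin N) (Fin N) ℂ).det ≠ 0 := by
  have h := (Matrix.mem_unitaryGroup_iff).1 U.2
  intro h0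
  have := congrArg Matrix.det h
  rw [Matrix.det_mul, h0, zero_mul, Matrix.det_one] at this
  exact zero_ne_one this

theorem continuous_charpoly_coeff {N : ℕ} (i : ℕ) :
    Continuous fun A : Matrix (Fin N) (Fin N) ℂ => A.charpoly.coeff i := by
  have h : ∀ A : Matrix (Fin N) (Fin N) ℂ, A.charpoly.coeff i =
      MvPolynomial.eval (fun p => A p.1 p.2) ((charpoly.univ ℂ (Fin N)).coeff i) := by
    intro A
    have := charpoly.univ_coeff_eval₂Hom (Fin N) (RingHom.id ℂ) (fun p => A p.1 p.2) i
    rw [MvPolynomial.eval]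
    rw [this]; rfl
  simp_rw [h]
  exact (MvPolynomial.continuous_eval _).comp (by fun_prop)

/-- The mean of `det U ^ (-m) * f U` over the unitary group. -/
noncomputable def haarMean (N m : ℕ) (f : Matrix.unitaryGroup (Fin N) ℂ → ℂ) : ℂ :=
  ∫ U : Matrix.unitaryGroup (Fin N) ℂ,
    ((U : Matrix (Fin N) (Fin N) ℂ).det⁻¹) ^ m * f U ∂(haarU N)

theorem continuous_inv_det_pow (N m : ℕ) :
    Continuous fun U : Matrix.unitaryGroup (Fin N) ℂ =>
      ((U : Matrix (Fin N) (Fin N) ℂ).det⁻¹) ^ m := by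
  refine Continuous.pow (Continuous.inv₀ ?_ det_ne_zero_of_unitary) m
  exact continuous_subtype_val.matrix_det

theorem haarMean_sum {N m : ℕ} {ι : Type*} (s : Finset ι)
    (f : ι → Matrix.unitaryGroup (Fin N) ℂ → ℂ) (hf : ∀ i, Continuous (f i)) :
    haarMean N m (fun U => ∑ i ∈ s, f i U) = ∑ i ∈ s, haarMean N m (f i) := by
  simp only [haarMean, Finset.mul_sum]
  exact integral_finsetSum _ fun i _ =>
    integrable_haarU_of_continuous ((continuous_inv_det_pow N m).mul (hf i))

theorem haarMean_const_mul {N m : ℕ} (c : ℂ) (f : Matrix.unitaryGroup (Fin N) ℂ → ℂ) :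
    haarMean N m (fun U => c * f U) = c * haarMean N m f := by
  simp only [haarMean, mul_left_comm _ c]
  exact integral_const_mul _ _

/-- Left invariance of Haar measure; the weight `det U ^ (-m)` makes the functional equivariant with
character `det ^ m` instead of invariant. -/
theorem haarMean_mul_left {N m : ℕ} (f : Matrix.unitaryGroup (Fin N) ℂ → ℂ)
    (g : Matrix.unitaryGroup (Fin N) ℂ) :
    haarMean N m (fun U => f (g * U)) =
      (g : Matrix (Fin N) (Fin N) ℂ).det ^ m * haarMean N m f := by
  rw [← haarMean_const_mul, haarMean, haarMean,
    ← integral_mul_left_eq_self (fun U : Matrix.unitaryGroup (Fin N) ℂ =>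
      ((U : Matrix (Fin N) (Fin N) ℂ).det⁻¹) ^ m *
        ((g : Matrix (Fin N) (Fin N) ℂ).det ^ m * f U)) g]
  refine integral_congr_ae (Filter.Eventually.of_forall fun U => ?_)
  have h := pow_ne_zero m (det_ne_zero_of_unitary g)
  simp only [Submonoid.coe_mul, Matrix.det_mul, mul_inv, mul_pow, inv_pow]
  field_simp

theorem continuous_charpoly_eval {N : ℕ} (x : ℂ) :
    Continuous fun U : Matrix.unitaryGroup (Fin N) ℂ =>
      (U : Matrix (Fin N) (Fin N) ℂ).charpoly.eval x := by
  simp_rw [Matrix.eval_charpoly]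
  exact (continuous_const.sub continuous_subtype_val).matrix_det

theorem continuous_resolventNum {N : ℕ} (x : ℂ) :
    Continuous fun U : Matrix.unitaryGroup (Fin N) ℂ =>
      resolventNum (U : Matrix (Fin N) (Fin N) ℂ) x := by
  unfold resolventNum
  exact continuous_subtype_val.matrix_mul
    (continuous_const.sub continuous_subtype_val).matrix_adjugate

/-- The quadratic form of a matrix. -/
def quadForm {N : ℕ} (A : Matrix (Fin N) (Fin N) ℂ) (v : Fin N → ℂ) : ℂ := star v ⬝ᵥ (A *ᵥ v)

theorem continuous_quadForm_resolventNum {N : ℕ} (x : ℂ) (v : Fin N → ℂ) :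
    Continuous fun U : Matrix.unitaryGroup (Fin N) ℂ =>
      quadForm (resolventNum (U : Matrix (Fin N) (Fin N) ℂ) x) v :=
  Continuous.dotProduct continuous_const
    ((continuous_resolventNum x).matrix_mulVec continuous_const)

theorem continuous_coeff_prod {X ι : Type*} [TopologicalSpace X] (s : Finset ι)
    (P : ι → X → ℂ[X]) (hP : ∀ k i, Continuous fun u => (P k u).coeff i) (i : ℕ) :
    Continuous fun u => (∏ k ∈ s, P k u).coeff i := by
  classical
  induction s using Finset.induction_on generalizing i with
  | empty => simpa using continuous_const
  | insert a s ha ih =>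
    simp_rw [Finset.prod_insert ha, Polynomial.coeff_mul]
    exact continuous_finsetSum _ fun p _ => (hP a p.1).mul (ih p.2)

/-- Invariance is available only for `s` on this circle; its being infinite promotes the relation to
an identity of polynomials in `s`. -/
theorem infinite_setOf_norm_one_add : {s : ℂ | ‖1 + s‖ = 1}.Infinite := by
  refine Set.infinite_of_injOn_mapsTo (f := fun t : ℝ => Complex.exp (t * Complex.I) - 1)
    (s := Set.Icc 0 1) (fun a ha b hb h => ?_) (fun t _ => ?_) (Set.Icc_infinite zero_lt_one)
  · have h1 : Complex.exp (a * Complex.I) = Complex.exp (b * Complex.I) := by simpa using h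
    have h2 := congrArg Complex.re h1
    rw [Complex.exp_ofReal_mul_I_re, Complex.exp_ofReal_mul_I_re] at h2
    have hpi : (1 : ℝ) ≤ Real.pi := by linarith [Real.pi_gt_three]
    exact Real.injOn_cos ⟨ha.1, ha.2.trans hpi⟩ ⟨hb.1, hb.2.trans hpi⟩ h2
  · change ‖1 + (Complex.exp (t * Complex.I) - 1)‖ = 1
    rw [add_sub_cancel, Complex.norm_exp_ofReal_mul_I]

theorem haarMean_prod_charpoly_perturb {N m n : ℕ} (x : Fin n → ℂ) (v : Fin N → ℂ)
    (hv : star v ⬝ᵥ v = 1) (s : ℂ) (hs : ‖1 + s‖ = 1) :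
    haarMean N m (fun U => ∏ k, ((U : Matrix (Fin N) (Fin N) ℂ).charpoly.eval (x k) -
        s * quadForm (resolventNum (U : Matrix (Fin N) (Fin N) ℂ) (x k)) v)) =
      (1 + s) ^ m * haarMean N m
        (fun U => ∏ k, (U : Matrix (Fin N) (Fin N) ℂ).charpoly.eval (x k)) := by
  have h := haarMean_mul_left (m := m)
    (fun U => ∏ k, (U : Matrix (Fin N) (Fin N) ℂ).charpoly.eval (x k))
    ⟨_, rankOne_mem_unitaryGroup v hv s hs⟩
  simp only [Submonoid.coe_mul, eval_charpoly_rankOne_mul, det_one_add_rankOne, hv, mul_one] at h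
  exact h

/-- Comparison of the coefficients of the second order in the reflection parameter. -/
theorem haarMean_first_second_order {N m n : ℕ} (x : Fin n → ℂ) (v : Fin N → ℂ)
    (hv : star v ⬝ᵥ v = 1) :
    (haarMean N m (fun U => ∑ k, (∏ j ∈ Finset.univ.erase k,
        (U : Matrix (Fin N) (Fin N) ℂ).charpoly.eval (x j)) *
        quadForm (resolventNum (U : Matrix (Fin N) (Fin N) ℂ) (x k)) v) =
      -m * haarMean N m
        (fun U => ∏ k, (U : Matrix (Fin N) (Fin N) ℂ).charpoly.eval (x k))) ∧
    (haarMean N m (fun U => ∑ k, ∑ l ∈ Finset.univ.erase k,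
        (∏ j ∈ (Finset.univ.erase k).erase l,
          (U : Matrix (Fin N) (Fin N) ℂ).charpoly.eval (x j)) *
        (quadForm (resolventNum (U : Matrix (Fin N) (Fin N) ℂ) (x k)) v *
         quadForm (resolventNum (U : Matrix (Fin N) (Fin N) ℂ) (x l)) v)) =
      (m * (m - 1)) * haarMean N m
        (fun U => ∏ k, (U : Matrix (Fin N) (Fin N) ℂ).charpoly.eval (x k))) := by
  set q : Fin n → Matrix.unitaryGroup (Fin N) ℂ → ℂ :=
    fun k U => (U : Matrix (Fin N) (Fin N) ℂ).charpoly.eval (x k) with hq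
  set y : Fin n → Matrix.unitaryGroup (Fin N) ℂ → ℂ :=
    fun k U => quadForm (resolventNum (U : Matrix (Fin N) (Fin N) ℂ) (x k)) v with hy
  have cq : ∀ k, Continuous (q k) := fun k => continuous_charpoly_eval (x k)
  have cy : ∀ k, Continuous (y k) := fun k => continuous_quadForm_resolventNum (x k) v
  set P : Fin n → Matrix.unitaryGroup (Fin N) ℂ → ℂ[X] :=
    fun k U => C (q k U) - C (y k U) * X with hP
  set Φ := haarMean N m (fun U => ∏ k, q k U) with hΦ
  have cP : ∀ k i, Continuous fun U => (P k U).coeff i := by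
    intro k i
    simp only [hP, Polynomial.coeff_sub, Polynomial.coeff_C, Polynomial.coeff_C_mul]
    refine Continuous.sub ?_ ((cy k).mul continuous_const)
    split_ifs
    · exact cq k
    · exact continuous_const
  have cPp : ∀ i, Continuous fun U => (∏ k, P k U).coeff i := fun i =>
    continuous_coeff_prod _ P cP i
  have degP : ∀ U, (∏ k, P k U).natDegree < n + 1 := by
    intro U
    refine Nat.lt_succ_of_le ((Polynomial.natDegree_prod_le _ _).trans ?_)
    calc ∑ k : Fin n, (P k U).natDegree ≤ ∑ k : Fin n, 1 :=
          Finset.sum_le_sum fun k _ => by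
            simp only [hP]
            compute_degree
      _ = n := by simp
  -- Averaging coefficientwise exhibits the mean as a polynomial in `s` of degree at most `n`, since
  -- each factor is affine in `s`.
  set p : ℂ[X] := ∑ i ∈ Finset.range (n + 1),
    Polynomial.monomial i (haarMean N m fun U => (∏ k, P k U).coeff i) with hp
  have pcoeff : ∀ i, p.coeff i = haarMean N m fun U => (∏ k, P k U).coeff i := by
    intro i
    simp only [hp, Polynomial.finsetSum_coeff, Polynomial.coeff_monomial, Finset.sum_ite_eq',
      Finset.mem_range]
    split_ifs with h
    · rfl
    · have : ∀ U, (∏ k, P k U).coeff i = 0 := fun U =>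
        Polynomial.coeff_eq_zero_of_natDegree_lt (lt_of_lt_of_le (degP U) (not_lt.1 h))
      simp [this, haarMean]
  have peval : ∀ s, p.eval s = haarMean N m fun U => ∏ k, (q k U - s * y k U) := by
    intro s
    have h1 : ∀ U, ∏ k, (q k U - s * y k U) =
        ∑ i ∈ Finset.range (n + 1), s ^ i * (∏ k, P k U).coeff i := by
      intro U
      have := Polynomial.eval_eq_sum_range' (degP U) s
      rw [Polynomial.eval_prod] at this
      simp only [hP, eval_sub, eval_C, eval_mul, eval_X] at this
      rw [Finset.prod_congr rfl fun k _ => by rw [mul_comm s (y k U)], this]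
      exact Finset.sum_congr rfl fun i _ => by simp only [hP]; ring
    simp_rw [h1]
    rw [haarMean_sum (Finset.range (n + 1)) (fun i U => s ^ i * (∏ k, P k U).coeff i)
      (fun i => continuous_const.mul (cPp i)), hp, Polynomial.eval_finsetSum]
    refine Finset.sum_congr rfl fun i _ => ?_
    rw [Polynomial.eval_monomial, haarMean_const_mul, mul_comm]
  have hpeq : p = (1 + X) ^ m * C Φ := by
    refine Polynomial.eq_of_infinite_eval_eq _ _ (infinite_setOf_norm_one_add.mono fun s hs => ?_)
    have := haarMean_prod_charpoly_perturb (m := m) x v hv s hs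
    change p.eval s = _
    simp only [peval, eval_mul, eval_pow, eval_add, eval_one, eval_X, eval_C]
    exact this
  have dP : ∀ k U, derivative (P k U) = - C (y k U) := by
    intro k U; simp [hP]
  have eP : ∀ k U, (P k U).eval 0 = q k U := by
    intro k U; simp [hP]
  constructor
  · have h1 : ∀ U, (∏ k, P k U).coeff 1 =
        -1 * ∑ k, (∏ j ∈ Finset.univ.erase k, q j U) * y k U := by
      intro U
      have := Polynomial.coeff_derivative (∏ k, P k U) 0
      rw [Polynomial.coeff_zero_eq_eval_zero, derivative_prod_finset, Polynomial.eval_finsetSum]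
        at this
      simp only [eval_mul, dP, eval_prod, eP, eval_neg, eval_C] at this
      simp only [mul_neg, Finset.sum_neg_distrib, Nat.cast_zero, zero_add, mul_one] at this
      rw [← this, neg_one_mul]
    have h2 := pcoeff 1
    simp_rw [h1] at h2
    rw [haarMean_const_mul, hpeq, Polynomial.coeff_mul_C, add_comm, Polynomial.coeff_X_add_one_pow,
      Nat.choose_one_right] at h2
    change haarMean N m (fun U => ∑ k, (∏ j ∈ Finset.univ.erase k, q j U) * y k U) = _
    linear_combination h2
  -- The second derivative of a product of affine factors has only cross terms `k ≠ l`; the factor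
  -- `2⁻¹` passes from the second derivative at `0` to the coefficient.
  · have h1 : ∀ U, (∏ k, P k U).coeff 2 =
        2⁻¹ * ∑ k, ∑ l ∈ Finset.univ.erase k,
          (∏ j ∈ (Finset.univ.erase k).erase l, q j U) * (y k U * y l U) := by
      intro U
      have h3 := Polynomial.coeff_derivative (∏ k, P k U) 1
      have h4 := Polynomial.coeff_derivative (derivative (∏ k, P k U)) 0
      rw [Polynomial.coeff_zero_eq_eval_zero, derivative_prod_finset, map_sum,
        Polynomial.eval_finsetSum] at h4
      simp only [derivative_mul, dP, derivative_neg, derivative_C, mul_zero, add_zero,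
        derivative_prod_finset, Finset.sum_mul, Polynomial.eval_finsetSum, eval_mul, eval_prod, eP,
        eval_C, mul_neg, neg_mul, zero_add, Nat.cast_zero, mul_one,
        Finset.sum_neg_distrib, neg_neg] at h4
      have h5 : ∑ k, ∑ l ∈ Finset.univ.erase k,
          (∏ j ∈ (Finset.univ.erase k).erase l, q j U) * (y k U * y l U) =
          (derivative (∏ k, P k U)).coeff 1 := by
        rw [derivative_prod_finset]
        simp only [dP, mul_neg, Finset.sum_neg_distrib]
        rw [← h4]
        exact Finset.sum_congr rfl fun k _ => Finset.sum_congr rfl fun l _ => by ring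
      rw [h5, h3]; push_cast; ring
    have h2 := pcoeff 2
    simp_rw [h1] at h2
    rw [haarMean_const_mul, hpeq, Polynomial.coeff_mul_C, add_comm, Polynomial.coeff_X_add_one_pow,
      Nat.cast_choose_two] at h2
    change haarMean N m (fun U => ∑ k, ∑ l ∈ Finset.univ.erase k,
          (∏ j ∈ (Finset.univ.erase k).erase l, q j U) * (y k U * y l U)) = _
    linear_combination -2 * h2

end HaarFunctional

/-! ### From single vectors to traces: first-order and Casimir relations. -/

section CasimirEquations

open Matrix Polynomial MeasureTheory

theorem trace_eq_sum_quadForm {N : ℕ} (A : Matrix (Fin N) (Fin N) ℂ) :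
    A.trace = ∑ i, quadForm A (Pi.single i 1) := by
  simp [Matrix.trace, quadForm]

theorem quadForm_single_add {N : ℕ} (A : Matrix (Fin N) (Fin N) ℂ) (i j : Fin N) (w : ℂ) :
    quadForm A (Pi.single i 1 + w • Pi.single j 1) =
      A i i + w * A i j + star w * A j i + star w * w * A j j := by
  simp only [quadForm, star_add, star_smul, Matrix.mulVec_add, Matrix.mulVec_smul,
    add_dotProduct, dotProduct_add, smul_dotProduct, dotProduct_smul, smul_eq_mul,
    Pi.star_single, star_one, mulVec_single_one, single_one_dotProduct, Matrix.col_apply]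
  ring

/-- A discrete form of averaging `(v* A v)(v* B v)` over the sphere. Summing over the fourth roots
of unity `w` removes every term in which `w` and `star w` do not balance; the surplus diagonal terms
`A i i * B i i` are subtracted through the basis vectors. -/
theorem trace_mul_trace_add_trace_mul {N : ℕ} (A B : Matrix (Fin N) (Fin N) ℂ) :
    A.trace * B.trace + (A * B).trace =
      (∑ i, ∑ j, ∑ w ∈ ({1, -1, Complex.I, -Complex.I} : Finset ℂ), (1 / 8 : ℂ) *
        (quadForm A (Pi.single i 1 + w • Pi.single j 1) *
          quadForm B (Pi.single i 1 + w • Pi.single j 1))) -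
      ∑ i, (N : ℂ) * (quadForm A (Pi.single i 1) * quadForm B (Pi.single i 1)) := by
  have hI : Complex.I ≠ -Complex.I := fun h => by
    have := congrArg Complex.im h; norm_num at this
  have h1I : (1 : ℂ) ≠ Complex.I := fun h => by
    have := congrArg Complex.im h; norm_num at this
  have h1I' : (1 : ℂ) ≠ -Complex.I := fun h => by
    have := congrArg Complex.im h; norm_num at this
  have hmI : (-1 : ℂ) ≠ Complex.I := fun h => by
    have := congrArg Complex.im h; norm_num at this
  have hmI' : (-1 : ℂ) ≠ -Complex.I := fun h => by
    have := congrArg Complex.im h; norm_num at this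
  have h11 : (1 : ℂ) ≠ -1 := by norm_num
  have hsum : ∀ i j : Fin N, ∑ w ∈ ({1, -1, Complex.I, -Complex.I} : Finset ℂ), (1 / 8 : ℂ) *
        (quadForm A (Pi.single i 1 + w • Pi.single j 1) *
          quadForm B (Pi.single i 1 + w • Pi.single j 1)) =
      (1 / 2 : ℂ) * (A i i * B i i + A j j * B j j + A i i * B j j + A j j * B i i +
        A i j * B j i + A j i * B i j) := by
    intro i j
    rw [Finset.sum_insert (by simp [h11, h1I, h1I']), Finset.sum_insert (by simp [hmI, hmI']),
      Finset.sum_insert (by simpa using hI), Finset.sum_singleton]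
    simp only [quadForm_single_add, star_one, star_neg, RCLike.star_def, Complex.conj_I]
    ring_nf
    simp only [Complex.I_sq, show Complex.I ^ 4 = 1 by rw [Complex.I_pow_four]]
    ring
  have hdiag : ∀ (A : Matrix (Fin N) (Fin N) ℂ) i, quadForm A (Pi.single i 1) = A i i := by
    intro A i; simp [quadForm]
  simp only [hsum, hdiag]
  have e1 : A.trace * B.trace = ∑ i, ∑ j, A i i * B j j := by
    simp [Matrix.trace, Finset.sum_mul_sum]
  have e2 : (A * B).trace = ∑ i, ∑ j, A i j * B j i := by
    simp [Matrix.trace, Matrix.mul_apply]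
  have e3 : ∑ i : Fin N, ∑ j : Fin N, A j j * B i i = ∑ i, ∑ j, A i i * B j j :=
    Finset.sum_comm
  have e4 : ∑ i : Fin N, ∑ j : Fin N, A j i * B i j = ∑ i, ∑ j, A i j * B j i :=
    Finset.sum_comm
  have e5 : ∑ i : Fin N, ∑ _j : Fin N, A i i * B i i = N * ∑ i, A i i * B i i := by
    simp [Finset.mul_sum]
  have e6 : ∑ _i : Fin N, ∑ j : Fin N, A j j * B j j = N * ∑ i, A i i * B i i := by
    simp
  simp only [mul_add, Finset.sum_add_distrib, ← Finset.mul_sum _ _ (1 / 2 : ℂ),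
    ← Finset.mul_sum _ _ (N : ℂ)]
  rw [e3, e4, e5, e6, e1, e2]
  ring

theorem exists_quadrature (N : ℕ) : ∃ (ι : Type) (_ : Fintype ι) (v : ι → Fin N → ℂ) (c : ι → ℂ),
    ∀ A B : Matrix (Fin N) (Fin N) ℂ, A.trace * B.trace + (A * B).trace =
      ∑ i, c i * (quadForm A (v i) * quadForm B (v i)) := by
  refine ⟨(Fin N × Fin N × ({1, -1, Complex.I, -Complex.I} : Finset ℂ)) ⊕ Fin N, inferInstance,
    Sum.elim (fun p => Pi.single p.1 1 + (p.2.2 : ℂ) • Pi.single p.2.1 1) (fun i => Pi.single i 1),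
    Sum.elim (fun _ => 1 / 8) (fun _ => -N), fun A B => ?_⟩
  rw [trace_mul_trace_add_trace_mul, Fintype.sum_sum_type, Fintype.sum_prod_type]
  simp only [Sum.elim_inl, Sum.elim_inr, Fintype.sum_prod_type, neg_mul, Finset.sum_neg_distrib]
  rw [← sub_eq_add_neg]
  congr 1
  refine Finset.sum_congr rfl fun i _ => Finset.sum_congr rfl fun j _ => ?_
  rw [← Finset.sum_coe_sort]

theorem quadForm_smul {N : ℕ} (A : Matrix (Fin N) (Fin N) ℂ) (r : ℂ) (v : Fin N → ℂ) :
    quadForm A (r • v) = star r * r * quadForm A v := by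
  simp [quadForm, Matrix.mulVec_smul]
  ring

theorem exists_eq_smul_unit {N : ℕ} (v : Fin N → ℂ) (hv : v ≠ 0) :
    ∃ (r : ℂ) (w : Fin N → ℂ), star w ⬝ᵥ w = 1 ∧ v = r • w := by
  have h1 : star v ⬝ᵥ v = ((∑ i, ‖v i‖ ^ 2 : ℝ) : ℂ) := by
    simp only [dotProduct, Pi.star_apply, Complex.ofReal_sum]
    refine Finset.sum_congr rfl fun i _ => ?_
    rw [RCLike.star_def, Complex.conj_mul', Complex.ofReal_pow]
  have hpos : 0 < ∑ i, ‖v i‖ ^ 2 := by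
    obtain ⟨i, hi⟩ := Function.ne_iff.1 hv
    exact Finset.sum_pos' (fun _ _ => by positivity)
      ⟨i, Finset.mem_univ _, by have : 0 < ‖v i‖ := norm_pos_iff.2 hi
                                positivity⟩
  set R := ∑ i, ‖v i‖ ^ 2 with hR
  have hs : 0 < √R := Real.sqrt_pos.2 hpos
  have hsc : ((√R : ℝ) : ℂ) ≠ 0 := by exact_mod_cast hs.ne'
  refine ⟨((√R : ℝ) : ℂ), ((√R : ℝ) : ℂ)⁻¹ • v, ?_, by rw [smul_smul, mul_inv_cancel₀ hsc, one_smul]⟩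
  rw [star_smul, smul_dotProduct, dotProduct_smul, h1]
  simp only [star_inv₀, RCLike.star_def, Complex.conj_ofReal, smul_eq_mul]
  have : ((√R : ℝ) : ℂ) * ((√R : ℝ) : ℂ) = (R : ℂ) := by
    rw [← Complex.ofReal_mul, Real.mul_self_sqrt hpos.le]
  rw [← this]
  field_simp

theorem exists_haarMean_second_order {N m n : ℕ} (v : Fin N → ℂ) :
    ∃ K : ℂ, ∀ x : Fin n → ℂ,
    haarMean N m (fun U => ∑ k, ∑ l ∈ Finset.univ.erase k,
        (∏ j ∈ (Finset.univ.erase k).erase l,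
          (U : Matrix (Fin N) (Fin N) ℂ).charpoly.eval (x j)) *
        (quadForm (resolventNum (U : Matrix (Fin N) (Fin N) ℂ) (x k)) v *
         quadForm (resolventNum (U : Matrix (Fin N) (Fin N) ℂ) (x l)) v)) =
      K * haarMean N m
        (fun U => ∏ k, (U : Matrix (Fin N) (Fin N) ℂ).charpoly.eval (x k)) := by
  by_cases hv : v = 0
  · exact ⟨0, fun x => by simp [hv, quadForm, haarMean]⟩
  · obtain ⟨r, w, hw, rfl⟩ := exists_eq_smul_unit v hv
    -- Each quadratic form scales by `star r * r`, and the relation contains two of them.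
    refine ⟨(star r * r) ^ 2 * (m * (m - 1)), fun x => ?_⟩
    rw [mul_assoc, ← (haarMean_first_second_order (m := m) x w hw).2, ← haarMean_const_mul]
    congr 1
    funext U
    simp only [quadForm_smul, Finset.mul_sum]
    exact Finset.sum_congr rfl fun k _ => Finset.sum_congr rfl fun l _ => by ring

theorem exists_haarMean_trace {N m n : ℕ} :
    ∃ K : ℂ, ∀ x : Fin n → ℂ,
    haarMean N m (fun U => ∑ k, (∏ j ∈ Finset.univ.erase k,
          (U : Matrix (Fin N) (Fin N) ℂ).charpoly.eval (x j)) *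
        (resolventNum (U : Matrix (Fin N) (Fin N) ℂ) (x k)).trace) =
      K * haarMean N m
        (fun U => ∏ k, (U : Matrix (Fin N) (Fin N) ℂ).charpoly.eval (x k)) := by
  refine ⟨∑ _i : Fin N, (-m : ℂ), fun x => ?_⟩
  rw [Finset.sum_mul]
  have h : ∀ i : Fin N, (-m : ℂ) * haarMean N m
      (fun U => ∏ k, (U : Matrix (Fin N) (Fin N) ℂ).charpoly.eval (x k)) = _ := fun i =>
    (haarMean_first_second_order (m := m) x (Pi.single i 1) (by simp)).1.symm
  rw [Finset.sum_congr rfl fun i _ => h i, ← haarMean_sum]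
  · congr 1
    funext U
    simp only [trace_eq_sum_quadForm, Finset.mul_sum]
    rw [Finset.sum_comm]
  · intro i
    exact continuous_finsetSum _ fun k _ =>
      (continuous_finsetProd _ fun j _ => continuous_charpoly_eval (x j)).mul
        (continuous_quadForm_resolventNum _ _)

/-- The second-order relation holds for each vector with a constant independent of `x`, so it
survives any fixed linear combination; the quadrature combines the vectors into traces. Only the
independence of `K` from `x` matters later. -/
theorem exists_haarMean_trace_mul_trace {N m n : ℕ} :
    ∃ K : ℂ, ∀ x : Fin n → ℂ,
    haarMean N m (fun U => ∑ k, ∑ l ∈ Finset.univ.erase k,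
        (∏ j ∈ (Finset.univ.erase k).erase l,
          (U : Matrix (Fin N) (Fin N) ℂ).charpoly.eval (x j)) *
        ((resolventNum (U : Matrix (Fin N) (Fin N) ℂ) (x k)).trace *
          (resolventNum (U : Matrix (Fin N) (Fin N) ℂ) (x l)).trace +
         (resolventNum (U : Matrix (Fin N) (Fin N) ℂ) (x k) *
          resolventNum (U : Matrix (Fin N) (Fin N) ℂ) (x l)).trace)) =
      K * haarMean N m
        (fun U => ∏ k, (U : Matrix (Fin N) (Fin N) ℂ).charpoly.eval (x k)) := by
  obtain ⟨ι, _, v, c, hvc⟩ := exists_quadrature N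
  choose K hK using fun i : ι => exists_haarMean_second_order (m := m) (n := n) (v i)
  refine ⟨∑ i, c i * K i, fun x => ?_⟩
  simp only [Finset.sum_mul, mul_assoc, ← hK, ← haarMean_const_mul]
  rw [← haarMean_sum]
  · congr 1
    funext U
    simp only [hvc, Finset.mul_sum]
    symm
    rw [Finset.sum_comm]
    refine Finset.sum_congr rfl fun k _ => ?_
    rw [Finset.sum_comm]
    exact Finset.sum_congr rfl fun l _ => Finset.sum_congr rfl fun i _ => by ring
  · intro i
    refine continuous_const.mul (continuous_finsetSum _ fun k _ => continuous_finsetSum _ fun l _ => ?_)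
    exact (continuous_finsetProd _ fun j _ => continuous_charpoly_eval (x j)).mul
        ((continuous_quadForm_resolventNum _ _).mul (continuous_quadForm_resolventNum _ _))

end CasimirEquations

/-! ### Euler operators, coefficient extraction and the Vandermonde polynomial. -/

section EulerOperators

open Matrix MeasureTheory MvPolynomial

theorem sum_sum_erase_comm {ι M : Type*} [Fintype ι] [DecidableEq ι] [AddCommMonoid M]
    (f : ι → ι → M) :
    ∑ k, ∑ l ∈ Finset.univ.erase k, f k l = ∑ k, ∑ l ∈ Finset.univ.erase k, f l k := by
  have h : ∀ g : ι → ι → M, ∑ k, ∑ l ∈ Finset.univ.erase k, g k l =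
      ∑ k, ∑ l, if l ≠ k then g k l else 0 := by
    intro g
    refine Finset.sum_congr rfl fun k _ => ?_
    rw [← Finset.sum_filter]
    congr 1
    ext l; simp
  rw [h, h, Finset.sum_comm]
  simp only [ne_comm]

/-- The Euler operator `X k * ∂ / ∂ X k`. -/
noncomputable def eulerOp {n : ℕ} (k : Fin n) :
    Derivation ℂ (MvPolynomial (Fin n) ℂ) (MvPolynomial (Fin n) ℂ) :=
  (X k : MvPolynomial (Fin n) ℂ) • pderiv k

/-- Monomials are joint eigenvectors of the Euler operators, so a differential equation with
constant coefficients in these operators becomes an algebraic condition on the exponents that occur.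
-/
theorem coeff_eulerOp {n : ℕ} (k : Fin n) (p : MvPolynomial (Fin n) ℂ) (α : Fin n →₀ ℕ) :
    coeff α (eulerOp k p) = α k * coeff α p := by
  induction p using MvPolynomial.induction_on' with
  | monomial u a =>
    rw [eulerOp, Derivation.smul_apply, smul_eq_mul, X_mul_pderiv_monomial, coeff_smul,
      nsmul_eq_mul, coeff_monomial]
    split_ifs with h
    · rw [h]
    · simp
  | add p q hp hq => simp [hp, hq, mul_add]

theorem eulerOp_aeval_X {n : ℕ} (k j : Fin n) (p : Polynomial ℂ) :
    eulerOp k (Polynomial.aeval (X j : MvPolynomial (Fin n) ℂ) p) =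
      if j = k then X k * Polynomial.aeval (X k : MvPolynomial (Fin n) ℂ) (Polynomial.derivative p)
      else 0 := by
  rw [Derivation.map_aeval, eulerOp, Derivation.smul_apply, pderiv_X]
  split_ifs with h
  · subst h; simp [mul_comm]
  · simp [h]

theorem aeval_X_eq_sum {n : ℕ} (k : Fin n) (p : Polynomial ℂ) {D : ℕ} (hD : p.natDegree < D) :
    Polynomial.aeval (X k : MvPolynomial (Fin n) ℂ) p =
      ∑ i ∈ Finset.range D, monomial (Finsupp.single k i) (p.coeff i) := by
  rw [Polynomial.aeval_eq_sum_range' hD]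
  refine Finset.sum_congr rfl fun i _ => ?_
  rw [X_pow_eq_monomial, smul_monomial, smul_eq_mul, mul_one]

theorem prod_aeval_X_eq_sum {n : ℕ} (p : Fin n → Polynomial ℂ) {D : ℕ}
    (hD : ∀ k, (p k).natDegree < D) :
    ∏ k, Polynomial.aeval (X k : MvPolynomial (Fin n) ℂ) (p k) =
      ∑ f ∈ Fintype.piFinset (fun _ : Fin n => Finset.range D),
        monomial (Finsupp.equivFunOnFinite.symm f) (∏ k, (p k).coeff (f k)) := by
  rw [Finset.prod_congr rfl fun k _ => aeval_X_eq_sum k (p k) (hD k), Finset.prod_univ_sum]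
  refine Finset.sum_congr rfl fun f _ => ?_
  have := monomial_sum_index (R := ℂ) Finset.univ (fun k => Finsupp.single k (f k))
    (∏ k, (p k).coeff (f k))
  have h2 : ∑ k, Finsupp.single k (f k) = Finsupp.equivFunOnFinite.symm f := by
    ext i; simp [Finsupp.finsetSum_apply, Finsupp.single_apply]
  rw [h2] at this
  rw [this, map_prod, ← Finset.prod_mul_distrib]
  exact Finset.prod_congr rfl fun k _ => by rw [C_mul_monomial, mul_one]

theorem coeff_prod_aeval_X {n : ℕ} (p : Fin n → Polynomial ℂ) (α : Fin n →₀ ℕ) :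
    coeff α (∏ k, Polynomial.aeval (X k : MvPolynomial (Fin n) ℂ) (p k)) =
      ∏ k, (p k).coeff (α k) := by
  set D := ∑ k, ((p k).natDegree + 1 + α k)
  have hD : ∀ k, (p k).natDegree + 1 + α k ≤ D := fun k =>
    Finset.single_le_sum (f := fun k => (p k).natDegree + 1 + α k) (fun _ _ => Nat.zero_le _)
      (Finset.mem_univ k)
  have hα : ⇑α ∈ Fintype.piFinset (fun _ : Fin n => Finset.range D) := by
    rw [Fintype.mem_piFinset]; intro k; have := hD k; simp; omega
  rw [prod_aeval_X_eq_sum p (D := D) (fun k => by have := hD k; omega), coeff_sum,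
    Finset.sum_eq_single (⇑α)]
  · have : Finsupp.equivFunOnFinite.symm ⇑α = α := by ext; simp
    rw [this, coeff_monomial, if_pos rfl]
  · intro f _ hf
    rw [coeff_monomial, if_neg]
    rintro rfl
    exact hf (by ext; simp)
  · exact fun h => absurd hα h

/-- Row `k` involves only the variable `X k`, so each term of the determinant factors over the
variables and coefficients can be taken row by row. -/
theorem coeff_det_aeval_X {n : ℕ} (p : Fin n → Polynomial ℂ) (α : Fin n →₀ ℕ) :
    coeff α (Matrix.of fun k j : Fin n =>
        Polynomial.aeval (X k : MvPolynomial (Fin n) ℂ) (p j)).det =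
      (Matrix.of fun k j : Fin n => (p j).coeff (α k)).det := by
  rw [← Matrix.det_transpose, ← Matrix.det_transpose (Matrix.of fun k j : Fin n => (p j).coeff (α k)),
    Matrix.det_apply, Matrix.det_apply, coeff_sum]
  refine Finset.sum_congr rfl fun σ _ => ?_
  simp only [Matrix.transpose_apply, Matrix.of_apply]
  rw [Units.smul_def, Units.smul_def, coeff_smul, coeff_prod_aeval_X]

/-- The Vandermonde determinant of the variables. -/
noncomputable def vdmPoly (n : ℕ) : MvPolynomial (Fin n) ℂ := (vandermonde X).det

theorem eval_vdmPoly {n : ℕ} (x : Fin n → ℂ) : eval x (vdmPoly n) = (vandermonde x).det := by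
  rw [vdmPoly, RingHom.map_det]
  congr 1
  ext i j
  simp [vandermonde_apply]

theorem vdmPoly_ne_zero (n : ℕ) : vdmPoly n ≠ 0 :=
  det_vandermonde_ne_zero_iff.2 (X_injective)

theorem vdmPoly_mul_prod_aeval {n : ℕ} (p : Polynomial ℂ) :
    vdmPoly n * ∏ k, Polynomial.aeval (X k : MvPolynomial (Fin n) ℂ) p =
      (Matrix.of fun k j : Fin n =>
        Polynomial.aeval (X k : MvPolynomial (Fin n) ℂ) (Polynomial.X ^ (j : ℕ) * p)).det := by
  rw [mul_comm, vdmPoly, ← Matrix.det_mul_column]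
  congr 1
  ext1 k j
  simp [vandermonde_apply, mul_comm]

theorem coeff_vdmPoly_ne_zero {n : ℕ} {α : Fin n →₀ ℕ} (h : coeff α (vdmPoly n) ≠ 0) :
    ∃ σ : Equiv.Perm (Fin n), ∀ k, α k = σ k := by
  have h1 := vdmPoly_mul_prod_aeval (n := n) 1
  simp only [map_one, Finset.prod_const_one, mul_one] at h1
  rw [h1] at h
  rw [coeff_det_aeval_X, ← Matrix.det_transpose, Matrix.det_apply] at h
  obtain ⟨σ, _, hσ⟩ := Finset.exists_ne_zero_of_sum_ne_zero h
  refine ⟨σ, fun k => ?_⟩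
  by_contra hk
  apply hσ
  rw [Finset.prod_eq_zero (Finset.mem_univ k), smul_zero]
  simp [Matrix.transpose_apply, Polynomial.coeff_X_pow, hk]

theorem sum_eulerOp_vdmPoly (n : ℕ) : ∃ c : ℂ, ∑ k, eulerOp k (vdmPoly n) = c • vdmPoly n := by
  refine ⟨∑ k : Fin n, (k : ℂ), ?_⟩
  ext α
  rw [coeff_sum, coeff_smul, smul_eq_mul]
  simp only [coeff_eulerOp, ← Finset.sum_mul]
  by_cases h : coeff α (vdmPoly n) = 0
  · simp [h]
  · obtain ⟨σ, hσ⟩ := coeff_vdmPoly_ne_zero h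
    simp only [hσ]
    rw [Equiv.sum_comp σ fun k : Fin n => ((k : ℕ) : ℂ)]

/-- The exponents of every monomial of the Vandermonde polynomial are a permutation of `0, …, n -
1`, so a symmetric expression in them is constant. -/
theorem sum_eulerOp_eulerOp_vdmPoly (n : ℕ) :
    ∃ c : ℂ, ∑ k, ∑ l ∈ Finset.univ.erase k, eulerOp k (eulerOp l (vdmPoly n)) =
      c • vdmPoly n := by
  refine ⟨∑ k : Fin n, ∑ l ∈ Finset.univ.erase k, (k : ℂ) * l, ?_⟩
  ext α
  rw [coeff_sum, coeff_smul, smul_eq_mul]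
  simp only [coeff_sum, coeff_eulerOp, ← mul_assoc, ← Finset.sum_mul]
  by_cases h : coeff α (vdmPoly n) = 0
  · simp [h]
  · obtain ⟨σ, hσ⟩ := coeff_vdmPoly_ne_zero h
    simp only [hσ]
    congr 1
    rw [← Equiv.sum_comp σ fun k : Fin n => ∑ l ∈ Finset.univ.erase k, ((k : ℕ) : ℂ) * l]
    refine Finset.sum_congr rfl fun k _ => ?_
    refine Finset.sum_equiv σ (by simp) (by simp)

theorem eval_derivation_prod {n : ℕ} {ι : Type*}
    (D : Derivation ℂ (MvPolynomial (Fin n) ℂ) (MvPolynomial (Fin n) ℂ)) (x : Fin n → ℂ)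
    (s : Finset ι) (f : ι → MvPolynomial (Fin n) ℂ) (hf : ∀ i ∈ s, eval x (f i) ≠ 0) :
    eval x (D (∏ i ∈ s, f i)) =
      eval x (∏ i ∈ s, f i) * ∑ i ∈ s, eval x (D (f i)) / eval x (f i) := by
  classical
  induction s using Finset.induction_on with
  | empty => simp
  | insert a s ha ih =>
    rw [Finset.prod_insert ha, Finset.sum_insert ha, Derivation.leibniz, map_add, smul_eq_mul,
      smul_eq_mul, map_mul, map_mul, map_mul, ih fun i hi => hf i (Finset.mem_insert_of_mem hi)]
    have := hf a (Finset.mem_insert_self a s)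
    field_simp
    ring

/-- Logarithmic differentiation of `∏_{i<j} (x_j - x_i)`: every factor containing `x_k` contributes
`x_k / (x_k - x_l)`, whichever index is the larger. -/
theorem eval_eulerOp_vdmPoly {n : ℕ} (x : Fin n → ℂ) (hx : Function.Injective x) (k : Fin n) :
    eval x (eulerOp k (vdmPoly n)) =
      (vandermonde x).det * ∑ l ∈ Finset.univ.erase k, x k / (x k - x l) := by
  have hne : ∀ i j : Fin n, i ≠ j → x j - x i ≠ 0 := fun i j h h0 =>
    h (hx (sub_eq_zero.1 h0)).symm
  rw [← eval_vdmPoly, vdmPoly, det_vandermonde, Finset.prod_sigma', eval_derivation_prod]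
  · congr 1
    have hX : ∀ j, eval x (eulerOp k (X j)) = if j = k then x k else 0 := by
      intro j
      have := eulerOp_aeval_X k j (Polynomial.X)
      rw [Polynomial.aeval_X] at this
      rw [this]; split_ifs <;> simp
    rw [Finset.sum_sigma]
    simp only [map_sub, hX, eval_X]
    have h1 : ∀ i : Fin n, ∑ j ∈ Finset.Ioi i,
        ((if j = k then x k else 0) - (if i = k then x k else 0)) / (x j - x i) =
        ∑ j, if i < j then
        ((if j = k then x k else 0) - (if i = k then x k else 0)) / (x j - x i) else 0 := by
      intro i
      rw [← Finset.sum_filter]; congr 1; ext j; simp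
    simp only [h1]
    have h2 : ∀ i j : Fin n, (if i < j then
        ((if j = k then x k else 0) - (if i = k then x k else 0)) / (x j - x i) else 0) =
        (if j = k then (if i < k then x k / (x k - x i) else 0) else 0) +
        (if i = k then (if k < j then x k / (x k - x j) else 0) else 0) := by
      intro i j
      by_cases hj : j = k
      · subst hj
        by_cases hi : i = j
        · subst hi; simp
        · simp [hi]
      · by_cases hi : i = k
        · subst hi
          simp only [hj, if_false, if_true, zero_add, zero_sub]
          split_ifs with h
          · rw [← neg_sub (x j) (x i), neg_div, div_neg]
          · rfl
        · simp [hi, hj]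
    simp only [h2, Finset.sum_add_distrib, Finset.sum_ite_eq', Finset.mem_univ, if_true]
    rw [Finset.sum_comm]
    simp only [Finset.sum_ite_eq', Finset.mem_univ, if_true]
    have h3 : ∑ l ∈ Finset.univ.erase k, x k / (x k - x l) =
        ∑ l, if l ≠ k then x k / (x k - x l) else 0 := by
      rw [← Finset.sum_filter]; congr 1; ext j; simp
    rw [h3, ← Finset.sum_add_distrib]
    refine Finset.sum_congr rfl fun l _ => ?_
    rcases lt_trichotomy l k with h | h | h
    · simp [h, h.ne, h.not_gt]
    · simp [h]
    · simp [h, h.ne', h.not_gt]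
  · rintro ⟨i, j⟩ hij
    simp only [Finset.mem_sigma, Finset.mem_Ioi] at hij
    simpa using hne i j hij.2.ne

end EulerOperators

/-! ### Differential equations for the mean of a product of characteristic polynomials. -/

section EigenvalueEquations

open Matrix MeasureTheory MvPolynomial

/-- The polynomial `∏ k, χ(X k)`, with `χ` the characteristic polynomial. -/
noncomputable def charProd {N : ℕ} (n : ℕ) (U : Matrix (Fin N) (Fin N) ℂ) :
    MvPolynomial (Fin n) ℂ :=
  ∏ k, Polynomial.aeval (X k : MvPolynomial (Fin n) ℂ) U.charpoly

/-- The integrand stays in a finite-dimensional space of polynomials, so it can be averaged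
coefficientwise. Quantifying over all linear functionals lets evaluation, differentiation and
coefficient extraction commute with the mean at once, with no differentiation under the integral. -/
theorem exists_haarMean_charProd (N m n : ℕ) : ∃ H : MvPolynomial (Fin n) ℂ,
    ∀ L : MvPolynomial (Fin n) ℂ →ₗ[ℂ] ℂ,
      L H = haarMean N m (fun U => L (charProd n (U : Matrix (Fin N) (Fin N) ℂ))) ∧
      Continuous fun U : Matrix.unitaryGroup (Fin N) ℂ =>
        L (charProd n (U : Matrix (Fin N) (Fin N) ℂ)) := by
  set S := Fintype.piFinset (fun _ : Fin n => Finset.range (N + 1))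
  have h1 : ∀ U : Matrix (Fin N) (Fin N) ℂ, charProd n U =
      ∑ f ∈ S, monomial (Finsupp.equivFunOnFinite.symm f) (∏ k, U.charpoly.coeff (f k)) := by
    intro U
    exact prod_aeval_X_eq_sum (fun _ => U.charpoly) (fun _ => by
      rw [Matrix.charpoly_natDegree_eq_dim]; simp)
  have hmon : ∀ (L : MvPolynomial (Fin n) ℂ →ₗ[ℂ] ℂ) (α : Fin n →₀ ℕ) (c : ℂ),
      L (monomial α c) = L (monomial α 1) * c := by
    intro L α c
    have : monomial α c = c • monomial α (1 : ℂ) := by rw [smul_monomial, smul_eq_mul, mul_one]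
    rw [this, map_smul, smul_eq_mul, mul_comm]
  have hc : ∀ f : Fin n → ℕ, Continuous fun U : Matrix.unitaryGroup (Fin N) ℂ =>
      ∏ k, (U : Matrix (Fin N) (Fin N) ℂ).charpoly.coeff (f k) := fun f =>
    continuous_finsetProd _ fun k _ => (continuous_charpoly_coeff _).comp continuous_subtype_val
  refine ⟨∑ f ∈ S, monomial (Finsupp.equivFunOnFinite.symm f)
    (haarMean N m fun U => ∏ k, (U : Matrix (Fin N) (Fin N) ℂ).charpoly.coeff (f k)), fun L => ?_⟩
  have hL : ∀ U : Matrix (Fin N) (Fin N) ℂ, L (charProd n U) =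
      ∑ f ∈ S, L (monomial (Finsupp.equivFunOnFinite.symm f) 1) *
        ∏ k, U.charpoly.coeff (f k) := by
    intro U
    rw [h1, map_sum]
    exact Finset.sum_congr rfl fun f _ => hmon _ _ _
  constructor
  · simp only [hL]
    rw [haarMean_sum S (fun (f : Fin n → ℕ) (U : Matrix.unitaryGroup (Fin N) ℂ) => L (monomial (Finsupp.equivFunOnFinite.symm f) 1) *
        ∏ k, (U : Matrix (Fin N) (Fin N) ℂ).charpoly.coeff (f k))
        (fun f => continuous_const.mul (hc f)), map_sum]
    refine Finset.sum_congr rfl fun f _ => ?_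
    rw [hmon, haarMean_const_mul]
  · simp only [hL]
    exact continuous_finsetSum _ fun f _ => continuous_const.mul (hc f)

theorem eval_aeval_X {n : ℕ} (x : Fin n → ℂ) (k : Fin n) (p : Polynomial ℂ) :
    eval x (Polynomial.aeval (X k : MvPolynomial (Fin n) ℂ) p) = p.eval (x k) := by
  have := Polynomial.aeval_algHom_apply (aeval x : MvPolynomial (Fin n) ℂ →ₐ[ℂ] ℂ) (X k) p
  rw [aeval_X, Polynomial.coe_aeval_eq_eval] at this
  rw [this]
  exact (DFunLike.congr_fun (coe_aeval_eq_eval x) _).symm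

theorem eval_charProd {N n : ℕ} (U : Matrix (Fin N) (Fin N) ℂ) (x : Fin n → ℂ) :
    eval x (charProd n U) = ∏ k, U.charpoly.eval (x k) := by
  simp only [charProd, map_prod, eval_aeval_X]

theorem derivation_prod {ι A : Type*} [DecidableEq ι] [CommRing A] [Algebra ℂ A]
    (D : Derivation ℂ A A) (s : Finset ι) (f : ι → A) :
    D (∏ i ∈ s, f i) = ∑ i ∈ s, (∏ j ∈ s.erase i, f j) * D (f i) := by
  induction s using Finset.induction_on with
  | empty => simp
  | insert a s ha ih =>
    rw [Finset.prod_insert ha, Finset.sum_insert ha, Derivation.leibniz, ih, smul_eq_mul,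
      smul_eq_mul, Finset.erase_insert ha, add_comm, Finset.mul_sum]
    congr 1
    refine Finset.sum_congr rfl fun i hi => ?_
    have hne : a ≠ i := fun h => ha (h ▸ hi)
    rw [Finset.erase_insert_of_ne hne, Finset.prod_insert (by simp [ha]), mul_assoc]

theorem eulerOp_prod_aeval {n : ℕ} (s : Finset (Fin n)) (p : Polynomial ℂ) (k : Fin n) :
    eulerOp k (∏ j ∈ s, Polynomial.aeval (X j : MvPolynomial (Fin n) ℂ) p) =
      if k ∈ s then (∏ j ∈ s.erase k, Polynomial.aeval (X j : MvPolynomial (Fin n) ℂ) p) *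
        (X k * Polynomial.aeval (X k : MvPolynomial (Fin n) ℂ) (Polynomial.derivative p))
      else 0 := by
  rw [derivation_prod]
  simp only [eulerOp_aeval_X, mul_ite, mul_zero, Finset.sum_ite_eq']

theorem eval_eulerOp_charProd {N n : ℕ} (U : Matrix (Fin N) (Fin N) ℂ) (x : Fin n → ℂ)
    (k : Fin n) :
    eval x (eulerOp k (charProd n U)) =
      (∏ j ∈ Finset.univ.erase k, U.charpoly.eval (x j)) *
        (x k * (Polynomial.derivative U.charpoly).eval (x k)) := by
  rw [charProd, eulerOp_prod_aeval, if_pos (Finset.mem_univ k)]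
  simp only [map_mul, map_prod, eval_aeval_X, eval_X]

theorem eval_eulerOp_eulerOp_charProd {N n : ℕ} (U : Matrix (Fin N) (Fin N) ℂ) (x : Fin n → ℂ)
    (k l : Fin n) (h : k ≠ l) :
    eval x (eulerOp k (eulerOp l (charProd n U))) =
      (∏ j ∈ (Finset.univ.erase k).erase l, U.charpoly.eval (x j)) *
        (x k * (Polynomial.derivative U.charpoly).eval (x k)) *
        (x l * (Polynomial.derivative U.charpoly).eval (x l)) := by
  have hX : eulerOp k (X l : MvPolynomial (Fin n) ℂ) = 0 := by
    have := eulerOp_aeval_X k l Polynomial.X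
    rwa [Polynomial.aeval_X, if_neg h.symm] at this
  have key : eulerOp k (eulerOp l (charProd n U)) =
      (∏ j ∈ (Finset.univ.erase k).erase l,
          Polynomial.aeval (X j : MvPolynomial (Fin n) ℂ) U.charpoly) *
        (X k * Polynomial.aeval (X k : MvPolynomial (Fin n) ℂ)
          (Polynomial.derivative U.charpoly)) *
        (X l * Polynomial.aeval (X l : MvPolynomial (Fin n) ℂ)
          (Polynomial.derivative U.charpoly)) := by
    rw [charProd, eulerOp_prod_aeval, if_pos (Finset.mem_univ l), Derivation.leibniz,
      Derivation.leibniz, hX, eulerOp_aeval_X, if_neg h.symm, eulerOp_prod_aeval,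
      if_pos (by simp [h]), Finset.erase_right_comm]
    simp only [smul_eq_mul]
    ring
  rw [key]
  simp only [map_mul, map_prod, eval_aeval_X, eval_X]

/-- The first order relation satisfied by the mean of `∏ k, χ(x k)`. -/
theorem exists_sum_eulerOp_haarMean {N m n : ℕ} {H : MvPolynomial (Fin n) ℂ}
    (hH : ∀ L : MvPolynomial (Fin n) ℂ →ₗ[ℂ] ℂ,
      L H = haarMean N m (fun U => L (charProd n (U : Matrix (Fin N) (Fin N) ℂ))) ∧
      Continuous fun U : Matrix.unitaryGroup (Fin N) ℂ =>
        L (charProd n (U : Matrix (Fin N) (Fin N) ℂ))) :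
    ∃ K : ℂ, ∀ x : Fin n → ℂ, ∑ k, eval x (eulerOp k H) = K * eval x H := by
  obtain ⟨K, hK⟩ := exists_haarMean_trace (N := N) (m := m) (n := n)
  -- Each trace equals `x χ'(x) - N χ(x)`; the `n` terms `-N χ` account for the shift `n * N`.
  refine ⟨K + n * N, fun x => ?_⟩
  set ev : MvPolynomial (Fin n) ℂ →ₗ[ℂ] ℂ := (aeval x).toLinearMap with hev
  have hev' : ∀ p, ev p = eval x p := fun p =>
    DFunLike.congr_fun (coe_aeval_eq_eval x) p
  set L : MvPolynomial (Fin n) ℂ →ₗ[ℂ] ℂ :=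
    ∑ k, ev ∘ₗ (eulerOp k).toLinearMap - ((n * N : ℂ)) • ev with hL
  have hL' : ∀ p, L p = ∑ k, eval x (eulerOp k p) - (n * N) * eval x p := by
    intro p
    simp [hL, hev', LinearMap.sum_apply]
  have h0 : eval x H = haarMean N m
        (fun U => ∏ k, (U : Matrix (Fin N) (Fin N) ℂ).charpoly.eval (x k)) := by
    rw [← hev', (hH ev).1]
    simp only [hev', eval_charProd]
  have h1 := (hH L).1
  rw [hL'] at h1
  have h2 : ∀ U : Matrix (Fin N) (Fin N) ℂ, L (charProd n U) =
      ∑ k, (∏ j ∈ Finset.univ.erase k, U.charpoly.eval (x j)) * (resolventNum U (x k)).trace := by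
    intro U
    rw [hL', eval_charProd]
    simp only [eval_eulerOp_charProd, trace_resolventNum, mul_sub, Finset.sum_sub_distrib]
    congr 1
    have : ∀ k ∈ (Finset.univ : Finset (Fin n)), (∏ j ∈ Finset.univ.erase k, U.charpoly.eval (x j)) *
        (N * U.charpoly.eval (x k)) = N * ∏ j, U.charpoly.eval (x j) := by
      intro k hk
      rw [← Finset.prod_erase_mul _ _ hk]; ring
    rw [Finset.sum_congr rfl this]
    simp [mul_assoc]
  simp only [h2] at h1
  rw [hK x, ← h0] at h1
  linear_combination h1

/-- The second order relation satisfied by the mean of `∏ k, χ(x k)`. -/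
theorem exists_sum_eulerOp_eulerOp_haarMean {N m n : ℕ} {H : MvPolynomial (Fin n) ℂ}
    (hH : ∀ L : MvPolynomial (Fin n) ℂ →ₗ[ℂ] ℂ,
      L H = haarMean N m (fun U => L (charProd n (U : Matrix (Fin N) (Fin N) ℂ))) ∧
      Continuous fun U : Matrix.unitaryGroup (Fin N) ℂ =>
        L (charProd n (U : Matrix (Fin N) (Fin N) ℂ))) :
    ∃ K : ℂ, ∀ x : Fin n → ℂ, Function.Injective x →
      ∑ k, ∑ l ∈ Finset.univ.erase k, (eval x (eulerOp k (eulerOp l H)) -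
        N * eval x (eulerOp k H) - N * eval x (eulerOp l H) -
        (x k * eval x (eulerOp k H) - x l * eval x (eulerOp l H)) / (x k - x l)) =
      K * eval x H := by
  obtain ⟨K, hK⟩ := exists_haarMean_trace_mul_trace (N := N) (m := m) (n := n)
  -- For each pair, `N ^ 2` comes from the product of the two traces and `N` from the trace of the
  -- product, after the resolvent identity.
  refine ⟨K - ∑ k : Fin n, ∑ l ∈ Finset.univ.erase k, (N ^ 2 + N : ℂ), fun x hx => ?_⟩
  set ev : MvPolynomial (Fin n) ℂ →ₗ[ℂ] ℂ := (aeval x).toLinearMap with hev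
  have hev' : ∀ p, ev p = eval x p := fun p =>
    DFunLike.congr_fun (coe_aeval_eq_eval x) p
  set L : MvPolynomial (Fin n) ℂ →ₗ[ℂ] ℂ :=
    ∑ k, ∑ l ∈ Finset.univ.erase k, (ev ∘ₗ (eulerOp k).toLinearMap ∘ₗ (eulerOp l).toLinearMap -
      (N : ℂ) • ev ∘ₗ (eulerOp k).toLinearMap - (N : ℂ) • ev ∘ₗ (eulerOp l).toLinearMap -
      (x k - x l)⁻¹ • (x k • ev ∘ₗ (eulerOp k).toLinearMap - x l • ev ∘ₗ (eulerOp l).toLinearMap) +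
      (N ^ 2 + N : ℂ) • ev) with hL
  have hL' : ∀ p, L p = ∑ k, ∑ l ∈ Finset.univ.erase k, (eval x (eulerOp k (eulerOp l p)) -
        N * eval x (eulerOp k p) - N * eval x (eulerOp l p) -
        (x k * eval x (eulerOp k p) - x l * eval x (eulerOp l p)) / (x k - x l) +
        (N ^ 2 + N) * eval x p) := by
    intro p
    simp only [hL, LinearMap.sum_apply, LinearMap.add_apply, LinearMap.sub_apply,
      LinearMap.smul_apply, LinearMap.comp_apply, hev', smul_eq_mul, Derivation.coeFn_coe]
    refine Finset.sum_congr rfl fun k _ => Finset.sum_congr rfl fun l _ => ?_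
    ring
  have h0 : eval x H = haarMean N m
        (fun U => ∏ k, (U : Matrix (Fin N) (Fin N) ℂ).charpoly.eval (x k)) := by
    rw [← hev', (hH ev).1]
    simp only [hev', eval_charProd]
  have h1 := (hH L).1
  rw [hL'] at h1
  have h2 : ∀ U : Matrix (Fin N) (Fin N) ℂ, L (charProd n U) =
      ∑ k, ∑ l ∈ Finset.univ.erase k, (∏ j ∈ (Finset.univ.erase k).erase l, U.charpoly.eval (x j)) *
        ((resolventNum U (x k)).trace * (resolventNum U (x l)).trace +
          (resolventNum U (x k) * resolventNum U (x l)).trace) := by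
    intro U
    rw [hL', eval_charProd]
    refine Finset.sum_congr rfl fun k _ => Finset.sum_congr rfl fun l hl => ?_
    have hkl : k ≠ l := (Finset.ne_of_mem_erase hl).symm
    have hne : x k - x l ≠ 0 := fun h => hkl (hx (sub_eq_zero.1 h))
    have e1 : ∏ j ∈ Finset.univ.erase k, U.charpoly.eval (x j) =
        (∏ j ∈ (Finset.univ.erase k).erase l, U.charpoly.eval (x j)) * U.charpoly.eval (x l) :=
      (Finset.prod_erase_mul _ _ hl).symm
    have e2 : ∏ j ∈ Finset.univ.erase l, U.charpoly.eval (x j) =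
        (∏ j ∈ (Finset.univ.erase k).erase l, U.charpoly.eval (x j)) * U.charpoly.eval (x k) := by
      rw [Finset.erase_right_comm]
      exact (Finset.prod_erase_mul _ _ (by simp [hkl])).symm
    have e3 : ∏ j, U.charpoly.eval (x j) =
        (∏ j ∈ (Finset.univ.erase k).erase l, U.charpoly.eval (x j)) * U.charpoly.eval (x l) *
          U.charpoly.eval (x k) := by
      rw [← e1, Finset.prod_erase_mul _ _ (Finset.mem_univ k)]
    have e4 : (resolventNum U (x k) * resolventNum U (x l)).trace =
        (x l * U.charpoly.eval (x k) * (resolventNum U (x l)).trace -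
          x k * U.charpoly.eval (x l) * (resolventNum U (x k)).trace) / (x k - x l) := by
      have := congrArg Matrix.trace (resolventNum_mul U (x k) (x l))
      simp only [Matrix.trace_smul, Matrix.trace_sub, smul_eq_mul] at this
      rw [eq_div_iff hne, ← this, mul_comm]
    rw [e3, e4, eval_eulerOp_eulerOp_charProd U x k l hkl, eval_eulerOp_charProd,
      eval_eulerOp_charProd, e1, e2, trace_resolventNum, trace_resolventNum]
    field_simp
    ring
  simp only [h2] at h1
  rw [hK x, ← h0] at h1
  simp only [Finset.sum_add_distrib, ← Finset.sum_mul] at h1 ⊢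
  rw [sub_mul, ← h1]
  ring

end EigenvalueEquations

/-! ### Conjugation by the Vandermonde polynomial. -/

section MeanAlternant

open Matrix MeasureTheory MvPolynomial

/-- Multiplying the difference by the Vandermonde polynomial kills it at points with coinciding
coordinates as well, and the polynomial ring is a domain. The second-order equation, with its
denominators, is available only off the diagonals. -/
theorem eq_of_vdmPoly_eval {n : ℕ} {p q : MvPolynomial (Fin n) ℂ}
    (h : ∀ x : Fin n → ℂ, Function.Injective x → eval x p = eval x q) : p = q := by
  have h0 : vdmPoly n * (p - q) = 0 := by
    refine MvPolynomial.funext fun x => ?_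
    rw [map_mul, eval_vdmPoly, map_zero, map_sub]
    by_cases hx : Function.Injective x
    · rw [h x hx, sub_self, mul_zero]
    · have : (vandermonde x).det = 0 := by
        by_contra h0
        exact hx (det_vandermonde_ne_zero_iff.1 h0)
      rw [this, zero_mul]
  exact sub_eq_zero.1 ((mul_eq_zero.1 h0).resolve_left (vdmPoly_ne_zero n))

/-- The singular term of the Casimir equation, multiplied by `V`, sums to `2 ∑ V₁ k * h₁ k`. The
Leibniz cross terms run only over `k ≠ l`, so they are products of full sums minus exactly this
amount; the two cancel and only constants multiply `V * h`. -/
theorem sum_leibniz_expansion {n : ℕ} {V h c₁ c₂ K K' N : ℂ} {x : Fin n → ℂ} (V₁ h₁ : Fin n → ℂ)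
    (V₂ h₂ : Fin n → Fin n → ℂ) (hV₁ : ∑ k, V₁ k = c₁ * V)
    (hV₂ : ∑ k, ∑ l ∈ Finset.univ.erase k, V₂ k l = c₂ * V) (hh₁ : ∑ k, h₁ k = K * h)
    (hh₂ : ∑ k, ∑ l ∈ Finset.univ.erase k, (h₂ k l - N * h₁ k - N * h₁ l -
      (x k * h₁ k - x l * h₁ l) / (x k - x l)) = K' * h)
    (hVk : ∀ k, V₁ k = V * ∑ l ∈ Finset.univ.erase k, x k / (x k - x l)) :
    ∑ k, ∑ l ∈ Finset.univ.erase k, (V * h₂ k l + V₁ k * h₁ l + V₁ l * h₁ k + V₂ k l * h) =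
      (c₂ + 2 * c₁ * K + K' + 2 * N * (n - 1) * K) * (V * h) := by
  have hcard : ∀ k : Fin n, ((Finset.univ.erase k).card : ℂ) = n - 1 := by
    intro k
    rw [Finset.card_erase_of_mem (Finset.mem_univ k), Finset.card_univ,
      Fintype.card_fin, Nat.cast_sub (by have := k.2; omega)]
    simp
  have e1 : ∑ k, ∑ l ∈ Finset.univ.erase k, V₁ l * h₁ k = c₁ * V * (K * h) - ∑ k, V₁ k * h₁ k := by
    have : ∀ k, ∑ l ∈ Finset.univ.erase k, V₁ l * h₁ k = c₁ * V * h₁ k - V₁ k * h₁ k := by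
      intro k
      rw [← Finset.sum_mul, ← hV₁, ← Finset.add_sum_erase _ V₁ (Finset.mem_univ k)]
      ring
    simp only [this, Finset.sum_sub_distrib, ← Finset.mul_sum, hh₁]
  have e1' : ∑ k, ∑ l ∈ Finset.univ.erase k, V₁ k * h₁ l =
      c₁ * V * (K * h) - ∑ k, V₁ k * h₁ k := by
    rw [← e1, sum_sum_erase_comm]
  have e0 : ∑ k, ∑ l ∈ Finset.univ.erase k, V * (x k * h₁ k / (x k - x l)) =
      ∑ k, V₁ k * h₁ k := by
    refine Finset.sum_congr rfl fun k _ => ?_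
    rw [hVk, Finset.mul_sum, Finset.sum_mul]
    exact Finset.sum_congr rfl fun l _ => by ring
  have e2 : ∑ k, ∑ l ∈ Finset.univ.erase k, V * ((x k * h₁ k - x l * h₁ l) / (x k - x l)) =
      2 * ∑ k, V₁ k * h₁ k := by
    have : ∀ k l, V * ((x k * h₁ k - x l * h₁ l) / (x k - x l)) =
        V * (x k * h₁ k / (x k - x l)) + V * (x l * h₁ l / (x l - x k)) := by
      intro k l
      rw [← neg_sub (x k) (x l), div_neg]
      ring
    simp only [this, Finset.sum_add_distrib]
    rw [sum_sum_erase_comm fun k l => V * (x l * h₁ l / (x l - x k)), e0]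
    ring
  have e3 : ∑ k, ∑ _l ∈ Finset.univ.erase k, h₁ k = (n - 1) * (K * h) := by
    simp only [Finset.sum_const, nsmul_eq_mul, hcard, ← Finset.mul_sum, hh₁]
  have e4 : ∑ k, ∑ l ∈ Finset.univ.erase k, h₁ l = (n - 1) * (K * h) := by
    rw [← e3, sum_sum_erase_comm]
  simp only [Finset.sum_sub_distrib, ← Finset.mul_sum] at hh₂ e2
  rw [e3, e4] at hh₂
  simp only [Finset.sum_add_distrib, ← Finset.mul_sum, ← Finset.sum_mul] at e1 e1' ⊢
  rw [e1, e1', hV₂]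
  linear_combination V * hh₂ + e2

theorem exists_coeff_vdmPoly_mul_haarMean {N m n : ℕ} {H : MvPolynomial (Fin n) ℂ}
    (hH : ∀ L : MvPolynomial (Fin n) ℂ →ₗ[ℂ] ℂ,
      L H = haarMean N m (fun U => L (charProd n (U : Matrix (Fin N) (Fin N) ℂ))) ∧
      Continuous fun U : Matrix.unitaryGroup (Fin N) ℂ =>
        L (charProd n (U : Matrix (Fin N) (Fin N) ℂ))) :
    ∃ K₁ K₂ : ℂ, ∀ α : Fin n →₀ ℕ, coeff α (vdmPoly n * H) ≠ 0 →
      ∑ k, (α k : ℂ) = K₁ ∧ ∑ k, (α k : ℂ) ^ 2 = K₂ := by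
  obtain ⟨c₁, hc₁⟩ := sum_eulerOp_vdmPoly n
  obtain ⟨c₂, hc₂⟩ := sum_eulerOp_eulerOp_vdmPoly n
  obtain ⟨K, hK⟩ := exists_sum_eulerOp_haarMean hH
  obtain ⟨K', hK'⟩ := exists_sum_eulerOp_eulerOp_haarMean hH
  have first : ∑ k, eulerOp k (vdmPoly n * H) = (c₁ + K) • (vdmPoly n * H) := by
    refine MvPolynomial.funext fun x => ?_
    have h1 := congrArg (eval x) hc₁
    rw [map_sum, smul_eval] at h1
    rw [map_sum, smul_eval, map_mul]
    simp only [Derivation.leibniz, smul_eq_mul, map_add, map_mul, Finset.sum_add_distrib,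
      ← Finset.mul_sum]
    rw [h1, hK x]
    ring
  obtain ⟨K₂, second⟩ : ∃ K₂ : ℂ, ∑ k, ∑ l ∈ Finset.univ.erase k,
      eulerOp k (eulerOp l (vdmPoly n * H)) = K₂ • (vdmPoly n * H) := by
    refine ⟨c₂ + 2 * c₁ * K + K' + 2 * N * (n - 1) * K, eq_of_vdmPoly_eval fun x hx => ?_⟩
    have h1 := congrArg (eval x) hc₁
    have h2 := congrArg (eval x) hc₂
    have h3 := hK x
    have h4 := hK' x hx
    rw [smul_eval, map_sum] at h1
    rw [smul_eval, map_sum] at h2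
    simp only [map_sum] at h2
    rw [smul_eval, map_sum]
    simp only [map_sum, Derivation.leibniz, smul_eq_mul, map_add, map_mul]
    have hVk : ∀ k, eval x (eulerOp k (vdmPoly n)) =
        eval x (vdmPoly n) * ∑ l ∈ Finset.univ.erase k, x k / (x k - x l) := fun k => by
      rw [eval_vdmPoly]; exact eval_eulerOp_vdmPoly x hx k
    have := sum_leibniz_expansion (fun k => eval x (eulerOp k (vdmPoly n)))
      (fun k => eval x (eulerOp k H)) (fun k l => eval x (eulerOp k (eulerOp l (vdmPoly n))))
      (fun k l => eval x (eulerOp k (eulerOp l H))) h1 h2 h3 h4 hVk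
    rw [← this]
    exact Finset.sum_congr rfl fun k _ => Finset.sum_congr rfl fun l _ => by ring
  -- The operators return `∑ α_k` and `∑_{k≠l} α_k α_l`; the sum of squares is the square of the
  -- first minus the second.
  refine ⟨c₁ + K, (c₁ + K) ^ 2 - K₂, fun α hα => ?_⟩
  have h1 := congrArg (coeff α) first
  have h2 := congrArg (coeff α) second
  simp only [coeff_sum, coeff_eulerOp, coeff_smul, smul_eq_mul, ← mul_assoc, ← Finset.sum_mul] at h1 h2
  have h1' := mul_right_cancel₀ hα h1
  have h2' := mul_right_cancel₀ hα h2
  refine ⟨h1', ?_⟩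
  rw [← h1', ← h2', sq (∑ k, (α k : ℂ)), Finset.sum_mul_sum, ← Finset.sum_sub_distrib]
  refine Finset.sum_congr rfl fun k _ => ?_
  rw [← Finset.add_sum_erase _ _ (Finset.mem_univ k)]
  ring

end MeanAlternant

/-! ### Identification of the mean with a single alternant. -/

section Alternant

open Matrix MeasureTheory MvPolynomial

/-- The exponents `0, …, m - 1, N + m, …, N + n - 1`. -/
def gapExp (N m n : ℕ) (l : Fin n) : ℕ := if (l : ℕ) < m then l else N + l

theorem gapExp_injective (N m n : ℕ) : Function.Injective (gapExp N m n) := by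
  intro a b h
  simp only [gapExp] at h
  ext
  split_ifs at h <;> omega

theorem gapExp_lt {N m n : ℕ} (l : Fin n) : gapExp N m n l < N + n := by
  have := l.2
  simp only [gapExp]
  split_ifs <;> omega

/-- A determinant whose non-zero entries go up for an injective weight is the product of its
diagonal. -/
theorem det_eq_prod_diag_of_le {n : ℕ} {R : Type*} [CommRing R] (M : Matrix (Fin n) (Fin n) R)
    (b : Fin n → ℕ) (hb : Function.Injective b) (h : ∀ k j, M k j ≠ 0 → b k ≤ b j) :
    M.det = ∏ k, M k k := by
  rw [← Matrix.det_transpose, Matrix.det_apply, Finset.sum_eq_single 1]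
  · simp
  · intro σ _ hσ
    by_contra hne
    apply hσ
    have hle : ∀ k, b k ≤ b (σ k) := by
      intro k
      by_contra hk
      apply hne
      rw [Finset.prod_eq_zero (Finset.mem_univ k), smul_zero]
      by_contra hM
      exact hk (h k (σ k) hM)
    have hsum : ∑ k, b k = ∑ k, b (σ k) := (Equiv.sum_comp σ b).symm
    have := (Finset.sum_eq_sum_iff_of_le fun k _ => hle k).1 hsum
    ext k
    rw [Equiv.Perm.one_apply, ← hb (this k (Finset.mem_univ k))]
  · simp

/-- Of all `n`-element subsets of `{0, …, N + n - 1}`, the complement of the gap `m, …, m + N - 1`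
is the unique one with the largest total squared distance from the centre of the gap, and that total
depends only on the sum and the sum of squares. -/
theorem exists_perm_of_gap {N m n : ℕ} (hmn : m ≤ n) (α : Fin n → ℕ) (hα : Function.Injective α)
    (hlt : ∀ k, α k < N + n) (h₁ : ∑ k, α k = ∑ k, gapExp N m n k)
    (h₂ : ∑ k, α k ^ 2 = ∑ k, gapExp N m n k ^ 2) :
    ∃ σ : Equiv.Perm (Fin n), ∀ k, α k = gapExp N m n (σ k) := by
  classical
  -- The centre of the gap is `(2m + N - 1) / 2`; doubling avoids halves. Then `φ ≤ (N - 1)^2`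
  -- inside the gap and `φ ≥ (N + 1)^2` on the exponents outside it.
  set φ : ℕ → ℤ := fun s => (2 * s - (2 * m + N - 1)) ^ 2 with hφ
  have hsum : ∀ β : Fin n → ℕ, ∑ k, φ (β k) = 4 * ((∑ k, β k ^ 2 : ℕ) : ℤ) -
      4 * (2 * m + N - 1) * ((∑ k, β k : ℕ) : ℤ) + n * (2 * m + N - 1) ^ 2 := by
    intro β
    have : ∀ k, φ (β k) = 4 * ((β k : ℤ) ^ 2) - 4 * (2 * m + N - 1) * (β k) +
      (2 * m + N - 1) ^ 2 := fun k => by simp only [hφ]; ring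
    simp only [this, Finset.sum_add_distrib, Finset.sum_sub_distrib, ← Finset.mul_sum]
    push_cast
    simp
  have hφeq : ∑ k, φ (α k) = ∑ k, φ (gapExp N m n k) := by rw [hsum, hsum, h₁, h₂]
  set S := Finset.univ.image α with hS
  set T := Finset.univ.image (gapExp N m n) with hT
  have hST : ∑ s ∈ S, φ s = ∑ s ∈ T, φ s := by
    rw [hS, hT, Finset.sum_image (fun _ _ _ _ h => hα h),
      Finset.sum_image (fun _ _ _ _ h => gapExp_injective N m n h), hφeq]
  have hcard : S.card = T.card := by
    rw [hS, hT, Finset.card_image_of_injective _ hα,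
      Finset.card_image_of_injective _ (gapExp_injective N m n)]
  have hin : ∀ s ∈ S \ T, φ s ≤ (N - 1 : ℤ) ^ 2 ∧ 0 < N := by
    intro s hs
    rw [Finset.mem_sdiff] at hs
    obtain ⟨k, -, rfl⟩ := Finset.mem_image.1 hs.1
    have h3 : m ≤ α k := by
      by_contra hlt'
      have hk : α k < n := by omega
      exact hs.2 (Finset.mem_image.2 ⟨⟨α k, hk⟩, Finset.mem_univ _, by simp [gapExp]; omega⟩)
    have h4 : α k < N + m := by
      by_contra hge
      have hk : α k - N < n := by have := hlt k; omega
      exact hs.2 (Finset.mem_image.2 ⟨⟨α k - N, hk⟩, Finset.mem_univ _, by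
        simp only [gapExp]; split_ifs <;> omega⟩)
    have h5 : 0 < N := by omega
    refine ⟨?_, h5⟩
    simp only [hφ]
    apply sq_le_sq'
    · omega
    · omega
  have hout : ∀ s ∈ T \ S, (N + 1 : ℤ) ^ 2 ≤ φ s := by
    intro s hs
    rw [Finset.mem_sdiff] at hs
    obtain ⟨k, -, rfl⟩ := Finset.mem_image.1 hs.1
    simp only [hφ, gapExp]
    split_ifs with h
    · rw [← neg_sq (2 * ((k : ℕ) : ℤ) - _)]
      apply pow_le_pow_left₀ <;> omega
    · apply pow_le_pow_left₀
      · omega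
      · push_cast; omega
  have hcd : (S \ T).card = (T \ S).card := by
    have e1 := Finset.card_sdiff_add_card_inter S T
    have e2 := Finset.card_sdiff_add_card_inter T S
    rw [Finset.inter_comm] at e2
    omega
  have hsd : ∑ s ∈ S \ T, φ s = ∑ s ∈ T \ S, φ s := by
    have e1 := Finset.sum_inter_add_sum_sdiff S T φ
    have e2 := Finset.sum_inter_add_sum_sdiff T S φ
    rw [Finset.inter_comm] at e2
    linarith
  have hempty : S \ T = ∅ := by
    by_contra hne
    obtain ⟨s₀, hs₀⟩ := Finset.nonempty_iff_ne_empty.2 hne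
    have hN := (hin s₀ hs₀).2
    have e1 : ∑ s ∈ S \ T, φ s ≤ (S \ T).card * (N - 1 : ℤ) ^ 2 := by
      rw [← nsmul_eq_mul]; exact Finset.sum_le_card_nsmul _ _ _ fun s hs => (hin s hs).1
    have e2 : (T \ S).card * (N + 1 : ℤ) ^ 2 ≤ ∑ s ∈ T \ S, φ s := by
      rw [← nsmul_eq_mul]; exact Finset.card_nsmul_le_sum _ _ _ fun s hs => hout s hs
    have hpos : (0 : ℤ) < (S \ T).card := by
      exact_mod_cast Finset.card_pos.2 ⟨s₀, hs₀⟩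
    rw [← hcd, ← hsd] at e2
    have hN' : (0 : ℤ) < N := by exact_mod_cast hN
    nlinarith [mul_pos hpos hN']
  have hsub : S ⊆ T := Finset.sdiff_eq_empty_iff_subset.1 hempty
  have hex : ∀ k, ∃ j, gapExp N m n j = α k := by
    intro k
    obtain ⟨j, -, hj⟩ := Finset.mem_image.1 (hsub (Finset.mem_image_of_mem α (Finset.mem_univ k)))
    exact ⟨j, hj⟩
  choose f hf using hex
  have hfi : Function.Injective f := fun a b hab => hα (by rw [← hf a, ← hf b, hab])
  exact ⟨Equiv.ofBijective f (Finite.injective_iff_bijective.1 hfi), fun k => (hf k).symm⟩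

theorem coeff_vdmPoly_mul_charProd {N n : ℕ} (U : Matrix (Fin N) (Fin N) ℂ) (α : Fin n →₀ ℕ) :
    coeff α (vdmPoly n * charProd n U) =
      (Matrix.of fun k j : Fin n => (Polynomial.X ^ (j : ℕ) * U.charpoly).coeff (α k)).det := by
  rw [charProd, vdmPoly_mul_prod_aeval, coeff_det_aeval_X]

/-- The first `m` rows read coefficients below the diagonal shift and the others read coefficients
near the top degree. The matrix is block diagonal, with a lower triangular block having `χ(0)` on
its diagonal and an upper unitriangular block. -/
theorem det_coeff_gapExp {N m n : ℕ} (hmn : m ≤ n) (U : Matrix (Fin N) (Fin N) ℂ) :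
    (Matrix.of fun k j : Fin n =>
      (Polynomial.X ^ (j : ℕ) * U.charpoly).coeff (gapExp N m n k)).det =
      (U.charpoly.coeff 0) ^ m := by
  have hdeg : U.charpoly.natDegree = N := by simp
  -- The weight reverses the order on the first block and keeps it on the second; even and odd
  -- values keep the two blocks apart.
  rw [det_eq_prod_diag_of_le _ (fun k => if (k : ℕ) < m then 2 * (m - 1 - k) else 2 * (k - m) + 1)]
  · have : ∀ k : Fin n, (Matrix.of fun k j : Fin n =>
      (Polynomial.X ^ (j : ℕ) * U.charpoly).coeff (gapExp N m n k)) k k =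
        if (k : ℕ) < m then U.charpoly.coeff 0 else 1 := by
      intro k
      simp only [Matrix.of_apply, Polynomial.coeff_X_pow_mul', gapExp]
      split_ifs with h1 h2 h3
      · simp
      · omega
      · have := U.charpoly_monic
        rw [Polynomial.Monic, Polynomial.leadingCoeff, hdeg] at this
        simpa using this
      · omega
    rw [Finset.prod_congr rfl fun k _ => this k, Finset.prod_ite, Finset.prod_const,
      Finset.prod_const_one, mul_one]
    congr 1
    have : (Finset.univ.filter fun k : Fin n => (k : ℕ) < m).card = m := by
      rw [Fin.card_filter_val_lt]; omega
    exact this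
  · intro a b h
    simp only at h
    ext
    split_ifs at h <;> omega
  · intro k j hkj
    simp only [Matrix.of_apply, Polynomial.coeff_X_pow_mul', gapExp] at hkj
    split_ifs at hkj with h1 h2 h3
    · simp only [h1, if_true]; split_ifs <;> omega
    · simp at hkj
    · have : ¬ N < N + (k : ℕ) - j := fun hlt => hkj
        (Polynomial.coeff_eq_zero_of_natDegree_lt (by rw [hdeg]; exact hlt))
      split_ifs <;> omega
    · simp at hkj

/-- The alternant with exponents `gapExp`. -/
noncomputable def gapAlternant (N m n : ℕ) : MvPolynomial (Fin n) ℂ :=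
  (Matrix.of fun k j : Fin n => (X k : MvPolynomial (Fin n) ℂ) ^ gapExp N m n j).det

theorem coeff_gapAlternant {N m n : ℕ} (α : Fin n →₀ ℕ) : coeff α (gapAlternant N m n) =
    (Matrix.of fun k j : Fin n => if α k = gapExp N m n j then (1 : ℂ) else 0).det := by
  have := coeff_det_aeval_X (fun j => Polynomial.X ^ gapExp N m n j) α
  simpa [gapAlternant, Polynomial.coeff_X_pow] using this

theorem det_of_comp_perm {n : ℕ} (f : ℕ → Fin n → ℂ) (e : Fin n → ℕ) (σ : Equiv.Perm (Fin n)) :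
    (Matrix.of fun k j : Fin n => f (e (σ k)) j).det =
      ((Equiv.Perm.sign σ : ℤ) : ℂ) * (Matrix.of fun k j : Fin n => f (e k) j).det := by
  have := Matrix.det_permute σ (Matrix.of fun k j : Fin n => f (e k) j)
  rw [← this]; rfl

/-- At the gap exponents the factor `det U ^ (-m)` cancels `χ_U(0) ^ m` up to sign, so that
coefficient is explicit and non-zero and fixes the two constants of the differential equations.
Antisymmetry then determines the coefficients at permuted exponents, and every other exponent vector
is excluded by `exists_perm_of_gap`. -/
theorem vdmPoly_mul_haarMean_eq_gapAlternant {N m n : ℕ} (hmn : m ≤ n) {H : MvPolynomial (Fin n) ℂ}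
    (hH : ∀ L : MvPolynomial (Fin n) ℂ →ₗ[ℂ] ℂ,
      L H = haarMean N m (fun U => L (charProd n (U : Matrix (Fin N) (Fin N) ℂ))) ∧
      Continuous fun U : Matrix.unitaryGroup (Fin N) ℂ =>
        L (charProd n (U : Matrix (Fin N) (Fin N) ℂ))) :
    vdmPoly n * H = ((-1 : ℂ) ^ N) ^ m • gapAlternant N m n := by
  have hw : ∀ α : Fin n →₀ ℕ, coeff α (vdmPoly n * H) = haarMean N m (fun U =>
      (Matrix.of fun k j : Fin n => (Polynomial.X ^ (j : ℕ) *
        (U : Matrix (Fin N) (Fin N) ℂ).charpoly).coeff (α k)).det) := by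
    intro α
    have := (hH ((MvPolynomial.lcoeff ℂ α) ∘ₗ LinearMap.mulLeft ℂ (vdmPoly n))).1
    simp only [LinearMap.comp_apply, LinearMap.mulLeft_apply, MvPolynomial.lcoeff_apply] at this
    rw [this]
    simp only [coeff_vdmPoly_mul_charProd]
  set e : Fin n →₀ ℕ := Finsupp.equivFunOnFinite.symm (gapExp N m n) with he
  have hek : ∀ k, e k = gapExp N m n k := fun k => rfl
  have hwe : coeff e (vdmPoly n * H) = ((-1 : ℂ) ^ N) ^ m := by
    rw [hw]
    simp only [hek, det_coeff_gapExp hmn]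
    have : ∀ U : Matrix.unitaryGroup (Fin N) ℂ,
        ((U : Matrix (Fin N) (Fin N) ℂ).det⁻¹) ^ m *
          ((U : Matrix (Fin N) (Fin N) ℂ).charpoly.coeff 0) ^ m = ((-1 : ℂ) ^ N) ^ m := by
      intro U
      have h0 := det_ne_zero_of_unitary U
      have h1 := Matrix.det_eq_sign_charpoly_coeff (U : Matrix (Fin N) (Fin N) ℂ)
      rw [Fintype.card_fin] at h1
      have h2 : (U : Matrix (Fin N) (Fin N) ℂ).charpoly.coeff 0 =
          (-1) ^ N * (U : Matrix (Fin N) (Fin N) ℂ).det := by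
        rw [h1, ← mul_assoc, ← mul_pow]; simp
      rw [h2, ← mul_pow]
      congr 1
      field_simp
    simp only [haarMean, this]
    simp
  have hne : coeff e (vdmPoly n * H) ≠ 0 := by
    rw [hwe]; simp
  obtain ⟨K₁, K₂, hK⟩ := exists_coeff_vdmPoly_mul_haarMean hH
  ext α
  rw [coeff_smul, coeff_gapAlternant, smul_eq_mul]
  by_cases hα : ∃ σ : Equiv.Perm (Fin n), ∀ k, α k = gapExp N m n (σ k)
  · obtain ⟨σ, hσ⟩ := hα
    rw [hw]
    simp only [hσ]
    have h1 : ∀ p : Polynomial ℂ, (Matrix.of fun k j : Fin n =>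
        (Polynomial.X ^ (j : ℕ) * p).coeff (gapExp N m n (σ k))).det =
        ((Equiv.Perm.sign σ : ℤ) : ℂ) * (Matrix.of fun k j : Fin n =>
        (Polynomial.X ^ (j : ℕ) * p).coeff (gapExp N m n k)).det := fun p =>
      det_of_comp_perm (fun a j => (Polynomial.X ^ (j : ℕ) * p).coeff a) _ σ
    have h2 := det_of_comp_perm (fun a j => if a = gapExp N m n j then (1 : ℂ) else 0)
      (gapExp N m n) σ
    have h3 : (Matrix.of fun k j : Fin n =>
        if gapExp N m n k = gapExp N m n j then (1 : ℂ) else 0) = 1 := by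
      ext k j
      simp [Matrix.one_apply, (gapExp_injective N m n).eq_iff]
    rw [h2, h3, Matrix.det_one, mul_one, ← hwe, hw]
    simp only [h1, hek]
    rw [haarMean_const_mul, mul_comm]
  · have h0 : (Matrix.of fun k j : Fin n =>
        if α k = gapExp N m n j then (1 : ℂ) else 0).det = 0 := by
      by_contra h
      rw [← Matrix.det_transpose, Matrix.det_apply] at h
      obtain ⟨σ, _, hσ⟩ := Finset.exists_ne_zero_of_sum_ne_zero h
      refine hα ⟨σ, fun k => ?_⟩
      by_contra hk
      apply hσ
      rw [Finset.prod_eq_zero (Finset.mem_univ k), smul_zero]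
      simp [hk]
    rw [h0, mul_zero]
    by_contra hcoeff
    have hinj : Function.Injective α := by
      intro a b hab
      by_contra hne'
      apply hcoeff
      rw [hw]
      have : ∀ p : Polynomial ℂ, (Matrix.of fun k j : Fin n =>
          (Polynomial.X ^ (j : ℕ) * p).coeff (α k)).det = 0 := fun p =>
        Matrix.det_zero_of_row_eq hne' (by ext j; simp [hab])
      simp [this, haarMean]
    have hlt : ∀ k, α k < N + n := by
      intro k
      by_contra hge
      apply hcoeff
      rw [hw]
      have : ∀ U : Matrix (Fin N) (Fin N) ℂ, (Matrix.of fun k j : Fin n =>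
          (Polynomial.X ^ (j : ℕ) * U.charpoly).coeff (α k)).det = 0 := fun U =>
        Matrix.det_eq_zero_of_row_eq_zero k (fun j => by
          rw [Matrix.of_apply, Polynomial.coeff_X_pow_mul']
          have hdeg : U.charpoly.natDegree = N := by simp
          have := j.2
          rw [Polynomial.coeff_eq_zero_of_natDegree_lt (by rw [hdeg]; omega)]
          simp)
      simp [this, haarMean]
    have h1 := hK α hcoeff
    have h2 := hK e hne
    refine hα (exists_perm_of_gap hmn α hinj hlt ?_ ?_)
    · have := h1.1.trans h2.1.symm
      simp only [hek] at this
      exact_mod_cast this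
    · have := h1.2.trans h2.2.symm
      simp only [hek] at this
      exact_mod_cast this

end Alternant

/-! ### The alternant as a Toeplitz determinant. -/

section HaarToeplitz

open Matrix MeasureTheory

/-- The permutation of rows that moves the rows with index in `gapExp` to the front. -/
theorem exists_gap_rowEquiv {N m n : ℕ} (hmn : m ≤ n) :
    ∃ τ : Equiv.Perm (Fin n ⊕ Fin N),
      (∀ l, (finSumFinEquiv (τ (Sum.inl l)) : ℕ) = gapExp N m n l) ∧
      (∀ i, (finSumFinEquiv (τ (Sum.inr i)) : ℕ) = m + i) := by
  set f : Fin n ⊕ Fin N → Fin (n + N) :=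
    Sum.elim (fun l => ⟨gapExp N m n l, by have := gapExp_lt (N := N) (m := m) l; omega⟩)
      (fun i => ⟨m + i, by omega⟩) with hf
  have hinj : Function.Injective f := by
    rintro (a | a) (b | b) h
    · simp only [hf, Sum.elim_inl, Fin.mk.injEq] at h
      rw [gapExp_injective N m n h]
    · simp only [hf, Sum.elim_inl, Sum.elim_inr, Fin.mk.injEq, gapExp] at h
      have := b.2
      split_ifs at h <;> omega
    · simp only [hf, Sum.elim_inl, Sum.elim_inr, Fin.mk.injEq, gapExp] at h
      have := a.2
      split_ifs at h <;> omega
    · simp only [hf, Sum.elim_inr, Fin.mk.injEq] at h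
      congr 1
      ext; omega
  have hbij : Function.Bijective f :=
    (Fintype.bijective_iff_injective_and_card f).2 ⟨hinj, by simp⟩
  refine ⟨(Equiv.ofBijective f hbij).trans finSumFinEquiv.symm, fun l => ?_, fun i => ?_⟩
  · simp [hf]
  · simp [hf]

/-- The vector of powers of a root `x_k` is orthogonal to the coefficient vectors of `X^j g`. A
product of two square matrices of size `n + N` is therefore block triangular, with the alternant in
one corner and a unitriangular block in the other, while the determinants of its factors are the
Vandermonde determinant and, up to sign, the Toeplitz determinant. -/
theorem exists_sign_vandermonde_mul_toeplitz {N m n : ℕ} (hmn : m ≤ n) :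
    ∃ ε : ℤˣ, ∀ {R : Type} [CommRing R] [Nontrivial R] (x : Fin n → R),
      (vandermonde x).det * ((ε : ℤ) * (Matrix.of fun i j : Fin N =>
        ((Polynomial.X : Polynomial R) ^ (j : ℕ) *
          ∏ k, (Polynomial.X - Polynomial.C (x k))).coeff (m + i)).det) =
      (Matrix.of fun k j : Fin n => x k ^ gapExp N m n j).det := by
  obtain ⟨τ, hτl, hτr⟩ := exists_gap_rowEquiv (N := N) hmn
  refine ⟨Equiv.Perm.sign τ, fun {R} _ _ x => ?_⟩
  set g : Polynomial R := ∏ k, (Polynomial.X - Polynomial.C (x k)) with hg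
  have hmon : g.Monic := Polynomial.monic_prod_of_monic _ _ fun k _ => Polynomial.monic_X_sub_C _
  have hdeg : g.natDegree = n := by
    rw [hg, Polynomial.natDegree_prod_of_monic _ _ fun k _ => Polynomial.monic_X_sub_C _]
    simp
  have hroot : ∀ k, g.eval (x k) = 0 := fun k => by
    rw [hg, Polynomial.eval_prod]
    exact Finset.prod_eq_zero (Finset.mem_univ k) (by simp)
  set ρ : Fin n ⊕ Fin N → ℕ := fun r => (finSumFinEquiv r : ℕ) with hρ
  have hsum : ∀ f : ℕ → R, ∑ r, f (ρ r) = ∑ r ∈ Finset.range (n + N), f r := by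
    intro f
    rw [← Fin.sum_univ_eq_sum_range]
    exact Equiv.sum_comp finSumFinEquiv (fun r : Fin (n + N) => f r)
  set E : Matrix (Fin n ⊕ Fin N) (Fin n ⊕ Fin N) R :=
    fromBlocks (vandermonde x) (Matrix.of fun k (i : Fin N) => x k ^ (n + (i : ℕ))) 0 1 with hE
  -- The first `n` columns are unit vectors selecting the powers `gapExp`; the last `N` are the
  -- coefficient vectors of `X^j g`.
  set P : Matrix (Fin n ⊕ Fin N) (Fin n ⊕ Fin N) R := Matrix.of fun r c => Sum.elim
    (fun l => if ρ r = gapExp N m n l then 1 else 0)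
    (fun j : Fin N => (Polynomial.X ^ (j : ℕ) * g).coeff (ρ r)) c with hP
  have hEl : ∀ k r, E (Sum.inl k) r = x k ^ ρ r := by
    rintro k (i | i)
    · simp [hE, hρ, vandermonde_apply]
    · simp [hE, hρ]
  have hEr : ∀ i r, E (Sum.inr i) r = if r = Sum.inr i then 1 else 0 := by
    rintro i (j | j)
    · simp [hE]
    · simp [hE, Matrix.one_apply, eq_comm]
  have hEP : E * P = fromBlocks (Matrix.of fun k j : Fin n => x k ^ gapExp N m n j) 0
      (Matrix.of fun (i : Fin N) l => P (Sum.inr i) (Sum.inl l))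
      (Matrix.of fun i j : Fin N => (Polynomial.X ^ (j : ℕ) * g).coeff (n + i)) := by
    ext r c
    rcases r with k | i <;> rcases c with l | j
    · rw [Matrix.mul_apply, fromBlocks_apply₁₁]
      simp only [hEl, hP, Matrix.of_apply, Sum.elim_inl]
      rw [hsum fun r => x k ^ r * if r = gapExp N m n l then 1 else 0]
      simp only [mul_ite, mul_one, mul_zero, Finset.sum_ite_eq', Finset.mem_range]
      rw [if_pos (by have := gapExp_lt (N := N) (m := m) l; omega)]
    · rw [Matrix.mul_apply, fromBlocks_apply₁₂, Matrix.zero_apply]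
      simp only [hEl, hP, Matrix.of_apply, Sum.elim_inr]
      rw [hsum fun r => x k ^ r * ((Polynomial.X : Polynomial R) ^ (j : ℕ) * g).coeff r]
      have hd : (Polynomial.X ^ (j : ℕ) * g).natDegree < n + N := by
        refine lt_of_le_of_lt Polynomial.natDegree_mul_le ?_
        rw [Polynomial.natDegree_X_pow, hdeg]
        have := j.2; omega
      have := Polynomial.eval_eq_sum_range' hd (x k)
      rw [Polynomial.eval_mul, hroot, mul_zero] at this
      rw [this]
      exact Finset.sum_congr rfl fun _ _ => mul_comm _ _
    · rw [Matrix.mul_apply, fromBlocks_apply₂₁]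
      simp [hEr]
    · rw [Matrix.mul_apply, fromBlocks_apply₂₂]
      simp [hEr, hP, hρ]
  have hdetE : E.det = (vandermonde x).det := by
    rw [hE, det_fromBlocks_zero₂₁, det_one, mul_one]
  have hdetD : (Matrix.of fun i j : Fin N => (Polynomial.X ^ (j : ℕ) * g).coeff (n + i)).det = 1 := by
    rw [Matrix.det_of_isUpperTriangular]
    · refine Finset.prod_eq_one fun i _ => ?_
      rw [Matrix.of_apply, Polynomial.coeff_X_pow_mul]
      rw [Polynomial.Monic, Polynomial.leadingCoeff, hdeg] at hmon
      exact hmon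
    · intro i j hij
      have hij' : (j : ℕ) < i := hij
      rw [Matrix.of_apply, Polynomial.coeff_X_pow_mul', if_pos (by omega)]
      exact Polynomial.coeff_eq_zero_of_natDegree_lt (by rw [hdeg]; omega)
  have hdetP : P.det = (Equiv.Perm.sign τ : ℤ) *
      (Matrix.of fun i j : Fin N => (Polynomial.X ^ (j : ℕ) * g).coeff (m + i)).det := by
    have h1 := Matrix.det_permute τ P
    have h2 : P.submatrix τ id = fromBlocks 1
        (Matrix.of fun l (j : Fin N) => P (τ (Sum.inl l)) (Sum.inr j)) 0
        (Matrix.of fun i j : Fin N => (Polynomial.X ^ (j : ℕ) * g).coeff (m + i)) := by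
      ext r c
      rcases r with k | i <;> rcases c with l | j
      · simp only [submatrix_apply, id, hP, Matrix.of_apply, Sum.elim_inl, hρ, hτl,
          fromBlocks_apply₁₁, Matrix.one_apply, (gapExp_injective N m n).eq_iff]
      · simp
      · simp only [submatrix_apply, id, hP, Matrix.of_apply, Sum.elim_inl, hρ, hτr,
          fromBlocks_apply₂₁, Matrix.zero_apply]
        rw [if_neg]
        simp only [gapExp]
        have := i.2
        split_ifs <;> omega
      · simp only [submatrix_apply, id, hP, Matrix.of_apply, Sum.elim_inr, hρ, hτr,
          fromBlocks_apply₂₂]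
    rw [h2, det_fromBlocks_zero₂₁, det_one, one_mul] at h1
    rw [h1, ← mul_assoc, ← Int.cast_mul]
    rcases Int.units_eq_one_or (Equiv.Perm.sign τ) with h | h <;> simp [h]
  have := congrArg Matrix.det hEP
  rw [Matrix.det_mul, det_fromBlocks_zero₁₂, hdetE, hdetD, mul_one, hdetP] at this
  exact this

/-- The Vandermonde factor is cancelled in the polynomial ring before evaluation, so coinciding
`x_k` are allowed. Norms absorb `(-1)^(N m)` and the sign of the row permutation. -/
theorem norm_haarMean_prod_charpoly {N m n : ℕ} (hmn : m ≤ n) (x : Fin n → ℂ) :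
    ‖haarMean N m (fun U => ∏ k, (U : Matrix (Fin N) (Fin N) ℂ).charpoly.eval (x k))‖ =
      ‖(Matrix.of fun i j : Fin N => ((Polynomial.X : Polynomial ℂ) ^ (j : ℕ) *
          ∏ k, (Polynomial.X - Polynomial.C (x k))).coeff (m + i)).det‖ := by
  obtain ⟨H, hH⟩ := exists_haarMean_charProd N m n
  obtain ⟨ε, hε⟩ := exists_sign_vandermonde_mul_toeplitz (N := N) hmn
  have h1 := vdmPoly_mul_haarMean_eq_gapAlternant hmn hH
  rw [gapAlternant, ← hε (MvPolynomial.X : Fin n → MvPolynomial (Fin n) ℂ), ← vdmPoly,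
    ← mul_smul_comm] at h1
  have h2 := mul_left_cancel₀ (vdmPoly_ne_zero n) h1
  have h3 := congrArg (MvPolynomial.eval x) h2
  have h4 : MvPolynomial.eval x H = haarMean N m
      (fun U => ∏ k, (U : Matrix (Fin N) (Fin N) ℂ).charpoly.eval (x k)) := by
    have := (hH (MvPolynomial.aeval x).toLinearMap).1
    have hev : ∀ p, (MvPolynomial.aeval x).toLinearMap p = MvPolynomial.eval x p := fun p =>
      DFunLike.congr_fun (MvPolynomial.coe_aeval_eq_eval x) p
    simp only [hev, eval_charProd] at this
    exact this
  rw [← h4, h3, MvPolynomial.smul_eval, map_mul, RingHom.map_det, map_intCast, norm_mul, norm_mul]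
  have h5 : (MvPolynomial.eval x).mapMatrix (Matrix.of fun i j : Fin N =>
      ((Polynomial.X : Polynomial (MvPolynomial (Fin n) ℂ)) ^ (j : ℕ) *
        ∏ k, (Polynomial.X - Polynomial.C (MvPolynomial.X k))).coeff (m + i)) =
      (Matrix.of fun i j : Fin N => ((Polynomial.X : Polynomial ℂ) ^ (j : ℕ) *
          ∏ k, (Polynomial.X - Polynomial.C (x k))).coeff (m + i)) := by
    ext i j
    rw [RingHom.mapMatrix_apply, Matrix.map_apply, Matrix.of_apply, Matrix.of_apply,
      ← Polynomial.coeff_map]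
    congr 1
    simp [Polynomial.map_prod]
  rw [h5]
  have h6 : ‖((ε : ℤ) : ℂ)‖ = 1 := by
    rcases Int.units_eq_one_or ε with h | h <;> simp [h]
  rw [h6]
  simp

theorem exists_eq_C_mul_prod_X_sub_C (p : Polynomial ℂ) {n : ℕ} (hn : p.natDegree = n) :
    ∃ x : Fin n → ℂ,
    p = Polynomial.C p.leadingCoeff * ∏ k, (Polynomial.X - Polynomial.C (x k)) := by
  have hcard : p.roots.card = p.natDegree := (IsAlgClosed.splits p).natDegree_eq_card_roots.symm
  have hl : n = p.roots.toList.length := by simp [hcard, hn]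
  refine ⟨fun k => p.roots.toList.get (finCongr hl k), ?_⟩
  rw [Equiv.prod_comp (finCongr hl) fun k =>
    (Polynomial.X - Polynomial.C (p.roots.toList.get k))]
  have h1 := Fin.prod_univ_fun_getElem p.roots.toList fun a => Polynomial.X - Polynomial.C a
  simp only [List.get_eq_getElem]
  rw [h1, ← Multiset.prod_coe, ← Multiset.map_coe, Multiset.coe_toList]
  exact (Polynomial.C_leadingCoeff_mul_prod_multiset_X_sub_C hcard).symm

/-- The mean of `det U ^ (-m) * det (p U)` is, up to a sign, a Toeplitz determinant. -/
theorem norm_haarMean_det_aeval {N m : ℕ} (p : Polynomial ℂ) (hm : m ≤ p.natDegree) :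
    ‖haarMean N m (fun U => (Polynomial.aeval (U : Matrix (Fin N) (Fin N) ℂ) p).det)‖ =
      ‖(Matrix.of fun i j : Fin N =>
        ((Polynomial.X : Polynomial ℂ) ^ (j : ℕ) * p).coeff (m + i)).det‖ := by
  obtain ⟨n, hn⟩ : ∃ n, p.natDegree = n := ⟨_, rfl⟩
  rw [hn] at hm
  obtain ⟨x, hx⟩ := exists_eq_C_mul_prod_X_sub_C p hn
  generalize p.leadingCoeff = a at hx
  set g := ∏ k, (Polynomial.X - Polynomial.C (x k)) with hg
  have h1 : ∀ U : Matrix (Fin N) (Fin N) ℂ, (Polynomial.aeval U p).det =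
      (a ^ N * ∏ _k : Fin n, (-1 : ℂ) ^ N) * ∏ k, U.charpoly.eval (x k) := by
    intro U
    have : ∀ k, (Polynomial.aeval U (Polynomial.X - Polynomial.C (x k))).det =
        (-1) ^ N * U.charpoly.eval (x k) := by
      intro k
      rw [Matrix.eval_charpoly, ← neg_sub, map_neg, Matrix.det_neg, Fintype.card_fin]
      congr 2
      simp [Matrix.scalar_apply, Matrix.algebraMap_eq_diagonal]
    have hprod : (Polynomial.aeval U g).det =
        ∏ k, (Polynomial.aeval U (Polynomial.X - Polynomial.C (x k))).det :=
      map_prod (Matrix.detMonoidHom.comp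
        (Polynomial.aeval U : Polynomial ℂ →ₐ[ℂ] Matrix (Fin N) (Fin N) ℂ).toMonoidHom) _ _
    rw [hx, map_mul, Polynomial.aeval_C, Matrix.det_mul, hprod]
    simp only [this, Finset.prod_mul_distrib, Algebra.algebraMap_eq_smul_one, Matrix.det_smul,
      Matrix.det_one, Fintype.card_fin, mul_one]
    ring
  have h2 : (Matrix.of fun i j : Fin N =>
        ((Polynomial.X : Polynomial ℂ) ^ (j : ℕ) * p).coeff (m + i)) =
      a • Matrix.of fun i j : Fin N =>
        ((Polynomial.X : Polynomial ℂ) ^ (j : ℕ) * g).coeff (m + i) := by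
    ext i j
    rw [Matrix.smul_apply, Matrix.of_apply, Matrix.of_apply, hx, mul_left_comm,
      Polynomial.coeff_C_mul, smul_eq_mul]
  simp only [h1]
  rw [haarMean_const_mul, norm_mul, norm_haarMean_prod_charpoly hm, h2, Matrix.det_smul, norm_mul, ← hg]
  simp

end HaarToeplitz

/-! ### Heine's identity by truncation of the symbol. -/

section HaarLimit

open Matrix MeasureTheory Filter Topology

/-- The truncation `∑_{r ≤ M} h_r X^r`. -/
noncomputable def truncPoly (h : ℕ → ℝ) (M : ℕ) : Polynomial ℂ :=
  ∑ r ∈ Finset.range (M + 1), Polynomial.C (h r : ℂ) * Polynomial.X ^ r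

/-- The reversed truncation `∑_{r ≤ M} h_r X^(M - r)`. -/
noncomputable def truncRev (h : ℕ → ℝ) (M : ℕ) : Polynomial ℂ :=
  ∑ r ∈ Finset.range (M + 1), Polynomial.C (h r : ℂ) * Polynomial.X ^ (M - r)

/-- The sequence `h` shifted by `i` to the right. -/
def shiftSeq (h : ℕ → ℝ) (i s : ℕ) : ℝ := if i ≤ s then h (s - i) else 0

theorem coeff_truncPoly (h : ℕ → ℝ) (M s : ℕ) :
    (truncPoly h M).coeff s = if s < M + 1 then (h s : ℂ) else 0 := by
  simp [truncPoly, Polynomial.finsetSum_coeff, Polynomial.coeff_X_pow]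

theorem aeval_truncPoly {N : ℕ} (h : ℕ → ℝ) (M : ℕ) (U : Matrix (Fin N) (Fin N) ℂ) :
    Polynomial.aeval U (truncPoly h M) = ∑ r ∈ Finset.range (M + 1), (h r : ℂ) • U ^ r := by
  simp [truncPoly, Algebra.algebraMap_eq_smul_one]

/-- For unitary `U` and real coefficients, taking the adjoint replaces `U` by its inverse, so
reversing the polynomial is the same as taking the adjoint and multiplying by `U^M`. -/
theorem aeval_truncRev {N : ℕ} (h : ℕ → ℝ) (M : ℕ) (U : Matrix.unitaryGroup (Fin N) ℂ) :
    Polynomial.aeval (U : Matrix (Fin N) (Fin N) ℂ) (truncRev h M) =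
      (U : Matrix (Fin N) (Fin N) ℂ) ^ M *
        star (Polynomial.aeval (U : Matrix (Fin N) (Fin N) ℂ) (truncPoly h M)) := by
  have hU : (U : Matrix (Fin N) (Fin N) ℂ) * star (U : Matrix (Fin N) (Fin N) ℂ) = 1 :=
    Matrix.mem_unitaryGroup_iff.1 U.2
  rw [aeval_truncPoly, star_sum, Finset.mul_sum, truncRev, map_sum]
  refine Finset.sum_congr rfl fun r hr => ?_
  have hr' : r ≤ M := by have := Finset.mem_range.1 hr; omega
  have hpow : ∀ k : ℕ, (U : Matrix (Fin N) (Fin N) ℂ) ^ k *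
      star (U : Matrix (Fin N) (Fin N) ℂ) ^ k = 1 := by
    intro k
    induction k with
    | zero => simp
    | succ k ih =>
      rw [pow_succ, pow_succ', Matrix.mul_assoc, ← Matrix.mul_assoc _ (star _) (star _ ^ k), hU,
        Matrix.one_mul, ih]
  rw [map_mul, Polynomial.aeval_C, map_pow, Polynomial.aeval_X, star_smul, star_pow,
    Algebra.algebraMap_eq_smul_one, Matrix.smul_mul, Matrix.one_mul, Matrix.mul_smul,
    RCLike.star_def, Complex.conj_ofReal]
  congr 1
  conv_rhs => rw [← Nat.sub_add_cancel hr', pow_add, Matrix.mul_assoc, hpow, Matrix.mul_one]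

theorem inv_det_pow_mul_det_aeval {N : ℕ} (h : ℕ → ℝ) (M : ℕ) (U : Matrix.unitaryGroup (Fin N) ℂ) :
    ((U : Matrix (Fin N) (Fin N) ℂ).det⁻¹) ^ M * (Polynomial.aeval (U : Matrix (Fin N) (Fin N) ℂ)
      (truncPoly h M * truncRev h M)).det =
      (Polynomial.aeval (U : Matrix (Fin N) (Fin N) ℂ) (truncPoly h M)).det *
        star (Polynomial.aeval (U : Matrix (Fin N) (Fin N) ℂ) (truncPoly h M)).det := by
  have h0 := pow_ne_zero M (det_ne_zero_of_unitary U)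
  rw [map_mul, Matrix.det_mul, aeval_truncRev, Matrix.det_mul, Matrix.det_pow,
    Matrix.star_eq_conjTranspose, Matrix.det_conjTranspose, inv_pow]
  field_simp

/-- This supplies the degree condition of `norm_haarMean_det_aeval` with `m = M`; here `h 0 ≠ 0`
enters. -/
theorem le_natDegree_trunc_mul (h : ℕ → ℝ) (h0 : h 0 ≠ 0) (M : ℕ) :
    M ≤ (truncPoly h M * truncRev h M).natDegree := by
  have h1 : (truncRev h M).coeff M = (h 0 : ℂ) := by
    rw [truncRev, Polynomial.finsetSum_coeff, Finset.sum_eq_single 0]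
    · simp
    · intro r hr hr0
      have := Finset.mem_range.1 hr
      rw [Polynomial.coeff_C_mul, Polynomial.coeff_X_pow, if_neg (by omega), mul_zero]
    · simp
  have h2 : (truncPoly h M).coeff 0 = (h 0 : ℂ) := by simp [coeff_truncPoly]
  have hc : (h 0 : ℂ) ≠ 0 := by exact_mod_cast h0
  rw [Polynomial.natDegree_mul]
  · have : M ≤ (truncRev h M).natDegree := Polynomial.le_natDegree_of_ne_zero (by rw [h1]; exact hc)
    omega
  · intro h'; rw [h'] at h2; exact hc (by simpa using h2.symm)
  · intro h'; rw [h'] at h1; exact hc (by simpa using h1.symm)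

/-- The Toeplitz entries of the truncated symbol are partial sums of the Gram entries. The range is
cut by both truncations: `c ≤ M` from the reversed factor and `i + c - j ≤ M` from the other. -/
theorem coeff_trunc_mul (h : ℕ → ℝ) (M i j : ℕ) :
    ((Polynomial.X : Polynomial ℂ) ^ j * (truncPoly h M * truncRev h M)).coeff (M + i) =
      ((∑ c ∈ Finset.range (min (M + 1) (M + 1 + j - i)), shiftSeq h j (i + c) * h c : ℝ) : ℂ) := by
  rw [← mul_assoc, truncRev, Finset.mul_sum, Polynomial.finsetSum_coeff, Complex.ofReal_sum]
  have h1 : ∀ c ∈ Finset.range (M + 1), ((Polynomial.X : Polynomial ℂ) ^ j * truncPoly h M *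
      (Polynomial.C (h c : ℂ) * Polynomial.X ^ (M - c))).coeff (M + i) =
      if c < M + 1 + j - i then ((shiftSeq h j (i + c) * h c : ℝ) : ℂ) else 0 := by
    intro c hc
    have hc' := Finset.mem_range.1 hc
    have e : M + i = (i + c) + (M - c) := by omega
    rw [mul_comm (Polynomial.C _), ← mul_assoc, Polynomial.coeff_mul_C, e,
      Polynomial.coeff_mul_X_pow, Polynomial.coeff_X_pow_mul', coeff_truncPoly, shiftSeq]
    split_ifs <;> first | omega | simp
  rw [Finset.sum_congr rfl h1, ← Finset.sum_filter]
  congr 1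
  ext c
  simp

theorem abs_shiftSeq_le {h : ℕ → ℝ} (hh : Summable fun r => |h r|) (i s : ℕ) :
    |shiftSeq h i s| ≤ ∑' r, |h r| := by
  rw [shiftSeq]
  split_ifs
  · exact hh.le_tsum _ fun _ _ => abs_nonneg _
  · rw [abs_zero]; exact tsum_nonneg fun _ => abs_nonneg _

theorem summable_abs_shiftSeq {h : ℕ → ℝ} (hh : Summable fun r => |h r|) (i : ℕ) :
    Summable fun s => |shiftSeq h i s| := by
  rw [← summable_nat_add_iff i]
  simpa [shiftSeq] using hh

theorem summable_shiftSeq_mul {h : ℕ → ℝ} (hh : Summable fun r => |h r|) (i j : ℕ) :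
    Summable fun s => shiftSeq h i s * shiftSeq h j s := by
  refine Summable.of_norm_bounded ((summable_abs_shiftSeq hh i).mul_right (∑' r, |h r|)) fun s => ?_
  rw [Real.norm_eq_abs, abs_mul]
  exact mul_le_mul_of_nonneg_left (abs_shiftSeq_le hh j s) (abs_nonneg _)

theorem hasSum_shiftSeq_mul {h : ℕ → ℝ} (hh : Summable fun r => |h r|) (i j : ℕ) :
    HasSum (fun c => shiftSeq h j (i + c) * h c) (∑' s, shiftSeq h i s * shiftSeq h j s) := by
  have hs := summable_shiftSeq_mul hh i j
  have h1 := hs.sum_add_tsum_nat_add i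
  have h2 : ∑ s ∈ Finset.range i, shiftSeq h i s * shiftSeq h j s = 0 :=
    Finset.sum_eq_zero fun s hs => by
      have := Finset.mem_range.1 hs
      rw [shiftSeq, if_neg (by omega), zero_mul]
  rw [h2, zero_add] at h1
  have h3 := ((summable_nat_add_iff i).2 hs).hasSum
  rw [h1] at h3
  refine h3.congr_fun fun c => ?_
  simp [shiftSeq, add_comm, mul_comm]

theorem tendsto_det_trunc {N : ℕ} {h : ℕ → ℝ} (hh : Summable fun r => |h r|) :
    Tendsto (fun M => (Matrix.of fun i j : Fin N => ((Polynomial.X : Polynomial ℂ) ^ (j : ℕ) *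
        (truncPoly h M * truncRev h M)).coeff (M + i)).det) atTop
      (𝓝 (((Matrix.of fun i j : Fin N =>
        ∑' s, shiftSeq h i s * shiftSeq h j s).det : ℝ) : ℂ)) := by
  have h1 : (((Matrix.of fun i j : Fin N => ∑' s, shiftSeq h i s * shiftSeq h j s).det : ℝ) : ℂ) =
      (Matrix.of fun i j : Fin N => ((∑' s, shiftSeq h i s * shiftSeq h j s : ℝ) : ℂ)).det :=
    RingHom.map_det Complex.ofRealHom _
  rw [h1]
  refine ((continuous_id.matrix_det).tendsto _).comp ?_
  refine tendsto_pi_nhds.2 fun i => tendsto_pi_nhds.2 fun j => ?_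
  simp only [Matrix.of_apply, coeff_trunc_mul]
  refine (Complex.continuous_ofReal.tendsto _).comp ?_
  refine (hasSum_shiftSeq_mul hh i j).tendsto_sum_nat.comp ?_
  refine tendsto_atTop.2 fun b => ?_
  filter_upwards [eventually_ge_atTop (b + i)] with M hM
  rw [le_min_iff]
  omega

/-- The truncations converge uniformly on the circle, which contains the spectrum, so the functional
calculus converges for every `U`. Domination comes from the entrywise bound `∑ |h r|`. -/
theorem tendsto_integral_trunc {N : ℕ} {h : ℕ → ℝ} (hh : Summable fun r => |h r|) {f F : ℂ → ℂ}
    (hF : ∀ z : ℂ, ‖z‖ = 1 → HasSum (fun r => (h r : ℂ) * z ^ r) (F z))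
    (hf : ∀ z : ℂ, ‖z‖ = 1 → f z = F z * star (F z)) :
    Tendsto (fun M => ∫ U : Matrix.unitaryGroup (Fin N) ℂ,
        (Polynomial.aeval (U : Matrix (Fin N) (Fin N) ℂ) (truncPoly h M)).det *
        star (Polynomial.aeval (U : Matrix (Fin N) (Fin N) ℂ) (truncPoly h M)).det ∂(haarU N)) atTop
      (𝓝 (∫ U : Matrix.unitaryGroup (Fin N) ℂ,
        (matrixFun f (U : Matrix (Fin N) (Fin N) ℂ)).det ∂(haarU N))) := by
  have hunif : TendstoUniformlyOn (fun M z => (truncPoly h M).eval z) F atTop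
      (Metric.sphere (0 : ℂ) 1) := by
    have h1 := tendstoUniformlyOn_tsum_nat (f := fun r (z : ℂ) => (h r : ℂ) * z ^ r)
      (s := Metric.sphere (0 : ℂ) 1) hh (fun r z hz => by
        have : ‖z‖ = 1 := by simpa using hz
        simp [this])
    have h2 : TendstoUniformlyOn (fun M (z : ℂ) => ∑ r ∈ Finset.range M, (h r : ℂ) * z ^ r) F atTop
        (Metric.sphere (0 : ℂ) 1) :=
      h1.congr_right fun z hz => (hF z (by simpa using hz)).tsum_eq
    have h3 : ∀ M (z : ℂ), (truncPoly h M).eval z =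
        ∑ r ∈ Finset.range (M + 1), (h r : ℂ) * z ^ r := by
      intro M z; simp [truncPoly, Polynomial.eval_finsetSum]
    simp only [h3]
    intro u hu
    exact (tendsto_add_atTop_nat 1).eventually (h2 u hu)
  have hFc : ContinuousOn F (Metric.sphere (0 : ℂ) 1) :=
    hunif.continuousOn (Frequently.of_forall fun M => (truncPoly h M).continuous.continuousOn)
  have hlim : ∀ U : Matrix.unitaryGroup (Fin N) ℂ, Tendsto (fun M =>
        (Polynomial.aeval (U : Matrix (Fin N) (Fin N) ℂ) (truncPoly h M)).det *
        star (Polynomial.aeval (U : Matrix (Fin N) (Fin N) ℂ) (truncPoly h M)).det) atTop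
      (𝓝 (matrixFun f (U : Matrix (Fin N) (Fin N) ℂ)).det) := by
    intro U
    open scoped Matrix.Norms.L2Operator in
    have hsp : spectrum ℂ (U : Matrix (Fin N) (Fin N) ℂ) ⊆ Metric.sphere 0 1 :=
      Unitary.spectrum_subset_circle U
    open scoped Matrix.Norms.L2Operator in
    have h1 : Tendsto (fun M => Polynomial.aeval (U : Matrix (Fin N) (Fin N) ℂ) (truncPoly h M))
        atTop (𝓝 (cfc F (U : Matrix (Fin N) (Fin N) ℂ))) := by
      have := tendsto_cfc_fun (A := Matrix (Fin N) (Fin N) ℂ) (hunif.mono hsp)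
        (Eventually.of_forall fun M => (truncPoly h M).continuous.continuousOn)
      refine this.congr fun M => ?_
      exact cfc_polynomial (truncPoly h M) (U : Matrix (Fin N) (Fin N) ℂ)
    open scoped Matrix.Norms.L2Operator in
    have h2 : matrixFun f (U : Matrix (Fin N) (Fin N) ℂ) =
        cfc F (U : Matrix (Fin N) (Fin N) ℂ) * star (cfc F (U : Matrix (Fin N) (Fin N) ℂ)) := by
      rw [matrixFun, ← cfc_star, ← cfc_mul _ _ _ (hFc.mono hsp) (hFc.mono hsp).star]
      exact cfc_congr fun z hz => hf z (by simpa using hsp hz)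
    rw [h2, Matrix.det_mul, Matrix.star_eq_conjTranspose, Matrix.det_conjTranspose]
    have h3 := ((continuous_id.matrix_det).tendsto _).comp h1
    exact h3.mul ((continuous_star.tendsto _).comp h3)
  set C := ∑' r, |h r| with hC
  set D : ℝ := (Fintype.card (Fin N)).factorial • C ^ Fintype.card (Fin N) with hD
  have hbound : ∀ M (U : Matrix.unitaryGroup (Fin N) ℂ),
      ‖(Polynomial.aeval (U : Matrix (Fin N) (Fin N) ℂ) (truncPoly h M)).det‖ ≤ D := by
    intro M U
    refine Matrix.det_le (abv := NormedField.toAbsoluteValue ℂ) fun i j => ?_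
    change ‖(Polynomial.aeval (U : Matrix (Fin N) (Fin N) ℂ) (truncPoly h M)) i j‖ ≤ C
    rw [aeval_truncPoly, Matrix.sum_apply]
    refine (norm_sum_le _ _).trans ?_
    calc ∑ r ∈ Finset.range (M + 1), ‖((h r : ℂ) • (U : Matrix (Fin N) (Fin N) ℂ) ^ r) i j‖
        ≤ ∑ r ∈ Finset.range (M + 1), |h r| := by
          refine Finset.sum_le_sum fun r _ => ?_
          rw [Matrix.smul_apply, smul_eq_mul, norm_mul, Complex.norm_real, Real.norm_eq_abs]
          have := entry_norm_bound_of_unitary (U ^ r).2 i j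
          exact mul_le_of_le_one_right (abs_nonneg _) this
      _ ≤ C := hh.sum_le_tsum _ fun _ _ => abs_nonneg _
  refine tendsto_integral_of_dominated_convergence (fun _ => D * D) (fun M => ?_)
    (integrable_const _) (fun M => Eventually.of_forall fun U => ?_) (Eventually.of_forall hlim)
  · refine Continuous.aestronglyMeasurable ?_
    have : Continuous fun U : Matrix.unitaryGroup (Fin N) ℂ =>
        (Polynomial.aeval (U : Matrix (Fin N) (Fin N) ℂ) (truncPoly h M)).det := by
      simp only [aeval_truncPoly]
      refine Continuous.matrix_det (continuous_finsetSum _ fun r _ => ?_)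
      exact Continuous.const_smul (Continuous.pow continuous_subtype_val r) (h r : ℂ)
    exact this.mul (continuous_star.comp this)
  · rw [norm_mul, norm_star]
    exact mul_le_mul (hbound M U) (hbound M U) (norm_nonneg _) ((norm_nonneg _).trans (hbound M U))

/-- **Heine's identity** for a symbol `|∑ h_r z^r|²` on the unit circle. -/
theorem integral_det_matrixFun {N : ℕ} {h : ℕ → ℝ} (hh : Summable fun r => |h r|) (h0 : h 0 ≠ 0)
    {f F : ℂ → ℂ}
    (hF : ∀ z : ℂ, ‖z‖ = 1 → HasSum (fun r => (h r : ℂ) * z ^ r) (F z))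
    (hf : ∀ z : ℂ, ‖z‖ = 1 → f z = F z * star (F z))
    (hpos : 0 ≤ (Matrix.of fun i j : Fin N => ∑' s, shiftSeq h i s * shiftSeq h j s).det) :
    ∫ U : Matrix.unitaryGroup (Fin N) ℂ,
        (matrixFun f (U : Matrix (Fin N) (Fin N) ℂ)).det ∂(haarU N) =
      (((Matrix.of fun i j : Fin N => ∑' s, shiftSeq h i s * shiftSeq h j s).det : ℝ) : ℂ) := by
  have key : ∀ M, ∫ U : Matrix.unitaryGroup (Fin N) ℂ,
        (Polynomial.aeval (U : Matrix (Fin N) (Fin N) ℂ) (truncPoly h M)).det *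
        star (Polynomial.aeval (U : Matrix (Fin N) (Fin N) ℂ) (truncPoly h M)).det ∂(haarU N) =
      ((‖(Matrix.of fun i j : Fin N => ((Polynomial.X : Polynomial ℂ) ^ (j : ℕ) *
        (truncPoly h M * truncRev h M)).coeff (M + i)).det‖ : ℝ) : ℂ) := by
    intro M
    -- The integrand is a squared modulus, so the integral equals its own norm; knowing the mean up
    -- to a factor of modulus one is enough.
    rw [← norm_haarMean_det_aeval _ (le_natDegree_trunc_mul h h0 M)]
    simp only [haarMean, inv_det_pow_mul_det_aeval]
    have : ∀ U : Matrix.unitaryGroup (Fin N) ℂ,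
        (Polynomial.aeval (U : Matrix (Fin N) (Fin N) ℂ) (truncPoly h M)).det *
        star (Polynomial.aeval (U : Matrix (Fin N) (Fin N) ℂ) (truncPoly h M)).det =
        ((‖(Polynomial.aeval (U : Matrix (Fin N) (Fin N) ℂ) (truncPoly h M)).det‖ ^ 2 : ℝ) : ℂ) := by
      intro U
      rw [RCLike.star_def, Complex.mul_conj', Complex.ofReal_pow]
    simp only [this]
    rw [integral_complex_ofReal, Complex.norm_real, Real.norm_of_nonneg]
    exact integral_nonneg fun U => by positivity
  have h1 := tendsto_integral_trunc (N := N) hh hF hf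
  simp only [key] at h1
  have h2 := (Complex.continuous_ofReal.tendsto _).comp (tendsto_det_trunc (N := N) hh).norm
  rw [Complex.norm_real, Real.norm_of_nonneg hpos] at h2
  exact tendsto_nhds_unique h1 h2

end HaarLimit

/-! ### The Cauchy–Binet formula, finite and infinite. -/

section CauchyBinet

open Matrix Filter Topology

/-- The determinant of a product, expanded over all choices of rows of the second factor. -/
theorem det_mul_eq_sum_functions {N L : ℕ} {R : Type*} [CommRing R] (A : Matrix (Fin N) (Fin L) R)
    (B : Matrix (Fin L) (Fin N) R) :
    (A * B).det = ∑ p : Fin N → Fin L, (∏ i, A i (p i)) * (B.submatrix p id).det := by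
  have h1 : A * B = fun i => ∑ k, A i k • B k := by
    ext i j
    simp [Matrix.mul_apply]
  rw [h1]
  change (Matrix.detRowAlternating : (Fin N → R) [⋀^Fin N]→ₗ[R] R).toMultilinearMap _ = _
  rw [MultilinearMap.map_sum]
  refine Finset.sum_congr rfl fun p _ => ?_
  rw [MultilinearMap.map_smul_univ, smul_eq_mul]
  rfl

theorem exists_orderEmbedding_comp_perm {N L : ℕ} (p : Fin N → Fin L) (hp : Function.Injective p) :
    ∃ (f : Fin N ↪o Fin L) (σ : Equiv.Perm (Fin N)), p = f ∘ σ := by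
  have hcard : (Finset.univ.image p).card = N := by
    rw [Finset.card_image_of_injective _ hp, Finset.card_univ, Fintype.card_fin]
  set f := (Finset.univ.image p).orderEmbOfFin hcard with hf
  have hex : ∀ i, ∃ j, f j = p i := by
    intro i
    have : p i ∈ Set.range f := by
      rw [hf, Finset.range_orderEmbOfFin]; simp
    exact this
  choose g hg using hex
  have hgi : Function.Injective g := fun a b h => hp (by rw [← hg a, ← hg b, h])
  exact ⟨f, Equiv.ofBijective g (Finite.injective_iff_bijective.1 hgi), funext fun i => (hg i).symm⟩

/-- The **Cauchy–Binet formula**. -/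
theorem det_mul_eq_sum_orderEmbedding {N L : ℕ} {R : Type*} [CommRing R]
    (A : Matrix (Fin N) (Fin L) R) (B : Matrix (Fin L) (Fin N) R) :
    (A * B).det = ∑ f : Fin N ↪o Fin L, (A.submatrix id f).det * (B.submatrix f id).det := by
  classical
  rw [det_mul_eq_sum_functions]
  have h1 : ∑ p : Fin N → Fin L, (∏ i, A i (p i)) * (B.submatrix p id).det =
      ∑ p ∈ Finset.univ.filter (fun p : Fin N → Fin L => Function.Injective p),
        (∏ i, A i (p i)) * (B.submatrix p id).det := by
    symm
    refine Finset.sum_filter_of_ne fun p _ hne => ?_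
    by_contra hp
    apply hne
    simp only [Function.Injective, not_forall] at hp
    obtain ⟨a, b, hab, hne'⟩ := hp
    rw [Matrix.det_zero_of_row_eq hne' (by ext j; simp [hab]), mul_zero]
  have h2 : ∀ f : Fin N ↪o Fin L, (A.submatrix id f).det * (B.submatrix f id).det =
      ∑ σ : Equiv.Perm (Fin N),
        (∏ i, A i ((f ∘ σ) i)) * (B.submatrix (f ∘ σ) id).det := by
    intro f
    rw [← Matrix.det_transpose (A.submatrix id f), Matrix.det_apply, Finset.sum_mul]
    refine Finset.sum_congr rfl fun σ _ => ?_
    have := Matrix.det_permute σ (B.submatrix f id)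
    rw [show B.submatrix (f ∘ σ) id = (B.submatrix f id).submatrix σ id by
      rw [Matrix.submatrix_submatrix]; rfl, this, Units.smul_def, zsmul_eq_mul]
    simp only [Matrix.transpose_apply, Matrix.submatrix_apply, id, Function.comp]
    ring
  rw [h1, Finset.sum_congr rfl fun f _ => h2 f, ← Finset.sum_product']
  symm
  refine Finset.sum_bij (fun x _ => x.1 ∘ x.2) (fun x _ => ?_) (fun x _ y _ hxy => ?_)
    (fun p hp => ?_) (fun x _ => rfl)
  · simp only [Finset.mem_filter, Finset.mem_univ, true_and]
    exact x.1.injective.comp x.2.injective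
  · obtain ⟨f, σ⟩ := x
    obtain ⟨g, τ⟩ := y
    simp only at hxy
    have hr : Set.range f = Set.range g := by
      have := congrArg Set.range hxy
      rwa [σ.surjective.range_comp, τ.surjective.range_comp] at this
    have hfg : f = g := OrderEmbedding.range_inj.1 hr
    subst hfg
    have : σ = τ := by
      ext i : 1
      exact f.injective (congrFun hxy i)
    rw [this]
  · obtain ⟨f, σ, rfl⟩ := exists_orderEmbedding_comp_perm p (Finset.mem_filter.1 hp).2
    exact ⟨(f, σ), by simp, rfl⟩

/-- Sums over sequences with values below `L` are finite Cauchy–Binet expansions of truncated Gram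
determinants. The terms are squares, so convergence along these exhausting sets already gives
unconditional summability. -/
theorem hasSum_det_sq_strictMono {N : ℕ} (B : Fin N → ℕ → ℝ)
    (hB : ∀ i j, Summable fun s => B i s * B j s) :
    HasSum (fun s : {s : Fin N → ℕ // StrictMono s} =>
      (Matrix.of fun i j => B i (s.1 j)).det ^ 2)
      (Matrix.of fun i j => ∑' s, B i s * B j s).det := by
  classical
  set D : {s : Fin N → ℕ // StrictMono s} → ℝ := fun s =>
    (Matrix.of fun i j => B i (s.1 j)).det ^ 2 with hD
  have hD0 : ∀ s, 0 ≤ D s := fun s => sq_nonneg _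
  set ι : (L : ℕ) → (Fin N ↪o Fin L) → {s : Fin N → ℕ // StrictMono s} := fun L f =>
    ⟨fun j => (f j : ℕ), fun a b hab => f.strictMono hab⟩ with hι
  have hιi : ∀ L, Function.Injective (ι L) := by
    intro L f g h
    ext j
    exact congrFun (congrArg Subtype.val h) j
  set Λ : ℕ → Finset {s : Fin N → ℕ // StrictMono s} := fun L =>
    Finset.univ.image (ι L) with hΛ
  have hmem : ∀ L s, s ∈ Λ L ↔ ∀ j, s.1 j < L := by
    intro L s
    simp only [hΛ, Finset.mem_image, Finset.mem_univ, true_and]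
    constructor
    · rintro ⟨f, rfl⟩ j
      exact (f j).2
    · intro h
      exact ⟨OrderEmbedding.ofStrictMono (fun j => ⟨s.1 j, h j⟩) fun a b hab => s.2 hab, rfl⟩
  have hmono : Monotone Λ := by
    intro L L' hL s hs
    rw [hmem] at hs ⊢
    exact fun j => (hs j).trans_le hL
  have hex : ∀ s, ∃ L, s ∈ Λ L := by
    intro s
    refine ⟨∑ j, s.1 j + 1, (hmem _ _).2 fun j => Nat.lt_succ_of_le ?_⟩
    exact Finset.single_le_sum (f := s.1) (fun _ _ => Nat.zero_le _) (Finset.mem_univ j)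
  have hsum : ∀ L, ∑ s ∈ Λ L, D s =
      (Matrix.of fun i j : Fin N => ∑ s ∈ Finset.range L, B i s * B j s).det := by
    intro L
    rw [hΛ, Finset.sum_image fun _ _ _ _ h => hιi L h]
    have := det_mul_eq_sum_orderEmbedding (Matrix.of fun (i : Fin N) (s : Fin L) => B i s)
      (Matrix.of fun (i : Fin N) (s : Fin L) => B i s)ᵀ
    have h2 : (Matrix.of fun (i : Fin N) (s : Fin L) => B i s) *
        (Matrix.of fun (i : Fin N) (s : Fin L) => B i s)ᵀ =
        Matrix.of fun i j : Fin N => ∑ s ∈ Finset.range L, B i s * B j s := by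
      ext i j
      rw [Matrix.mul_apply]
      simp only [Matrix.of_apply, Matrix.transpose_apply]
      rw [Finset.sum_range]
    rw [← h2, this]
    refine Finset.sum_congr rfl fun f _ => ?_
    rw [← Matrix.transpose_submatrix, Matrix.det_transpose, ← sq]
    rfl
  have hlim : Tendsto (fun L => ∑ s ∈ Λ L, D s) atTop
      (𝓝 (Matrix.of fun i j => ∑' s, B i s * B j s).det) := by
    simp only [hsum]
    refine ((continuous_id.matrix_det).tendsto _).comp ?_
    refine tendsto_pi_nhds.2 fun i => tendsto_pi_nhds.2 fun j => ?_
    exact (hB i j).hasSum.tendsto_sum_nat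
  have hle : ∀ L, ∑ s ∈ Λ L, D s ≤ (Matrix.of fun i j => ∑' s, B i s * B j s).det := fun L =>
    Monotone.ge_of_tendsto (fun L L' h => Finset.sum_le_sum_of_subset_of_nonneg (hmono h)
      fun s _ _ => hD0 s) hlim L
  have hΛt : Tendsto Λ atTop atTop := tendsto_atTop_finset_of_monotone hmono hex
  have hsummable : Summable D := by
    refine summable_of_sum_le hD0 (c := (Matrix.of fun i j => ∑' s, B i s * B j s).det) fun u => ?_
    obtain ⟨L, hL⟩ := (hΛt.eventually (eventually_ge_atTop u)).exists
    exact (Finset.sum_le_sum_of_subset_of_nonneg hL fun s _ _ => hD0 s).trans (hle L)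
  have := tendsto_nhds_unique (hsummable.hasSum.comp hΛt) hlim
  rw [← this]
  exact hsummable.hasSum

end CauchyBinet

/-! ### Partitions as strictly increasing sequences. -/

section PartitionSequences

/-- The strictly increasing sequence `j ↦ λ_{N - j} + j` of a partition of length at most `N`. -/
def partSeq (N : ℕ) (lam : YoungDiagram) (j : Fin N) : ℕ := lam.rowLen (N - 1 - j) + j

theorem partSeq_strictMono (N : ℕ) (lam : YoungDiagram) : StrictMono (partSeq N lam) := by
  intro a b hab
  have hab' : (a : ℕ) < b := hab
  have := lam.rowLen_anti (N - 1 - b) (N - 1 - a) (by omega)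
  simp only [partSeq]
  omega

theorem rowLen_eq_zero_of_partLength_le {lam : YoungDiagram} {i : ℕ} (h : partLength lam ≤ i) :
    lam.rowLen i = 0 := by
  by_contra hne
  have h1 : (i, 0) ∈ lam := YoungDiagram.mem_iff_lt_rowLen.2 (Nat.pos_of_ne_zero hne)
  have h2 := YoungDiagram.mem_iff_lt_colLen.1 h1
  exact absurd h2 (not_lt.2 h)

theorem youngDiagram_ext_rowLen {lam mu : YoungDiagram} (h : ∀ i, lam.rowLen i = mu.rowLen i) :
    lam = mu := by
  ext ⟨i, j⟩
  rw [YoungDiagram.mem_cells, YoungDiagram.mem_cells, YoungDiagram.mem_iff_lt_rowLen,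
    YoungDiagram.mem_iff_lt_rowLen, h]

/-- Subtracting the staircase from `s` and reversing gives the parts: strict growth makes `s j - j`
weakly increasing, and `j ≤ s j` keeps the subtraction from truncating. -/
theorem exists_partSeq_eq {N : ℕ} (s : Fin N → ℕ) (hs : StrictMono s) :
    ∃ lam : YoungDiagram, partLength lam ≤ N ∧ partSeq N lam = s := by
  have hgap : ∀ (k : ℕ) (a b : Fin N), (b : ℕ) = a + k → s a + k ≤ s b := by
    intro k
    induction k with
    | zero => intro a b h; rw [Fin.ext (by simpa using h) (a := b) (b := a)]; simp
    | succ k ih =>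
      intro a b h
      have h1 := ih a ⟨a + k, by omega⟩ rfl
      have h2 : s ⟨a + k, by omega⟩ < s b := hs (Fin.lt_def.2 (by simp; omega))
      omega
  have hge : ∀ j : Fin N, (j : ℕ) ≤ s j := by
    intro j
    have := hgap j ⟨0, j.pos⟩ j (by simp)
    omega
  set w : List ℕ := List.ofFn fun i : Fin N => s i.rev - (i.rev : ℕ) with hw
  have hlen : w.length = N := by simp [hw]
  have hsorted : w.SortedGE := by
    rw [hw, List.sortedGE_ofFn_iff]
    intro a b hab
    have hab' : (a : ℕ) ≤ b := hab
    have := hgap (b - a) b.rev a.rev (by simp [Fin.val_rev]; omega)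
    have h2 := hge b.rev
    simp only [Fin.val_rev] at *
    omega
  set lam := YoungDiagram.ofRowLens w hsorted with hlam
  refine ⟨lam, ?_, ?_⟩
  · by_contra hlt
    have h1 : (N, 0) ∈ lam := YoungDiagram.mem_iff_lt_colLen.2 (not_le.1 hlt)
    obtain ⟨h2, -⟩ := YoungDiagram.mem_ofRowLens.1 h1
    simp [hlen] at h2
  · funext j
    have h3 := YoungDiagram.rowLen_ofRowLens (hw := hsorted) ⟨N - 1 - j, by rw [hlen]; omega⟩
    rw [partSeq]
    simp only at h3
    rw [h3]
    have hj : (j : ℕ) < N := j.2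
    have hjN : N - 1 - (j : ℕ) < N := by omega
    have h4 : (⟨N - 1 - j, hjN⟩ : Fin N).rev = j := by
      refine Fin.ext ?_
      rw [Fin.val_rev]
      change N - (N - 1 - (j : ℕ) + 1) = j
      omega
    have h5 : w[N - 1 - (j : ℕ)]'(by rw [hlen]; omega) = s j - j := by
      simp only [hw, List.getElem_ofFn, h4]
    have h6 := hge j
    simp only [Fin.getElem_fin]
    omega

/-- Partitions of length at most `N` as strictly increasing sequences. -/
noncomputable def partSeqEquiv (N : ℕ) :
    {lam : YoungDiagram // partLength lam ≤ N} ≃ {s : Fin N → ℕ // StrictMono s} :=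
  Equiv.ofBijective (fun lam => ⟨partSeq N lam.1, partSeq_strictMono N lam.1⟩) <| by
    constructor
    · rintro ⟨lam, hlam⟩ ⟨mu, hmu⟩ h
      refine Subtype.ext (youngDiagram_ext_rowLen fun i => ?_)
      change lam.rowLen i = mu.rowLen i
      by_cases hi : i < N
      · have := congrFun (congrArg Subtype.val h) ⟨N - 1 - i, by omega⟩
        simp only [partSeq] at this
        rw [show N - 1 - (N - 1 - i) = i by omega] at this
        omega
      · rw [rowLen_eq_zero_of_partLength_le (hlam.trans (not_lt.1 hi)),
          rowLen_eq_zero_of_partLength_le (hmu.trans (not_lt.1 hi))]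
    · rintro ⟨s, hs⟩
      obtain ⟨lam, h1, h2⟩ := exists_partSeq_eq s hs
      exact ⟨⟨lam, h1⟩, Subtype.ext h2⟩

theorem hasSum_det_sq_partSeq {N : ℕ} (B : Fin N → ℕ → ℝ)
    (hB : ∀ i j, Summable fun s => B i s * B j s) :
    HasSum (fun lam : {lam : YoungDiagram // partLength lam ≤ N} =>
      (Matrix.of fun i j => B i (partSeq N lam.1 j)).det ^ 2)
      (Matrix.of fun i j => ∑' s, B i s * B j s).det := by
  have := (partSeqEquiv N).hasSum_iff.2 (hasSum_det_sq_strictMono B hB)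
  exact this

end PartitionSequences

/-! ### Euler's q-expansions and the exponential form of the weights. -/

section QSeries

open Filter Topology

variable {q : ℝ}

/-- The finite product `(q;q)_r = ∏_{1 ≤ t ≤ r} (1 - q^t)`. -/
noncomputable def qFact (q : ℝ) (r : ℕ) : ℝ := ∏ t ∈ Finset.range r, (1 - q ^ (t + 1))

theorem qFact_zero (q : ℝ) : qFact q 0 = 1 := by simp [qFact]

theorem qFact_succ (q : ℝ) (r : ℕ) : qFact q (r + 1) = qFact q r * (1 - q ^ (r + 1)) :=
  Finset.prod_range_succ _ _

theorem one_sub_pow_pos (hq0 : 0 ≤ q) (hq1 : q < 1) {n : ℕ} (hn : n ≠ 0) : 0 < 1 - q ^ n :=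
  sub_pos.2 (pow_lt_one₀ hq0 hq1 hn)

theorem qFact_pos (hq0 : 0 ≤ q) (hq1 : q < 1) (r : ℕ) : 0 < qFact q r :=
  Finset.prod_pos fun _ _ => one_sub_pow_pos hq0 hq1 (Nat.succ_ne_zero _)

theorem tendsto_mul_pow_zero (hq0 : 0 ≤ q) (hq1 : q < 1) (x : ℂ) :
    Tendsto (fun m : ℕ => x * (q : ℂ) ^ m) atTop (𝓝 0) := by
  have : Tendsto (fun m : ℕ => (q : ℂ) ^ m) atTop (𝓝 0) :=
    tendsto_pow_atTop_nhds_zero_of_norm_lt_one (by simpa [abs_of_nonneg hq0] using hq1)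
  simpa using this.const_mul x

theorem tendsto_prod_qPochInf (hq0 : 0 ≤ q) (hq1 : q < 1) (x : ℂ) :
    Tendsto (fun n => ∏ k ∈ Finset.range n, (1 - x * (q : ℂ) ^ k)) atTop (𝓝 (qPochInf x q)) := by
  have hm : Multipliable fun k : ℕ => 1 + -(x * (q : ℂ) ^ k) := by
    refine multipliable_one_add_of_summable ?_
    simp only [norm_neg, norm_mul, norm_pow, Complex.norm_real, Real.norm_eq_abs, abs_of_nonneg hq0]
    exact (summable_geometric_of_lt_one hq0 hq1).mul_left _
  simp only [← sub_eq_add_neg] at hm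
  exact hm.hasProd.tendsto_prod_nat

/-- A solution of `G(w) = (1 - w) G(q w)` along a geometric progression with limit `1`. -/
theorem eq_qPochInf_of_functional (hq0 : 0 ≤ q) (hq1 : q < 1) {x : ℂ} {g : ℕ → ℂ}
    (hg : Tendsto g atTop (𝓝 1)) (hfun : ∀ k, g k = (1 - x * (q : ℂ) ^ k) * g (k + 1)) :
    g 0 = qPochInf x q := by
  have h : ∀ n, g 0 = (∏ k ∈ Finset.range n, (1 - x * (q : ℂ) ^ k)) * g n := by
    intro n
    induction n with
    | zero => simp
    | succ n ih => rw [ih, Finset.prod_range_succ, hfun n, mul_assoc]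
  have h2 := (tendsto_prod_qPochInf hq0 hq1 x).mul hg
  rw [mul_one] at h2
  exact tendsto_nhds_unique (tendsto_const_nhds.congr h) h2

/-- A solution of `(1 - w) G(w) = G(q w)` along a geometric progression with limit `1`. -/
theorem mul_qPochInf_of_functional (hq0 : 0 ≤ q) (hq1 : q < 1) {x : ℂ} {g : ℕ → ℂ}
    (hg : Tendsto g atTop (𝓝 1)) (hfun : ∀ k, (1 - x * (q : ℂ) ^ k) * g k = g (k + 1)) :
    g 0 * qPochInf x q = 1 := by
  have h : ∀ n, (∏ k ∈ Finset.range n, (1 - x * (q : ℂ) ^ k)) * g 0 = g n := by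
    intro n
    induction n with
    | zero => simp
    | succ n ih => rw [← hfun n, ← ih, Finset.prod_range_succ]; ring
  have h2 := (tendsto_prod_qPochInf hq0 hq1 x).mul_const (g 0)
  rw [mul_comm]
  exact tendsto_nhds_unique (h2.congr h) hg

theorem norm_mul_pow_le (hq0 : 0 ≤ q) (hq1 : q < 1) (x : ℂ) (m : ℕ) :
    ‖x * (q : ℂ) ^ m‖ ≤ ‖x‖ := by
  rw [norm_mul, norm_pow, Complex.norm_real, Real.norm_eq_abs, abs_of_nonneg hq0]
  exact mul_le_of_le_one_right (norm_nonneg _) (pow_le_one₀ hq0 hq1.le)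

theorem tendsto_tsum_mul_pow (hq0 : 0 ≤ q) (hq1 : q < 1) {c : ℕ → ℂ} {x : ℂ}
    (hs : Summable fun r => ‖c r * x ^ r‖) :
    Tendsto (fun m : ℕ => ∑' r, c r * (x * (q : ℂ) ^ m) ^ r) atTop (𝓝 (c 0)) := by
  rw [← tsum_ite_eq (0 : ℕ) c]
  refine tendsto_tsum_of_dominated_convergence hs (fun r => ?_) (Eventually.of_forall fun m r => ?_)
  · rcases Nat.eq_zero_or_pos r with rfl | hr
    · simp
    · simp only [if_neg hr.ne']
      have := ((tendsto_mul_pow_zero hq0 hq1 x).pow r).const_mul (c r)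
      rwa [zero_pow hr.ne', mul_zero] at this
  · rw [norm_mul, norm_mul, norm_pow, norm_pow]
    exact mul_le_mul_of_nonneg_left
      (pow_le_pow_left₀ (norm_nonneg _) (norm_mul_pow_le hq0 hq1 x m) r) (norm_nonneg _)

theorem summable_norm_inv_qFact_mul_pow (hq0 : 0 ≤ q) (hq1 : q < 1) {w : ℂ} (hw : ‖w‖ < 1) :
    Summable fun r => ‖(qFact q r : ℂ)⁻¹ * w ^ r‖ := by
  rcases eq_or_ne w 0 with rfl | hw0
  · refine summable_of_ne_finset_zero (s := {0}) fun r hr => ?_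
    rw [zero_pow (by simpa using hr), mul_zero, norm_zero]
  have hne : ∀ r, (qFact q r : ℂ) ≠ 0 := fun r => Complex.ofReal_ne_zero.2 (qFact_pos hq0 hq1 r).ne'
  refine summable_of_ratio_test_tendsto_lt_one hw (Eventually.of_forall fun r => ?_) ?_
  · exact norm_ne_zero_iff.2 (mul_ne_zero (inv_ne_zero (hne r)) (pow_ne_zero _ hw0))
  have h1 : Tendsto (fun r : ℕ => ‖w‖ / (1 - q ^ (r + 1))) atTop (𝓝 (‖w‖ / (1 - 0))) := by
    refine Tendsto.div tendsto_const_nhds (tendsto_const_nhds.sub ?_) (by norm_num)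
    exact (tendsto_add_atTop_iff_nat 1).2 (tendsto_pow_atTop_nhds_zero_of_lt_one hq0 hq1)
  rw [sub_zero, div_one] at h1
  refine h1.congr fun r => ?_
  have h2 := one_sub_pow_pos hq0 hq1 (Nat.succ_ne_zero r)
  have h3 := qFact_pos hq0 hq1 r
  have h4 : ‖w‖ ≠ 0 := norm_ne_zero_iff.2 hw0
  rw [norm_norm, norm_norm, norm_mul, norm_mul, norm_inv, norm_inv, norm_pow, norm_pow,
    Complex.norm_real, Complex.norm_real, Real.norm_eq_abs, Real.norm_eq_abs,
    abs_of_pos h3, abs_of_pos (qFact_pos hq0 hq1 _), qFact_succ]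
  have h5 := h3.ne'
  have h6 : 1 - q ^ (r + 1) ≠ 0 := h2.ne'
  field_simp
  ring

/-- If `c_{r+1} - d_{r+1} = e_r` and `c_0 = d_0`, the generating functions satisfy
`C(w) - D(w) = w E(w)`. -/
theorem tsum_sub_tsum_eq_mul_tsum {c d e : ℕ → ℂ} {w : ℂ} (hc : Summable fun r => c r * w ^ r)
    (hd : Summable fun r => d r * w ^ r) (h0 : c 0 = d 0) (hs : ∀ r, c (r + 1) - d (r + 1) = e r) :
    ∑' r, c r * w ^ r - ∑' r, d r * w ^ r = w * ∑' r, e r * w ^ r := by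
  rw [← hc.tsum_sub hd, (hc.sub hd).tsum_eq_zero_add, h0, sub_self, zero_add, ← tsum_mul_left]
  refine tsum_congr fun r => ?_
  rw [← hs]; ring

/-- **Euler's expansion** of `1/(w;q)_∞`. -/
theorem hasSum_inv_qPochInf (hq0 : 0 ≤ q) (hq1 : q < 1) {w : ℂ} (hw : ‖w‖ < 1) :
    HasSum (fun r => (qFact q r : ℂ)⁻¹ * w ^ r) (qPochInf w q)⁻¹ := by
  have hsum := fun {v : ℂ} (hv : ‖v‖ < 1) => summable_norm_inv_qFact_mul_pow hq0 hq1 hv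
  have hlim := tendsto_tsum_mul_pow hq0 hq1 (hsum hw)
  rw [qFact_zero, Complex.ofReal_one, inv_one] at hlim
  have hne : ∀ r, (qFact q r : ℂ) ≠ 0 := fun r => Complex.ofReal_ne_zero.2 (qFact_pos hq0 hq1 r).ne'
  have key := mul_qPochInf_of_functional hq0 hq1 hlim (x := w) fun k => by
    obtain ⟨v, hv⟩ : ∃ v, v = w * (q : ℂ) ^ k := ⟨_, rfl⟩
    have hv1 : ‖v‖ < 1 := hv ▸ (norm_mul_pow_le hq0 hq1 w k).trans_lt hw
    have hv2 : ‖v * (q : ℂ) ^ 1‖ < 1 := (norm_mul_pow_le hq0 hq1 v 1).trans_lt hv1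
    have e1 : w * (q : ℂ) ^ (k + 1) = v * (q : ℂ) ^ 1 := by rw [hv]; ring
    rw [e1, ← hv]
    have e2 : ∀ r, (qFact q r : ℂ)⁻¹ * (v * (q : ℂ) ^ 1) ^ r =
        ((qFact q r : ℂ)⁻¹ * (q : ℂ) ^ r) * v ^ r := fun r => by ring
    have hd := (hsum hv2).of_norm
    simp only [e2] at hd ⊢
    have := tsum_sub_tsum_eq_mul_tsum (e := fun r => (qFact q r : ℂ)⁻¹) (hsum hv1).of_norm hd
      (by simp) fun r => by
        have h1 := hne r
        have h2 := hne (r + 1)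
        rw [qFact_succ] at h2 ⊢
        push_cast at h2 ⊢
        have h3 := right_ne_zero_of_mul h2
        field_simp
    linear_combination this
  simp only [pow_zero, mul_one] at key
  rw [← eq_inv_of_mul_eq_one_left key]
  exact (hsum hw).of_norm.hasSum

/-- **Euler's expansion** of `(-w;q)_∞`. -/
theorem hasSum_qPochInf_neg (hq0 : 0 ≤ q) (hq1 : q < 1) {w : ℂ} (hw : ‖w‖ < 1) :
    HasSum (fun r => ((q : ℂ) ^ r.choose 2 * (qFact q r : ℂ)⁻¹) * w ^ r) (qPochInf (-w) q) := by
  have hsum : ∀ {v : ℂ}, ‖v‖ < 1 →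
      Summable fun r => ‖((q : ℂ) ^ r.choose 2 * (qFact q r : ℂ)⁻¹) * v ^ r‖ := by
    intro v hv
    refine Summable.of_nonneg_of_le (fun _ => norm_nonneg _) (fun r => ?_)
      (summable_norm_inv_qFact_mul_pow hq0 hq1 hv)
    rw [mul_assoc, norm_mul]
    refine mul_le_of_le_one_left (norm_nonneg _) ?_
    rw [norm_pow, Complex.norm_real, Real.norm_eq_abs, abs_of_nonneg hq0]
    exact pow_le_one₀ hq0 hq1.le
  have hlim := tendsto_tsum_mul_pow hq0 hq1 (hsum hw)
  rw [qFact_zero, Complex.ofReal_one, inv_one, Nat.choose_zero_succ, pow_zero, mul_one] at hlim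
  have hne : ∀ r, (qFact q r : ℂ) ≠ 0 := fun r => Complex.ofReal_ne_zero.2 (qFact_pos hq0 hq1 r).ne'
  have key := eq_qPochInf_of_functional hq0 hq1 hlim (x := -w) fun k => by
    rw [neg_mul, sub_neg_eq_add]
    obtain ⟨v, hv⟩ : ∃ v, v = w * (q : ℂ) ^ k := ⟨_, rfl⟩
    have hv1 : ‖v‖ < 1 := hv ▸ (norm_mul_pow_le hq0 hq1 w k).trans_lt hw
    have hv2 : ‖v * (q : ℂ) ^ 1‖ < 1 := (norm_mul_pow_le hq0 hq1 v 1).trans_lt hv1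
    have e1 : w * (q : ℂ) ^ (k + 1) = v * (q : ℂ) ^ 1 := by rw [hv]; ring
    rw [e1, ← hv]
    have e2 : ∀ r, ((q : ℂ) ^ r.choose 2 * (qFact q r : ℂ)⁻¹) * (v * (q : ℂ) ^ 1) ^ r =
        ((q : ℂ) ^ r.choose 2 * (qFact q r : ℂ)⁻¹ * (q : ℂ) ^ r) * v ^ r := fun r => by ring
    have hd := (hsum hv2).of_norm
    simp only [e2] at hd ⊢
    -- Here the coefficient recursion reads `G(v) - G(qv) = v G(qv)`, because `(r+1).choose 2 = r +
    -- r.choose 2`.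
    have := tsum_sub_tsum_eq_mul_tsum
      (e := fun r => ((q : ℂ) ^ r.choose 2 * (qFact q r : ℂ)⁻¹ * (q : ℂ) ^ r))
      (hsum hv1).of_norm hd (by simp) fun r => by
        have h1 := hne r
        have h2 := hne (r + 1)
        rw [qFact_succ] at h2 ⊢
        rw [Nat.choose_succ_succ' r 1, Nat.choose_one_right, pow_add]
        push_cast at h2 ⊢
        have h3 := right_ne_zero_of_mul h2
        field_simp
    linear_combination this
  simp only [pow_zero, mul_one] at key
  rw [← key]
  exact (hsum hw).of_norm.hasSum

theorem summable_log_qPochInf (hq0 : 0 ≤ q) (hq1 : q < 1) {w : ℂ} (hw : ‖w‖ < 1) :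
    Summable fun n : ℕ => ‖(n * (1 - (q : ℂ) ^ n))⁻¹ * w ^ n‖ := by
  have h1q : 0 < 1 - q := by linarith
  refine Summable.of_nonneg_of_le (fun _ => norm_nonneg _) (fun n => ?_)
    ((summable_geometric_of_lt_one (norm_nonneg w) hw).mul_left (1 - q)⁻¹)
  rw [norm_mul, norm_pow]
  refine mul_le_mul_of_nonneg_right ?_ (by positivity)
  rcases Nat.eq_zero_or_pos n with rfl | hn
  · simpa using h1q.le
  have h2 : (n * (1 - (q : ℂ) ^ n)) = ((n * (1 - q ^ n) : ℝ) : ℂ) := by push_cast; ring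
  have h3 : q ^ n ≤ q := pow_le_of_le_one hq0 hq1.le hn.ne'
  have h4 : (1 : ℝ) ≤ n := by exact_mod_cast hn
  have h5 : 1 - q ≤ n * (1 - q ^ n) := by nlinarith
  rw [norm_inv, h2, Complex.norm_real, Real.norm_eq_abs, abs_of_pos (h1q.trans_le h5)]
  exact inv_anti₀ h1q h5

/-- With `L(w)` the series in the exponent, `L(w) - L(qw) = ∑ wⁿ/n = -log(1 - w)`, so `exp L` obeys
the functional equation of `1/(w;q)_∞`. The term `n = 0` is zero, as the inverse of zero. -/
theorem exp_tsum_mul_qPochInf (hq0 : 0 ≤ q) (hq1 : q < 1) {w : ℂ} (hw : ‖w‖ < 1) :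
    Complex.exp (∑' n : ℕ, (n * (1 - (q : ℂ) ^ n))⁻¹ * w ^ n) * qPochInf w q = 1 := by
  have hsum := fun {v : ℂ} (hv : ‖v‖ < 1) => summable_log_qPochInf hq0 hq1 hv
  have hlim := (Complex.continuous_exp.tendsto _).comp (tendsto_tsum_mul_pow hq0 hq1 (hsum hw))
  simp only [Nat.cast_zero, zero_mul, inv_zero, Complex.exp_zero] at hlim
  have key := mul_qPochInf_of_functional hq0 hq1 hlim (x := w) fun k => by
    simp only [Function.comp]
    obtain ⟨v, hv⟩ : ∃ v, v = w * (q : ℂ) ^ k := ⟨_, rfl⟩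
    have hv1 : ‖v‖ < 1 := hv ▸ (norm_mul_pow_le hq0 hq1 w k).trans_lt hw
    have hv2 : ‖v * (q : ℂ) ^ 1‖ < 1 := (norm_mul_pow_le hq0 hq1 v 1).trans_lt hv1
    have e1 : w * (q : ℂ) ^ (k + 1) = v * (q : ℂ) ^ 1 := by rw [hv]; ring
    rw [e1, ← hv]
    have hv3 : 1 - v ≠ 0 := by
      intro h
      rw [← sub_eq_zero.1 h] at hv1
      simp at hv1
    have h1 := (hsum hv1).of_norm.tsum_sub (hsum hv2).of_norm
    have h2 : ∀ n : ℕ, (n * (1 - (q : ℂ) ^ n))⁻¹ * v ^ n -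
        (n * (1 - (q : ℂ) ^ n))⁻¹ * (v * (q : ℂ) ^ 1) ^ n = v ^ n / n := by
      intro n
      rcases Nat.eq_zero_or_pos n with rfl | hn
      · simp
      have h3 : (1 - (q : ℂ) ^ n) ≠ 0 := by
        have := (one_sub_pow_pos hq0 hq1 hn.ne').ne'
        exact_mod_cast this
      have h4 : (n : ℂ) ≠ 0 := by exact_mod_cast hn.ne'
      rw [pow_one, mul_pow]
      field_simp
    rw [tsum_congr h2, (Complex.hasSum_taylorSeries_neg_log hv1).tsum_eq] at h1
    rw [show ∑' n : ℕ, (n * (1 - (q : ℂ) ^ n))⁻¹ * (v * (q : ℂ) ^ 1) ^ n =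
      ∑' n : ℕ, (n * (1 - (q : ℂ) ^ n))⁻¹ * v ^ n + Complex.log (1 - v) by linear_combination h1,
      Complex.exp_add, Complex.exp_log hv3, mul_comm]
  simpa using key

theorem expTerm_eq (hq : 0 < q) (a : ℝ) (z : ℂ) (n : ℕ) :
    expTerm a q z n = -((n * (1 - (q : ℂ) ^ n))⁻¹ * (a * √q * z) ^ n +
      (n * (1 - (q : ℂ) ^ n))⁻¹ * (a * √q * z⁻¹) ^ n) := by
  have hs : (√q : ℂ) ≠ 0 := Complex.ofReal_ne_zero.2 (Real.sqrt_pos.2 hq).ne'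
  have hs2 : (q : ℂ) = (√q : ℂ) ^ 2 := by
    rw [← Complex.ofReal_pow, Real.sq_sqrt hq.le]
  set s : ℂ := (√q : ℂ)
  have h1 : s ^ n - (s ^ n)⁻¹ = -((1 - (q : ℂ) ^ n) * (s ^ n)⁻¹) := by
    have := pow_ne_zero n hs
    rw [hs2]; field_simp; ring
  have h2 := pow_ne_zero n hs
  rw [expTerm, h1, div_eq_mul_inv]
  simp only [mul_inv, inv_neg, mul_neg, inv_inv, mul_pow, inv_pow]
  ring

theorem hasSum_expTerm (hq0 : 0 < q) (hq1 : q < 1) {a : ℝ} {z : ℂ}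
    (h1 : ‖a * √q * z‖ < 1) (h2 : ‖a * √q * z⁻¹‖ < 1) :
    HasSum (fun n : ℕ => expTerm a q z (n + 1))
      (-(∑' n : ℕ, (n * (1 - (q : ℂ) ^ n))⁻¹ * (a * √q * z) ^ n +
        ∑' n : ℕ, (n * (1 - (q : ℂ) ^ n))⁻¹ * (a * √q * z⁻¹) ^ n)) := by
  have h := ((summable_log_qPochInf hq0.le hq1 h1).of_norm.hasSum.add
    (summable_log_qPochInf hq0.le hq1 h2).of_norm.hasSum).neg
  simp only [← expTerm_eq hq0] at h
  -- The dropped term at index `0` vanishes, its denominator being zero.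
  rw [← hasSum_nat_add_iff' 1] at h
  simpa [expTerm] using h

theorem exponential_formulas {ξ : ℝ} (hξ₀ : 0 ≤ ξ) (hq0 : 0 < q) (hq1 : q < 1) {z : ℂ}
    (hz1 : ξ * √q < ‖z‖) (hz2 : ξ * √q * ‖z‖ < 1) :
    Summable (fun n : ℕ => expTerm ξ q z (n + 1)) ∧
      weight ξ q z = Complex.exp (-∑' n : ℕ, expTerm ξ q z (n + 1)) ∧
      Summable (fun n : ℕ => expTerm (-ξ) q z (n + 1)) ∧
      weightCheck ξ q z = Complex.exp (∑' n : ℕ, expTerm (-ξ) q z (n + 1)) := by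
  have hx0 : 0 ≤ ξ * √q := mul_nonneg hξ₀ (Real.sqrt_nonneg q)
  have hz : 0 < ‖z‖ := hx0.trans_lt hz1
  have n1 : ‖(ξ : ℂ) * √q‖ = ξ * √q := by
    rw [← Complex.ofReal_mul, Complex.norm_real, Real.norm_eq_abs, abs_of_nonneg hx0]
  have h1 : ‖(ξ : ℂ) * √q * z‖ < 1 := by rwa [norm_mul, n1]
  have h2 : ‖(ξ : ℂ) * √q * z⁻¹‖ < 1 := by
    rw [norm_mul, n1, norm_inv, ← div_eq_mul_inv, div_lt_one hz]; exact hz1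
  have e1 : ((-ξ : ℝ) : ℂ) * √q * z = -(ξ * √q * z) := by push_cast; ring
  have e2 : ((-ξ : ℝ) : ℂ) * √q * z⁻¹ = -(ξ * √q * z⁻¹) := by push_cast; ring
  have h1' : ‖-((ξ : ℂ) * √q * z)‖ < 1 := by rwa [norm_neg]
  have h2' : ‖-((ξ : ℂ) * √q * z⁻¹)‖ < 1 := by rwa [norm_neg]
  have s1 := hasSum_expTerm hq0 hq1 h1 h2
  have s2 := hasSum_expTerm hq0 hq1 (a := -ξ) (z := z) (by rwa [e1]) (by rwa [e2])
  rw [e1, e2] at s2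
  refine ⟨s1.summable, ?_, s2.summable, ?_⟩
  · rw [s1.tsum_eq, neg_neg, Complex.exp_add, weight, mul_inv,
      eq_inv_of_mul_eq_one_left (exp_tsum_mul_qPochInf hq0.le hq1 h1),
      eq_inv_of_mul_eq_one_left (exp_tsum_mul_qPochInf hq0.le hq1 h2)]
  · rw [s2.tsum_eq, neg_add, Complex.exp_add, weightCheck, Complex.exp_neg, Complex.exp_neg,
      ← eq_inv_of_mul_eq_one_right (exp_tsum_mul_qPochInf hq0.le hq1 h1'),
      ← eq_inv_of_mul_eq_one_right (exp_tsum_mul_qPochInf hq0.le hq1 h2')]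

end QSeries

/-! ### Hook lengths and the Vandermonde determinant of a partition. -/

section HookFormula

open Finset

variable {q : ℝ}

theorem prod_univ_rev_eq_prod_range {M : Type*} [CommMonoid M] (N : ℕ) (g : ℕ → M) :
    ∏ j : Fin N, g (N - 1 - j) = ∏ i ∈ range N, g i := by
  rw [← Finset.prod_range_reflect, Finset.prod_range]

theorem sum_univ_rev_eq_sum_range {M : Type*} [AddCommMonoid M] (N : ℕ) (g : ℕ → M) :
    ∑ j : Fin N, g (N - 1 - j) = ∑ i ∈ range N, g i := by
  rw [← Finset.sum_range_reflect, Finset.sum_range]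

theorem mem_cells_iff_of_partLength_le {lam : YoungDiagram} {N : ℕ} (h : partLength lam ≤ N)
    (p : ℕ × ℕ) : p ∈ lam.cells ↔ p.1 ∈ range N ∧ p.2 ∈ range (lam.rowLen p.1) := by
  obtain ⟨i, j⟩ := p
  rw [YoungDiagram.mem_cells, YoungDiagram.mem_iff_lt_rowLen, mem_range, mem_range]
  refine ⟨fun hj => ⟨?_, hj⟩, fun hj => hj.2⟩
  by_contra hi
  rw [rowLen_eq_zero_of_partLength_le (h.trans (not_lt.1 hi))] at hj
  omega

theorem prod_cells {M : Type*} [CommMonoid M] {lam : YoungDiagram} {N : ℕ}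
    (h : partLength lam ≤ N) (f : ℕ × ℕ → M) :
    ∏ c ∈ lam.cells, f c = ∏ i ∈ range N, ∏ j ∈ range (lam.rowLen i), f (i, j) :=
  Finset.prod_finset_product _ _ _ (mem_cells_iff_of_partLength_le h)

theorem sum_cells {M : Type*} [AddCommMonoid M] {lam : YoungDiagram} {N : ℕ}
    (h : partLength lam ≤ N) (f : ℕ × ℕ → M) :
    ∑ c ∈ lam.cells, f c = ∑ i ∈ range N, ∑ j ∈ range (lam.rowLen i), f (i, j) :=
  Finset.sum_finset_product _ _ _ (mem_cells_iff_of_partLength_le h)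

theorem card_eq_sum_rowLen {lam : YoungDiagram} {N : ℕ} (h : partLength lam ≤ N) :
    lam.card = ∑ i ∈ range N, lam.rowLen i := by
  have := sum_cells h fun _ => 1
  simpa using this

theorem bStat_eq_sum_cells (lam : YoungDiagram) : bStat lam = ∑ c ∈ lam.cells, c.1 := by
  rw [sum_cells le_rfl, bStat]
  refine sum_congr rfl fun i _ => ?_
  simp [mul_comm]

theorem bStat_eq_sum_range {lam : YoungDiagram} {N : ℕ} (h : partLength lam ≤ N) :
    bStat lam = ∑ i ∈ range N, i * lam.rowLen i := by
  rw [bStat_eq_sum_cells, sum_cells h]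
  refine sum_congr rfl fun i _ => ?_
  simp [mul_comm]

theorem prod_cells_transpose {M : Type*} [CommMonoid M] (lam : YoungDiagram) (f : ℕ × ℕ → M) :
    ∏ c ∈ lam.transpose.cells, f c = ∏ c ∈ lam.cells, f c.swap := by
  refine Finset.prod_bij' (fun c _ => c.swap) (fun c _ => c.swap) ?_ ?_ ?_ ?_ ?_
  · intro c hc
    rwa [YoungDiagram.mem_cells, YoungDiagram.mem_transpose, ← YoungDiagram.mem_cells] at hc
  · intro c hc
    rw [YoungDiagram.mem_cells, YoungDiagram.mem_transpose, Prod.swap_swap]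
    exact hc
  · simp
  · simp
  · simp

theorem sum_cells_transpose {M : Type*} [AddCommMonoid M] (lam : YoungDiagram) (f : ℕ × ℕ → M) :
    ∑ c ∈ lam.transpose.cells, f c = ∑ c ∈ lam.cells, f c.swap :=
  prod_cells_transpose (M := Multiplicative M) lam f

theorem card_transpose (lam : YoungDiagram) : lam.transpose.card = lam.card := by
  have := sum_cells_transpose lam fun _ => 1
  simpa using this

theorem bStat_transpose_eq_sum_choose {lam : YoungDiagram} {N : ℕ} (h : partLength lam ≤ N) :
    bStat lam.transpose = ∑ i ∈ range N, (lam.rowLen i).choose 2 := by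
  rw [bStat_eq_sum_cells, sum_cells_transpose, sum_cells h]
  refine sum_congr rfl fun i _ => ?_
  simp only [Prod.fst_swap]
  rw [Finset.sum_range_id, Nat.choose_two_right]

theorem hookLen_transpose (lam : YoungDiagram) (c : ℕ × ℕ) :
    hookLen lam.transpose c = hookLen lam c.swap := by
  simp only [hookLen, YoungDiagram.rowLen_transpose, YoungDiagram.colLen_transpose, Prod.fst_swap,
    Prod.snd_swap]
  omega

/-- The hook lengths of a row and the differences of the associated sequence fill an interval. -/
theorem prod_hook_mul_prod_diff {N : ℕ} {lam : YoungDiagram} (hlam : partLength lam ≤ N)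
    (j : Fin N) :
    (∏ c ∈ range (lam.rowLen (N - 1 - j)), (1 - q ^ hookLen lam (N - 1 - j, c))) *
      ∏ i ∈ Iio j, (1 - q ^ (partSeq N lam j - partSeq N lam i)) = qFact q (partSeq N lam j) := by
  classical
  have hj := j.2
  set r := N - 1 - (j : ℕ) with hr
  have hcol : ∀ c, c < lam.rowLen r → r < lam.colLen c := fun c hc =>
    YoungDiagram.mem_iff_lt_colLen.1 (YoungDiagram.mem_iff_lt_rowLen.2 hc)
  have hcolN : ∀ c, lam.colLen c ≤ N := fun c =>
    (lam.colLen_anti 0 c (Nat.zero_le _)).trans hlam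
  have hs : partSeq N lam j = lam.rowLen r + j := rfl
  have hA : Set.InjOn (fun c => hookLen lam (r, c)) (range (lam.rowLen r)) := by
    intro c hc d hd h
    simp only [coe_range, Set.mem_Iio] at hc hd
    have h1 := hcol c hc
    have h2 := hcol d hd
    simp only [hookLen] at h
    rcases le_total c d with hcd | hcd
    · have := lam.colLen_anti c d hcd
      omega
    · have := lam.colLen_anti d c hcd
      omega
  have hB : Set.InjOn (fun i => partSeq N lam j - partSeq N lam i) (Iio j : Finset (Fin N)) := by
    intro a ha b hb h
    simp only [coe_Iio, Set.mem_Iio] at ha hb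
    have h1 := partSeq_strictMono N lam ha
    have h2 := partSeq_strictMono N lam hb
    refine (partSeq_strictMono N lam).injective ?_
    simp only at h
    omega
  rw [← prod_image (f := fun n => 1 - q ^ n) hA, ← prod_image (f := fun n => 1 - q ^ n) hB]
  have hdisj : Disjoint ((range (lam.rowLen r)).image fun c => hookLen lam (r, c))
      ((Iio j).image fun i => partSeq N lam j - partSeq N lam i) := by
    rw [Finset.disjoint_left]
    intro n hn hn'
    obtain ⟨c, hc, rfl⟩ := mem_image.1 hn
    obtain ⟨i, hi, h⟩ := mem_image.1 hn'
    rw [mem_range] at hc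
    rw [mem_Iio] at hi
    have h1 := hcol c hc
    have h2 := partSeq_strictMono N lam hi
    have h3 : (i : ℕ) < j := hi
    simp only [hookLen, hs] at h h2
    have hsi : partSeq N lam i = lam.rowLen (N - 1 - i) + i := rfl
    rw [hsi] at h h2
    -- Put `k = N - 1 - i`. If the cell `(k, c)` lies in the diagram, the hook length exceeds the
    -- difference; otherwise it falls short. The two never agree.
    rcases lt_or_ge (N - 1 - (i : ℕ)) (lam.colLen c) with hk | hk
    · have h4 := YoungDiagram.mem_iff_lt_rowLen.1 (YoungDiagram.mem_iff_lt_colLen.2 hk)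
      omega
    · have h4 : lam.rowLen (N - 1 - i) ≤ c := by
        by_contra hlt
        exact absurd (YoungDiagram.mem_iff_lt_colLen.1
          (YoungDiagram.mem_iff_lt_rowLen.2 (not_le.1 hlt))) (not_lt.2 hk)
      omega
  rw [← prod_union hdisj]
  -- Both sets lie in `{1, …, s_j}`; being disjoint, with `λ_r` and `j` elements, they fill it
  -- because `s_j = λ_r + j`.
  have heq : ((range (lam.rowLen r)).image fun c => hookLen lam (r, c)) ∪
      ((Iio j).image fun i => partSeq N lam j - partSeq N lam i) =
      (range (partSeq N lam j)).image (· + 1) := by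
    refine Finset.eq_of_subset_of_card_le ?_ ?_
    · intro n hn
      rw [mem_image]
      refine ⟨n - 1, ?_⟩
      rcases mem_union.1 hn with hn | hn
      · obtain ⟨c, hc, rfl⟩ := mem_image.1 hn
        rw [mem_range] at hc
        have h1 := hcol c hc
        have h2 := hcolN c
        simp only [hookLen, mem_range, hs]
        omega
      · obtain ⟨i, hi, rfl⟩ := mem_image.1 hn
        rw [mem_Iio] at hi
        have h2 := partSeq_strictMono N lam hi
        rw [mem_range]
        omega
    · rw [card_union_of_disjoint hdisj, card_image_of_injOn hA, card_image_of_injOn hB,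
        card_range, Fin.card_Iio, card_image_of_injective _ (add_left_injective 1), card_range, hs]
  rw [heq, prod_image fun _ _ _ _ h => add_left_injective 1 h, qFact]

/-- `q^{b(λ)} ∏_{c ∈ λ} (1 - q^{h(c)})⁻¹`, the principal specialization of the Schur function up to
a power of the variable. -/
noncomputable def hookWeight (q : ℝ) (lam : YoungDiagram) : ℝ :=
  q ^ bStat lam * ∏ c ∈ lam.cells, (1 - q ^ hookLen lam c)⁻¹

theorem hookLen_pos {lam : YoungDiagram} {c : ℕ × ℕ} (hc : c ∈ lam.cells) :
    hookLen lam c ≠ 0 := by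
  obtain ⟨i, j⟩ := c
  have h1 := YoungDiagram.mem_iff_lt_rowLen.1 hc
  have h2 := YoungDiagram.mem_iff_lt_colLen.1 hc
  simp only [hookLen]
  omega

theorem prod_hook_pos (hq0 : 0 ≤ q) (hq1 : q < 1) (lam : YoungDiagram) :
    0 < ∏ c ∈ lam.cells, (1 - q ^ hookLen lam c) :=
  prod_pos fun _ hc => one_sub_pow_pos hq0 hq1 (hookLen_pos hc)

/-- The row-by-row identity `prod_hook_mul_prod_diff` multiplied over all rows; it turns a product
over pairs into a product over cells. -/
theorem prod_diff_eq (hq0 : 0 ≤ q) (hq1 : q < 1) {N : ℕ} {lam : YoungDiagram}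
    (hlam : partLength lam ≤ N) :
    ∏ i : Fin N, ∏ j ∈ Ioi i, (1 - q ^ (partSeq N lam j - partSeq N lam i)) =
      (∏ c ∈ lam.cells, (1 - q ^ hookLen lam c)⁻¹) * ∏ j, qFact q (partSeq N lam j) := by
  have h1 : ∏ i : Fin N, ∏ j ∈ Ioi i, (1 - q ^ (partSeq N lam j - partSeq N lam i)) =
      ∏ j : Fin N, ∏ i ∈ Iio j, (1 - q ^ (partSeq N lam j - partSeq N lam i)) :=
    Finset.prod_comm' (by simp)
  rw [h1, prod_inv_distrib, eq_inv_mul_iff_mul_eq₀ (prod_hook_pos hq0 hq1 lam).ne',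
    ← prod_congr rfl fun j _ => prod_hook_mul_prod_diff hlam j, prod_mul_distrib,
    prod_univ_rev_eq_prod_range N fun i => ∏ c ∈ range (lam.rowLen i), (1 - q ^ hookLen lam (i, c)),
    prod_cells hlam]

/-- This is the power of `q` extracted from the Vandermonde product, where `q^{s_i}` comes out once
for each of the `N - 1 - i` larger indices. -/
theorem sum_partSeq_mul {N : ℕ} {lam : YoungDiagram} (hlam : partLength lam ≤ N) :
    ∑ i : Fin N, partSeq N lam i * (N - 1 - i) =
      bStat lam + ∑ i ∈ range N, i.choose 2 := by
  have h1 : ∀ N : ℕ, ∑ i ∈ range N, i * (N - 1 - i) = ∑ i ∈ range N, i.choose 2 := by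
    intro N
    induction N with
    | zero => simp
    | succ n ih =>
      rw [sum_range_succ, sum_range_succ, ← ih, Nat.choose_two_right, ← Finset.sum_range_id,
        ← sum_add_distrib]
      simp only [Nat.add_sub_cancel, Nat.sub_self, mul_zero, add_zero]
      refine sum_congr rfl fun i hi => ?_
      rw [mem_range] at hi
      rw [show n - i = n - 1 - i + 1 by omega]
      ring
  simp only [partSeq, add_mul, sum_add_distrib]
  rw [← h1, bStat_eq_sum_range hlam, ← sum_univ_rev_eq_sum_range N fun i => i * lam.rowLen i,
    Finset.sum_range]
  simp only [mul_comm]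

theorem sum_partSeq {N : ℕ} {lam : YoungDiagram} (hlam : partLength lam ≤ N) :
    ∑ i : Fin N, partSeq N lam i = lam.card + ∑ i : Fin N, (i : ℕ) := by
  simp only [partSeq, sum_add_distrib]
  rw [card_eq_sum_rowLen hlam, ← sum_univ_rev_eq_sum_range]

/-- The Vandermonde determinant of the sequence `q^{s_j}` of a partition. -/
theorem det_vandermonde_partSeq_sq (hq0 : 0 ≤ q) (hq1 : q < 1) {N : ℕ} {lam : YoungDiagram}
    (hlam : partLength lam ≤ N) :
    (Matrix.vandermonde fun j : Fin N => q ^ partSeq N lam j).det ^ 2 =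
      (q ^ (∑ i ∈ range N, i.choose 2) * hookWeight q lam * ∏ j, qFact q (partSeq N lam j)) ^ 2 := by
  have h1 : ∀ i j : Fin N, j ∈ Ioi i → (q ^ partSeq N lam j - q ^ partSeq N lam i) ^ 2 =
      (q ^ partSeq N lam i * (1 - q ^ (partSeq N lam j - partSeq N lam i))) ^ 2 := by
    intro i j hij
    have := partSeq_strictMono N lam (mem_Ioi.1 hij)
    have h2 : q ^ partSeq N lam j =
        q ^ partSeq N lam i * q ^ (partSeq N lam j - partSeq N lam i) := by
      rw [← pow_add]; congr 1; omega
    rw [h2]; ring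
  rw [Matrix.det_vandermonde, ← prod_pow]
  simp_rw [← prod_pow]
  rw [prod_congr rfl fun i _ => prod_congr rfl (h1 i)]
  simp_rw [prod_pow, prod_mul_distrib]
  rw [prod_diff_eq hq0 hq1 hlam, hookWeight]
  simp only [prod_const, Fin.card_Ioi, ← pow_mul]
  rw [prod_pow_eq_pow_sum, sum_partSeq_mul hlam, pow_add]
  ring

end HookFormula

/-! ### Jacobi–Trudi minors as hook products. -/

section HookDeterminants

open Finset

variable {q : ℝ}

/-- `(q;q)_{s-i}⁻¹ = (q;q)_s⁻¹ ∏_{t<i} (1 - q^{s-t})`. -/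
theorem inv_qFact_sub (hq0 : 0 ≤ q) (hq1 : q < 1) {i s : ℕ} (h : i ≤ s) :
    (qFact q (s - i))⁻¹ = (∏ t ∈ range i, (1 - q ^ (s - t))) * (qFact q s)⁻¹ := by
  induction i with
  | zero => simp
  | succ i ih =>
    rw [prod_range_succ, mul_right_comm, ← ih (by omega)]
    have h1 : qFact q (s - i) = qFact q (s - (i + 1)) * (1 - q ^ (s - i)) := by
      conv_lhs => rw [show s - i = s - (i + 1) + 1 by omega]
      rw [qFact_succ, show s - (i + 1) + 1 = s - i by omega]
    have h2 := (qFact_pos hq0 hq1 (s - (i + 1))).ne'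
    have h3 : 1 - q ^ (s - i) ≠ 0 := (one_sub_pow_pos hq0 hq1 (by omega)).ne'
    rw [h1]
    field_simp

theorem natDegree_prod_range_X_sub_C (c : ℕ → ℝ) (i : ℕ) :
    (∏ t ∈ range i, (Polynomial.X - Polynomial.C (c t))).natDegree = i := by
  rw [Polynomial.natDegree_prod_of_monic _ _ fun t _ => Polynomial.monic_X_sub_C _]
  simp

/-- The products `∏_{t<i} (y - c t)` are monic of degree `i` (a Newton basis), so passing to powers
of `y` leaves the determinant unchanged. -/
theorem det_of_mul_eval_prod {N : ℕ} (u v y : Fin N → ℝ) (c : ℕ → ℝ) :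
    (Matrix.of fun i j : Fin N => u j * (v i * ∏ t ∈ range i, (y j - c t))).det =
      (∏ j, u j) * ((∏ i, v i) * (Matrix.vandermonde y).det) := by
  rw [Matrix.det_eval_matrixOfPolynomials_eq_det_vandermonde y
    (fun i => ∏ t ∈ range i, (Polynomial.X - Polynomial.C (c t)))
    (fun i => natDegree_prod_range_X_sub_C c i)
    (fun i => Polynomial.monic_prod_of_monic _ _ fun t _ => Polynomial.monic_X_sub_C _),
    ← Matrix.det_transpose (Matrix.of fun i j => _), ← Matrix.det_mul_row, ← Matrix.det_mul_column]
  congr 1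
  ext i j
  simp [Polynomial.eval_prod]

/-- Apart from factors in `s` alone or in `i` alone, the shifted term is a monic polynomial of
degree `i` in `q^s`. For `s < i` the factor `t = s` vanishes, so the cutoff in `shiftSeq` is built
in. -/
theorem shiftSeq_inv_qFact (hq0 : 0 < q) (hq1 : q < 1) {x : ℝ} (hx : x ≠ 0) (i s : ℕ) :
    shiftSeq (fun r => (qFact q r)⁻¹ * x ^ r) i s =
      (x ^ s * (qFact q s)⁻¹) * (((x ^ i)⁻¹ * ((-1) ^ i * (q ^ i.choose 2)⁻¹)) *
        ∏ t ∈ range i, (q ^ s - q ^ t)) := by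
  rw [shiftSeq]
  split_ifs with h
  · have h1 : ∏ t ∈ range i, (q ^ s - q ^ t) =
        (-1) ^ i * q ^ i.choose 2 * ∏ t ∈ range i, (1 - q ^ (s - t)) := by
      have h2 : ∀ t ∈ range i, q ^ s - q ^ t = (-1) * q ^ t * (1 - q ^ (s - t)) := by
        intro t ht
        rw [mem_range] at ht
        have : q ^ s = q ^ t * q ^ (s - t) := by rw [← pow_add]; congr 1; omega
        rw [this]; ring
      rw [prod_congr rfl h2, prod_mul_distrib, prod_mul_distrib, prod_const, card_range,
        prod_pow_eq_pow_sum, Finset.sum_range_id, Nat.choose_two_right]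
    have h3 : x ^ s = x ^ (s - i) * x ^ i := by rw [← pow_add]; congr 1; omega
    have h4 := pow_ne_zero i hx
    have h5 := pow_ne_zero (i.choose 2) hq0.ne'
    have h7 := (qFact_pos hq0.le hq1 s).ne'
    have h6 : ((-1 : ℝ) ^ i) * (-1) ^ i = 1 := by rw [← mul_pow]; norm_num
    rw [h1, inv_qFact_sub hq0.le hq1 h, h3]
    generalize ((-1 : ℝ) ^ i) = e at *
    generalize ∏ t ∈ range i, (1 - q ^ (s - t)) = P
    field_simp
    linear_combination (-P) * h6
  · rw [prod_eq_zero (mem_range.2 (not_le.1 h)) (sub_self _)]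
    ring

/-- The minor reduces to the Vandermonde determinant in `q^s`; its `(q;q)_s` factors and powers of
`q` cancel those of the Newton form. Squaring disposes of the sign. -/
theorem det_shiftSeq_inv_qFact_sq (hq0 : 0 < q) (hq1 : q < 1) {x : ℝ} (hx : x ≠ 0) {N : ℕ}
    {lam : YoungDiagram} (hlam : partLength lam ≤ N) :
    (Matrix.of fun i j : Fin N =>
      shiftSeq (fun r => (qFact q r)⁻¹ * x ^ r) i (partSeq N lam j)).det ^ 2 =
      (x ^ lam.card * hookWeight q lam) ^ 2 := by
  simp only [shiftSeq_inv_qFact hq0 hq1 hx]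
  rw [det_of_mul_eval_prod (fun j => x ^ partSeq N lam j * (qFact q (partSeq N lam j))⁻¹)
    (fun i : Fin N => (x ^ (i : ℕ))⁻¹ * ((-1) ^ (i : ℕ) * (q ^ (i : ℕ).choose 2)⁻¹))
    (fun j => q ^ partSeq N lam j) (fun t => q ^ t)]
  rw [mul_pow, mul_pow, det_vandermonde_partSeq_sq hq0.le hq1 hlam, prod_mul_distrib,
    prod_mul_distrib, prod_mul_distrib, prod_inv_distrib, prod_inv_distrib, prod_inv_distrib,
    prod_pow_eq_pow_sum, prod_pow_eq_pow_sum, prod_pow_eq_pow_sum, prod_pow_eq_pow_sum,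
    sum_partSeq hlam, pow_add, Finset.sum_range]
  have h1 : (∏ j, qFact q (partSeq N lam j)) ≠ 0 :=
    (prod_pos fun j _ => qFact_pos hq0.le hq1 _).ne'
  have h2 := pow_ne_zero (∑ i : Fin N, (i : ℕ)) hx
  have h3 := pow_ne_zero (∑ i : Fin N, (i : ℕ).choose 2) hq0.ne'
  have h4 : (((-1 : ℝ)) ^ (∑ i : Fin N, (i : ℕ))) ^ 2 = 1 := by rw [← pow_mul, mul_comm, pow_mul]; simp
  simp only [mul_pow, inv_pow, h4]
  field_simp

theorem choose_two_sub_add {i s : ℕ} (h : i ≤ s) :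
    (s - i).choose 2 + s * i = s.choose 2 + (i + 1).choose 2 := by
  obtain ⟨d, rfl⟩ := Nat.exists_eq_add_of_le h
  have : (((i + d - i).choose 2 + (i + d) * i : ℕ) : ℚ) =
      (((i + d).choose 2 + (i + 1).choose 2 : ℕ) : ℚ) := by
    rw [Nat.add_sub_cancel_left]
    push_cast [Nat.cast_choose_two]
    ring
  exact_mod_cast this

/-- The quadratic exponent of `s - i` contributes `q^(-s i)`, which changes the polynomial variable
from `q^s` to `q^{-s}`. -/
theorem shiftSeq_choose_two (hq0 : 0 < q) (hq1 : q < 1) {x : ℝ} (hx : x ≠ 0) (i s : ℕ) :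
    shiftSeq (fun r => q ^ r.choose 2 * (qFact q r)⁻¹ * x ^ r) i s =
      (x ^ s * q ^ s.choose 2 * (qFact q s)⁻¹) * (((x ^ i)⁻¹ * q ^ (i + 1).choose 2) *
        ∏ t ∈ range i, ((q ^ s)⁻¹ - (q ^ t)⁻¹)) := by
  rw [shiftSeq]
  split_ifs with h
  · have h1 : ∏ t ∈ range i, ((q ^ s)⁻¹ - (q ^ t)⁻¹) =
        (q ^ (s * i))⁻¹ * ∏ t ∈ range i, (1 - q ^ (s - t)) := by
      have h2 : ∀ t ∈ range i, (q ^ s)⁻¹ - (q ^ t)⁻¹ = (q ^ s)⁻¹ * (1 - q ^ (s - t)) := by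
        intro t ht
        rw [mem_range] at ht
        have : q ^ s = q ^ t * q ^ (s - t) := by rw [← pow_add]; congr 1; omega
        have h3 := pow_ne_zero t hq0.ne'
        have h4 := pow_ne_zero (s - t) hq0.ne'
        rw [this]; field_simp
      rw [prod_congr rfl h2, prod_mul_distrib, prod_const, card_range, inv_pow, ← pow_mul]
    have h3 : x ^ s = x ^ (s - i) * x ^ i := by rw [← pow_add]; congr 1; omega
    have h4 := pow_ne_zero i hx
    have h5 := pow_ne_zero (s * i) hq0.ne'
    have h6 : q ^ (s - i).choose 2 * q ^ (s * i) = q ^ s.choose 2 * q ^ (i + 1).choose 2 := by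
      rw [← pow_add, ← pow_add, choose_two_sub_add h]
    rw [h1, inv_qFact_sub hq0.le hq1 h, h3, (eq_mul_inv_iff_mul_eq₀ h5).2 h6]
    generalize ∏ t ∈ range i, (1 - q ^ (s - t)) = P
    field_simp
  · rw [prod_eq_zero (mem_range.2 (not_le.1 h)) (sub_self _)]
    ring

theorem det_vandermonde_inv_partSeq_sq (hq0 : 0 < q) (hq1 : q < 1) {N : ℕ} {lam : YoungDiagram}
    (hlam : partLength lam ≤ N) :
    (Matrix.vandermonde fun j : Fin N => (q ^ partSeq N lam j)⁻¹).det ^ 2 =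
      ((∏ j : Fin N, (q ^ (partSeq N lam j * j))⁻¹) *
        ((∏ c ∈ lam.cells, (1 - q ^ hookLen lam c)⁻¹) * ∏ j, qFact q (partSeq N lam j))) ^ 2 := by
  have h1 : ∀ i j : Fin N, j ∈ Ioi i → ((q ^ partSeq N lam j)⁻¹ - (q ^ partSeq N lam i)⁻¹) ^ 2 =
      ((q ^ partSeq N lam j)⁻¹ * (1 - q ^ (partSeq N lam j - partSeq N lam i))) ^ 2 := by
    intro i j hij
    have := partSeq_strictMono N lam (mem_Ioi.1 hij)
    have h2 : q ^ partSeq N lam j =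
        q ^ partSeq N lam i * q ^ (partSeq N lam j - partSeq N lam i) := by
      rw [← pow_add]; congr 1; omega
    have h3 := pow_ne_zero (partSeq N lam i) hq0.ne'
    have h4 := pow_ne_zero (partSeq N lam j - partSeq N lam i) hq0.ne'
    congr 1
    rw [h2]; field_simp
  rw [← prod_diff_eq hq0.le hq1 hlam, Matrix.det_vandermonde, ← prod_pow]
  simp_rw [← prod_pow]
  rw [prod_congr rfl fun i _ => prod_congr rfl (h1 i)]
  simp_rw [prod_pow, prod_mul_distrib]
  rw [mul_pow, mul_pow]
  congr 2
  have h5 : ∏ i : Fin N, ∏ j ∈ Ioi i, (q ^ partSeq N lam j)⁻¹ =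
      ∏ j : Fin N, ∏ i ∈ Iio j, (q ^ partSeq N lam j)⁻¹ := Finset.prod_comm' (by simp)
  rw [h5]
  refine prod_congr rfl fun j _ => ?_
  rw [prod_const, Fin.card_Iio, inv_pow, ← pow_mul]

theorem det_shiftSeq_choose_two_sq (hq0 : 0 < q) (hq1 : q < 1) {x : ℝ} (hx : x ≠ 0) {N : ℕ}
    {lam : YoungDiagram} (hlam : partLength lam ≤ N) :
    (Matrix.of fun i j : Fin N =>
      shiftSeq (fun r => q ^ r.choose 2 * (qFact q r)⁻¹ * x ^ r) i (partSeq N lam j)).det ^ 2 =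
      (x ^ lam.transpose.card * hookWeight q lam.transpose) ^ 2 := by
  simp only [shiftSeq_choose_two hq0 hq1 hx]
  rw [det_of_mul_eval_prod
    (fun j => x ^ partSeq N lam j * q ^ (partSeq N lam j).choose 2 * (qFact q (partSeq N lam j))⁻¹)
    (fun i : Fin N => (x ^ (i : ℕ))⁻¹ * q ^ ((i : ℕ) + 1).choose 2)
    (fun j => (q ^ partSeq N lam j)⁻¹) (fun t => (q ^ t)⁻¹)]
  -- For each `j` the three exponents combine to `(s_j - j).choose 2`, the binomial of the part `s_j
  -- - j`; summed over the parts this is `b` of the transpose.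
  have hpow : (∏ j : Fin N, q ^ (partSeq N lam j).choose 2) *
      (∏ j : Fin N, q ^ ((j : ℕ) + 1).choose 2) * (∏ j : Fin N, (q ^ (partSeq N lam j * j))⁻¹) =
      q ^ bStat lam.transpose := by
    rw [bStat_transpose_eq_sum_choose hlam, ← sum_univ_rev_eq_sum_range N fun i =>
      (lam.rowLen i).choose 2, ← prod_pow_eq_pow_sum, ← prod_mul_distrib, ← prod_mul_distrib]
    refine prod_congr rfl fun j _ => ?_
    have h1 := choose_two_sub_add (i := j) (s := partSeq N lam j) (Nat.le_add_left _ _)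
    rw [← pow_add, ← h1, pow_add, mul_inv_cancel_right₀ (pow_ne_zero _ hq0.ne'), partSeq,
      Nat.add_sub_cancel]
  have hhook : hookWeight q lam.transpose =
      q ^ bStat lam.transpose * ∏ c ∈ lam.cells, (1 - q ^ hookLen lam c)⁻¹ := by
    rw [hookWeight, prod_cells_transpose]
    simp only [hookLen_transpose, Prod.swap_swap]
  rw [mul_pow, mul_pow, det_vandermonde_inv_partSeq_sq hq0 hq1 hlam, hhook, ← hpow, card_transpose,
    prod_mul_distrib, prod_mul_distrib, prod_mul_distrib, prod_inv_distrib (f := fun j =>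
    qFact q (partSeq N lam j)), prod_inv_distrib (f := fun i : Fin N => x ^ (i : ℕ)),
    prod_pow_eq_pow_sum _ _ x, prod_pow_eq_pow_sum _ _ x, sum_partSeq hlam, pow_add]
  have h1 : (∏ j, qFact q (partSeq N lam j)) ≠ 0 :=
    (prod_pos fun j _ => qFact_pos hq0.le hq1 _).ne'
  have h2 := pow_ne_zero (∑ i : Fin N, (i : ℕ)) hx
  generalize ∏ j, qFact q (partSeq N lam j) = a at *
  generalize ∏ j : Fin N, q ^ (partSeq N lam j).choose 2 = b
  generalize ∏ j : Fin N, q ^ ((j : ℕ) + 1).choose 2 = c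
  generalize ∏ j : Fin N, (q ^ (partSeq N lam j * j))⁻¹ = d
  generalize ∏ c ∈ lam.cells, (1 - q ^ hookLen lam c)⁻¹ = e
  field_simp

end HookDeterminants

/-! ### The Cauchy identity and the total mass. -/

section TotalMass

open Finset Filter Topology

variable {q : ℝ}

/-- The **Cauchy determinant**. -/
theorem det_inv_one_sub_mul {n : ℕ} (a b : Fin n → ℝ) (hb0 : ∀ j, b j ≠ 0)
    (hb : Function.Injective b) (h : ∀ i j, 1 - a i * b j ≠ 0) :
    (Matrix.of fun i j => (1 - a i * b j)⁻¹).det * ∏ i, ∏ j, (1 - a i * b j) =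
      (Matrix.vandermonde a).det * (Matrix.vandermonde b).det := by
  classical
  set P : Fin n → Polynomial ℝ := fun j =>
    ∏ l ∈ ({j}ᶜ : Finset (Fin n)), (1 - Polynomial.C (b l) * Polynomial.X) with hP
  have hdeg : ∀ j, (P j).natDegree < n := by
    intro j
    have h1 : (P j).natDegree ≤ ∑ l ∈ ({j}ᶜ : Finset (Fin n)), 1 := by
      refine (Polynomial.natDegree_prod_le _ _).trans (sum_le_sum fun l _ => ?_)
      compute_degree
    have h2 := j.pos
    rw [sum_const, smul_eq_mul, mul_one, card_compl, card_singleton, Fintype.card_fin] at h1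
    omega
  set C : Matrix (Fin n) (Fin n) ℝ := Matrix.of fun k j => (P j).coeff k with hC
  have hV : ∀ y : Fin n → ℝ, Matrix.vandermonde y * C = Matrix.of fun i j => (P j).eval (y i) := by
    intro y
    ext i j
    rw [Matrix.mul_apply, Matrix.of_apply, Polynomial.eval_eq_sum_range' (hdeg j), Finset.sum_range]
    refine sum_congr rfl fun k _ => ?_
    rw [hC, Matrix.of_apply, Matrix.vandermonde_apply, mul_comm]
  have heval : ∀ j t, (P j).eval t = ∏ l ∈ ({j}ᶜ : Finset (Fin n)), (1 - b l * t) := by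
    intro j t
    simp [hP, Polynomial.eval_prod]
  -- Evaluating at the points `1 / b i` makes the matrix of values diagonal, since `P j` vanishes at
  -- all of them except `1 / b j`.
  have hdetC : C.det = (Matrix.vandermonde b).det := by
    have h1 := congrArg Matrix.det (hV fun i => (b i)⁻¹)
    have h2 : (Matrix.of fun i j => (P j).eval (b i)⁻¹) =
        Matrix.diagonal fun j => ∏ l ∈ ({j}ᶜ : Finset (Fin n)), (1 - b l * (b j)⁻¹) := by
      ext i j
      rw [Matrix.of_apply, heval, Matrix.diagonal_apply]
      split_ifs with hij
      · rw [hij]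
      · exact prod_eq_zero (i := i) (by simpa using hij) (by rw [mul_inv_cancel₀ (hb0 i), sub_self])
    rw [Matrix.det_mul, h2, Matrix.det_diagonal,
      ← Finset.prod_prod_Ioi_mul_eq_prod_prod_off_diag (fun l j => 1 - b l * (b j)⁻¹)] at h1
    have h3 : (Matrix.vandermonde fun i => (b i)⁻¹).det ≠ 0 := by
      rw [Matrix.det_vandermonde_ne_zero_iff]
      exact fun i j hij => hb (inv_injective hij)
    refine mul_left_cancel₀ h3 (h1.trans ?_)
    rw [Matrix.det_vandermonde, Matrix.det_vandermonde, ← prod_mul_distrib]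
    refine prod_congr rfl fun i _ => ?_
    rw [← prod_mul_distrib]
    refine prod_congr rfl fun j _ => ?_
    have h4 := hb0 i
    have h5 := hb0 j
    field_simp
  rw [← hdetC, ← Matrix.det_mul, hV, mul_comm, ← Matrix.det_mul_column]
  congr 1
  ext i j
  rw [Matrix.of_apply, Matrix.of_apply, Matrix.of_apply, heval,
    Fintype.prod_eq_mul_prod_compl j fun l => 1 - a i * b l, mul_right_comm, mul_inv_cancel₀ (h i j),
    one_mul]
  simp only [mul_comm]

theorem rowLen_bot (i : ℕ) : (⊥ : YoungDiagram).rowLen i = 0 := by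
  by_contra h
  exact YoungDiagram.notMem_bot _ (YoungDiagram.mem_iff_lt_rowLen.2 (Nat.pos_of_ne_zero h))

theorem partLength_bot : partLength ⊥ = 0 := by
  by_contra h
  exact YoungDiagram.notMem_bot _ (YoungDiagram.mem_iff_lt_colLen.2 (Nat.pos_of_ne_zero h))

theorem partSeq_bot (N : ℕ) (j : Fin N) : partSeq N ⊥ j = j := by
  rw [partSeq, rowLen_bot, zero_add]

theorem hookWeight_bot (q : ℝ) : hookWeight q ⊥ = 1 := by
  simp [hookWeight, bStat, partLength_bot]

/-- `∏_j (q;q)_{s_j} / (q;q)_j` for the sequence `s` of a partition. -/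
noncomputable def qFactRatio (q : ℝ) (N : ℕ) (lam : YoungDiagram) : ℝ :=
  ∏ j : Fin N, qFact q (partSeq N lam j) / qFact q j

/-- The Cauchy identity for the principal specialization in `N` variables. -/
theorem hasSum_hookWeight_sq_mul_qFactRatio_sq (hq0 : 0 < q) (hq1 : q < 1) {x : ℝ} (hx0 : 0 < x)
    (hx1 : x < 1) (N : ℕ) :
    HasSum (fun lam : {lam : YoungDiagram // partLength lam ≤ N} =>
      (x ^ lam.1.card * hookWeight q lam.1) ^ 2 * qFactRatio q N lam.1 ^ 2)
      (∏ i : Fin N, ∏ j : Fin N, (1 - x ^ 2 * q ^ ((i : ℕ) + j))⁻¹) := by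
  have hxq : ∀ i j : ℕ, ‖(x * q ^ i) * (x * q ^ j)‖ < 1 := by
    intro i j
    have h1 : q ^ i ≤ 1 := pow_le_one₀ hq0.le hq1.le
    have h2 : q ^ j ≤ 1 := pow_le_one₀ hq0.le hq1.le
    have h3 : 0 < q ^ i := pow_pos hq0 i
    have h4 : 0 < q ^ j := pow_pos hq0 j
    rw [Real.norm_eq_abs, abs_of_pos (by positivity)]
    have h5 : x * q ^ i < 1 := (mul_le_of_le_one_right hx0.le h1).trans_lt hx1
    have h6 : x * q ^ j < 1 := (mul_le_of_le_one_right hx0.le h2).trans_lt hx1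
    exact mul_lt_one_of_nonneg_of_lt_one_left (by positivity) h5 h6.le
  have hgeo : ∀ i j : Fin N, HasSum (fun s => (x * q ^ (i : ℕ)) ^ s * (x * q ^ (j : ℕ)) ^ s)
      (1 - (x * q ^ (i : ℕ)) * (x * q ^ (j : ℕ)))⁻¹ := by
    intro i j
    simp only [← mul_pow]
    exact hasSum_geometric_of_norm_lt_one (hxq i j)
  have hne : ∀ i j : Fin N, 1 - (x * q ^ (i : ℕ)) * (x * q ^ (j : ℕ)) ≠ 0 := by
    intro i j h0
    have := hxq i j
    rw [← sub_eq_zero.1 h0] at this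
    simp at this
  have hmain := hasSum_det_sq_partSeq (fun (i : Fin N) s => (x * q ^ (i : ℕ)) ^ s)
    fun i j => (hgeo i j).summable
  simp only [(hgeo _ _).tsum_eq] at hmain
  have hinj : Function.Injective fun i : Fin N => x * q ^ (i : ℕ) := by
    intro i j hij
    have h1 : q ^ (i : ℕ) = q ^ (j : ℕ) := mul_left_cancel₀ hx0.ne' hij
    exact Fin.ext ((pow_right_injective₀ hq0 hq1.ne) h1)
  have hcauchy := det_inv_one_sub_mul (fun i : Fin N => x * q ^ (i : ℕ))
    (fun i : Fin N => x * q ^ (i : ℕ)) (fun i => (mul_pos hx0 (pow_pos hq0 _)).ne') hinj hne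
  set X : ℝ := x ^ (∑ i : Fin N, (i : ℕ)) with hX
  set Q : ℝ := q ^ (∑ i ∈ range N, i.choose 2) with hQ
  set K : ℝ := ∏ j : Fin N, qFact q j with hK
  have hX0 : X ≠ 0 := pow_ne_zero _ hx0.ne'
  have hQ0 : Q ≠ 0 := pow_ne_zero _ hq0.ne'
  have hK0 : K ≠ 0 := (prod_pos fun j _ => qFact_pos hq0.le hq1 _).ne'
  -- This is the minor of the empty partition, with sequence `s_j = j`; dividing by it turns
  -- alternants into Schur values.
  have hvdm : (Matrix.vandermonde fun i : Fin N => x * q ^ (i : ℕ)).det ^ 2 = (X * (Q * K)) ^ 2 := by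
    have h1 : (Matrix.vandermonde fun i : Fin N => x * q ^ (i : ℕ)) =
        Matrix.of fun i j : Fin N => x ^ (j : ℕ) *
          Matrix.vandermonde (fun i : Fin N => q ^ partSeq N ⊥ i) i j := by
      ext i j
      simp only [Matrix.vandermonde_apply, Matrix.of_apply, partSeq_bot, mul_pow]
    rw [h1, Matrix.det_mul_row, mul_pow, det_vandermonde_partSeq_sq hq0.le hq1
      (by rw [partLength_bot]; exact Nat.zero_le _), prod_pow_eq_pow_sum, hookWeight_bot]
    simp only [partSeq_bot]
    ring
  have hdet : ∀ lam : {lam : YoungDiagram // partLength lam ≤ N},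
      (Matrix.of fun i j : Fin N => (x * q ^ (i : ℕ)) ^ partSeq N lam.1 j).det ^ 2 =
      (X * (Q * K)) ^ 2 *
        ((x ^ lam.1.card * hookWeight q lam.1) ^ 2 * qFactRatio q N lam.1 ^ 2) := by
    rintro ⟨lam, hlam⟩
    have h1 : (Matrix.of fun i j : Fin N => (x * q ^ (i : ℕ)) ^ partSeq N lam j) =
        Matrix.of fun i j : Fin N => x ^ partSeq N lam j *
          (Matrix.vandermonde (fun i : Fin N => q ^ partSeq N lam i)).transpose i j := by
      ext i j
      simp only [Matrix.vandermonde_apply, Matrix.of_apply, Matrix.transpose_apply, mul_pow,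
        ← pow_mul, mul_comm]
    rw [h1, Matrix.det_mul_row, mul_pow, Matrix.det_transpose,
      det_vandermonde_partSeq_sq hq0.le hq1 hlam, prod_pow_eq_pow_sum, sum_partSeq hlam, pow_add,
      qFactRatio, prod_div_distrib, ← hX, ← hQ, ← hK]
    field_simp
  simp only [hdet] at hmain
  have hscale : (X * (Q * K)) ^ 2 ≠ 0 := by positivity
  have hfin := hmain.mul_left ((X * (Q * K)) ^ 2)⁻¹
  simp only [inv_mul_cancel_left₀ hscale] at hfin
  rw [← sq, hvdm] at hcauchy
  suffices h : ((X * (Q * K)) ^ 2)⁻¹ *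
      (Matrix.of fun i j : Fin N => (1 - x * q ^ (i : ℕ) * (x * q ^ (j : ℕ)))⁻¹).det =
      ∏ i : Fin N, ∏ j : Fin N, (1 - x ^ 2 * q ^ ((i : ℕ) + j))⁻¹ by
    rwa [h] at hfin
  rw [inv_mul_eq_iff_eq_mul₀ hscale, ← hcauchy, mul_assoc]
  have h2 : (∏ i : Fin N, ∏ j : Fin N, (1 - x * q ^ (i : ℕ) * (x * q ^ (j : ℕ)))) *
      ∏ i : Fin N, ∏ j : Fin N, (1 - x ^ 2 * q ^ ((i : ℕ) + j))⁻¹ = 1 := by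
    rw [← prod_mul_distrib]
    refine prod_eq_one fun i _ => ?_
    rw [← prod_mul_distrib]
    refine prod_eq_one fun j _ => ?_
    have := hne i j
    rw [show 1 - x ^ 2 * q ^ ((i : ℕ) + j) = 1 - x * q ^ (i : ℕ) * (x * q ^ (j : ℕ)) by ring]
    exact mul_inv_cancel₀ this
  rw [h2, mul_one]

theorem qFact_antitone (hq0 : 0 ≤ q) (hq1 : q < 1) : Antitone (qFact q) := by
  refine antitone_nat_of_succ_le fun n => ?_
  rw [qFact_succ]
  exact mul_le_of_le_one_right (qFact_pos hq0 hq1 n).le (by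
    have := pow_nonneg hq0 (n + 1); linarith)

theorem qFactRatio_nonneg (hq0 : 0 ≤ q) (hq1 : q < 1) (N : ℕ) (lam : YoungDiagram) :
    0 ≤ qFactRatio q N lam :=
  prod_nonneg fun _ _ => div_nonneg (qFact_pos hq0 hq1 _).le (qFact_pos hq0 hq1 _).le

theorem qFactRatio_le_one (hq0 : 0 ≤ q) (hq1 : q < 1) (N : ℕ) (lam : YoungDiagram) :
    qFactRatio q N lam ≤ 1 := by
  refine prod_le_one (fun _ _ => div_nonneg (qFact_pos hq0 hq1 _).le (qFact_pos hq0 hq1 _).le)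
    fun j _ => ?_
  rw [div_le_one (qFact_pos hq0 hq1 _)]
  exact qFact_antitone hq0 hq1 (Nat.le_add_left _ _)

theorem tendsto_qFact_div (hq0 : 0 ≤ q) (hq1 : q < 1) (k : ℕ) :
    Tendsto (fun n => qFact q (k + n) / qFact q n) atTop (𝓝 1) := by
  induction k with
  | zero =>
    refine tendsto_const_nhds.congr fun n => ?_
    rw [zero_add, div_self (qFact_pos hq0 hq1 n).ne']
  | succ k ih =>
    have h1 : Tendsto (fun n : ℕ => 1 - q ^ (n + (k + 1))) atTop (𝓝 (1 - 0)) :=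
      tendsto_const_nhds.sub ((tendsto_add_atTop_iff_nat (k + 1)).2
        (tendsto_pow_atTop_nhds_zero_of_lt_one hq0 hq1))
    have h2 := ih.mul h1
    rw [sub_zero, mul_one] at h2
    refine h2.congr fun n => ?_
    rw [show k + 1 + n = k + n + 1 by ring, qFact_succ, show n + (k + 1) = k + n + 1 by ring]
    ring

/-- Zero parts contribute factors `1`, so once `N ≥ ℓ(λ)` the number of relevant factors is fixed,
and each compares `(q;q)` at two indices with constant distance tending to infinity. -/
theorem tendsto_qFactRatio (hq0 : 0 ≤ q) (hq1 : q < 1) (lam : YoungDiagram) :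
    Tendsto (fun N => qFactRatio q N lam) atTop (𝓝 1) := by
  set l := partLength lam with hl
  have h1 : Tendsto (fun N => ∏ i ∈ range l,
      qFact q (lam.rowLen i + (N - 1 - i)) / qFact q (N - 1 - i)) atTop (𝓝 (∏ i ∈ range l, 1)) := by
    refine tendsto_finsetProd _ fun i _ => (tendsto_qFact_div hq0 hq1 (lam.rowLen i)).comp ?_
    have : Tendsto (fun N : ℕ => N - (1 + i)) atTop atTop := tendsto_sub_atTop_nat _
    simpa only [Nat.sub_sub] using this
  rw [prod_const_one] at h1
  refine h1.congr' ?_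
  filter_upwards [eventually_ge_atTop l] with N hN
  have h2 : ∀ j : Fin N, qFact q (partSeq N lam j) / qFact q j =
      qFact q (lam.rowLen (N - 1 - j) + (N - 1 - (N - 1 - j))) / qFact q (N - 1 - (N - 1 - j)) := by
    intro j
    have hj := j.2
    rw [show N - 1 - (N - 1 - (j : ℕ)) = j by omega]
    rfl
  rw [qFactRatio, prod_congr rfl fun j _ => h2 j, prod_univ_rev_eq_prod_range N fun i =>
    qFact q (lam.rowLen i + (N - 1 - i)) / qFact q (N - 1 - i)]
  refine prod_subset (range_subset_range.2 hN) fun i _ hi => ?_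
  rw [rowLen_eq_zero_of_partLength_le (by simpa using hi), zero_add,
    div_self (qFact_pos hq0 hq1 _).ne']

/-- The double product converges absolutely, so square boxes and antidiagonals give the same value;
the antidiagonal `i + j = n` has `n + 1` equal factors, whence the exponent in `macMahon`. -/
theorem tendsto_prod_macMahon {ξ : ℝ} (hξ₀ : 0 ≤ ξ) (hξ₁ : ξ < 1) (hq0 : 0 ≤ q) (hq1 : q < 1) :
    Tendsto (fun N => ∏ i : Fin N, ∏ j : Fin N, (1 - ξ ^ 2 * q * q ^ ((i : ℕ) + j))⁻¹) atTop
      (𝓝 (macMahon ξ q)) := by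
  set y := ξ ^ 2 * q with hy
  have hy0 : 0 ≤ y := by positivity
  have hy1 : y < 1 := mul_lt_one_of_nonneg_of_lt_one_right (pow_le_one₀ hξ₀ hξ₁.le) hq0 hq1
  have hmul : Multipliable fun p : ℕ × ℕ => (1 - y * q ^ (p.1 + p.2))⁻¹ := by
    have h1 : Summable fun p : ℕ × ℕ => (1 - y)⁻¹ * (q ^ p.1 * q ^ p.2) :=
      ((summable_geometric_of_lt_one hq0 hq1).mul_of_nonneg (summable_geometric_of_lt_one hq0 hq1)
        (fun n => pow_nonneg hq0 n) (fun n => pow_nonneg hq0 n)).mul_left _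
    have h2 : Summable fun p : ℕ × ℕ => ‖(1 - y * q ^ (p.1 + p.2))⁻¹ - 1‖ := by
      refine h1.of_nonneg_of_le (fun _ => norm_nonneg _) fun p => ?_
      have h3 : q ^ (p.1 + p.2) ≤ 1 := pow_le_one₀ hq0 hq1.le
      have h4 : 0 ≤ q ^ (p.1 + p.2) := pow_nonneg hq0 _
      have h5 : y * q ^ (p.1 + p.2) ≤ y := mul_le_of_le_one_right hy0 h3
      have h6 : 0 < 1 - y * q ^ (p.1 + p.2) := by linarith
      have h7 : (1 - y * q ^ (p.1 + p.2))⁻¹ - 1 =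
          (1 - y * q ^ (p.1 + p.2))⁻¹ * (y * q ^ (p.1 + p.2)) := by
        field_simp; ring
      rw [h7, Real.norm_eq_abs, abs_of_nonneg (by positivity), ← pow_add]
      refine mul_le_mul (inv_anti₀ (by linarith) (by linarith)) ?_ (by positivity)
        (inv_nonneg.2 (by linarith))
      exact mul_le_of_le_one_left h4 hy1.le
    simpa using multipliable_one_add_of_summable h2
  have hprod := hmul.hasProd
  have hM : ∏' p : ℕ × ℕ, (1 - y * q ^ (p.1 + p.2))⁻¹ = macMahon ξ q := by
    have h1 := (Finset.HasAntidiagonal.sigmaAntidiagonalEquivProd (A := ℕ)).hasProd_iff.2 hprod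
    have h2 := h1.sigma (g := fun n => 1 / (1 - ξ ^ 2 * q ^ (n + 1)) ^ (n + 1)) fun n => by
      have h3 := hasProd_fintype (fun c : antidiagonal n =>
        ((fun p : ℕ × ℕ => (1 - y * q ^ (p.1 + p.2))⁻¹) ∘ Finset.HasAntidiagonal.sigmaAntidiagonalEquivProd)
          ⟨n, c⟩)
      convert h3 using 1
      have h4 : ∀ c : antidiagonal n,
        ((fun p : ℕ × ℕ => (1 - y * q ^ (p.1 + p.2))⁻¹) ∘ Finset.HasAntidiagonal.sigmaAntidiagonalEquivProd)
          ⟨n, c⟩ = (1 - ξ ^ 2 * q ^ (n + 1))⁻¹ := by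
        rintro ⟨c, hc⟩
        simp only [Function.comp, Finset.HasAntidiagonal.sigmaAntidiagonalEquivProd_apply]
        rw [mem_antidiagonal.1 hc, hy, pow_succ]
        ring
      rw [prod_congr rfl fun c _ => h4 c, prod_const, card_univ, Fintype.card_coe,
        Nat.card_antidiagonal, inv_pow, one_div]
    rw [macMahon, h2.tprod_eq]
  rw [hM] at hprod
  have hbox : Tendsto (fun N : ℕ => range N ×ˢ range N) atTop atTop := by
    refine tendsto_atTop_finset_of_monotone (fun a b hab => ?_) fun p => ?_
    · exact product_subset_product (range_subset_range.2 hab) (range_subset_range.2 hab)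
    · exact ⟨p.1 + p.2 + 1, by rw [mem_product, mem_range, mem_range]; omega⟩
  refine (Tendsto.comp hprod hbox).congr fun N => ?_
  simp only [Function.comp]
  rw [prod_product, Finset.prod_range]
  exact prod_congr rfl fun i _ => by rw [Finset.prod_range]

/-- The total mass of the unnormalized squared type q-Plancherel measure. -/
theorem hasSum_hookWeight_sq {ξ : ℝ} (hξ₀ : 0 < ξ) (hξ₁ : ξ < 1) (hq0 : 0 < q) (hq1 : q < 1) :
    HasSum (fun lam : YoungDiagram => ((ξ * √q) ^ lam.card * hookWeight q lam) ^ 2)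
      (macMahon ξ q) := by
  set x := ξ * √q with hx
  have hsq : x ^ 2 = ξ ^ 2 * q := by rw [hx, mul_pow, Real.sq_sqrt hq0.le]
  have hs1 : √q < 1 := by rw [Real.sqrt_lt' one_pos]; simpa using hq1
  have hx0 : 0 < x := mul_pos hξ₀ (Real.sqrt_pos.2 hq0)
  have hx1 : x < 1 := mul_lt_one_of_nonneg_of_lt_one_left hξ₀.le hξ₁ hs1.le
  have hlim := tendsto_prod_macMahon hξ₀.le hξ₁ hq0.le hq1
  rw [← hsq] at hlim
  set w : YoungDiagram → ℝ := fun lam => (x ^ lam.card * hookWeight q lam) ^ 2 with hw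
  have hw0 : ∀ lam, 0 ≤ w lam := fun lam => sq_nonneg _
  have hcau := hasSum_hookWeight_sq_mul_qFactRatio_sq hq0 hq1 hx0 hx1
  -- For a finite set of partitions, let `N` tend to infinity in the Cauchy identity; the ratio
  -- factors tend to `1`.
  have hle : ∀ u : Finset YoungDiagram, ∑ lam ∈ u, w lam ≤ macMahon ξ q := by
    intro u
    have h1 : Tendsto (fun N => ∑ lam ∈ u, w lam * qFactRatio q N lam ^ 2) atTop
        (𝓝 (∑ lam ∈ u, w lam * 1 ^ 2)) :=
      tendsto_finsetSum _ fun lam _ => ((tendsto_qFactRatio hq0.le hq1 lam).pow 2).const_mul _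
    simp only [one_pow, mul_one] at h1
    refine le_of_tendsto_of_tendsto h1 hlim ?_
    filter_upwards [eventually_ge_atTop (u.sup partLength)] with N hN
    have h2 := sum_le_hasSum (u.subtype fun lam => partLength lam ≤ N)
      (fun _ _ => mul_nonneg (sq_nonneg _) (sq_nonneg _)) (hcau N)
    rw [sum_subtype_of_mem (fun lam => w lam * qFactRatio q N lam ^ 2)
      fun lam hlam => (le_sup (f := partLength) hlam).trans hN] at h2
    exact h2
  have hsum : Summable w := summable_of_sum_le hw0 hle
  -- Conversely, every finite-`N` identity is bounded by the full sum because the ratios are at most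
  -- `1`.
  have hge : macMahon ξ q ≤ ∑' lam, w lam := by
    refine le_of_tendsto' hlim fun N => ?_
    have hinj := Subtype.val_injective (p := fun lam : YoungDiagram => partLength lam ≤ N)
    rw [← (hcau N).tsum_eq]
    refine ((hcau N).summable.tsum_le_tsum (fun lam => ?_) (hsum.comp_injective hinj)).trans
      (tsum_comp_le_tsum_of_inj hsum hw0 hinj)
    exact mul_le_of_le_one_right (hw0 _) (pow_le_one₀ (qFactRatio_nonneg hq0.le hq1 _ _)
      (qFactRatio_le_one hq0.le hq1 _ _))
  rw [← le_antisymm (hsum.tsum_le_of_sum_le hle) hge]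
  exact hsum.hasSum

end TotalMass

/-! ### From partition sums to probabilities and limits. -/

section Measure

open MeasureTheory Filter Topology

variable {ξ q : ℝ}

theorem qPlancherel_apply (S : Set YoungDiagram) :
    qPlancherel ξ q S =
      ∑' lam, ENNReal.ofReal (S.indicator (qPlancherelMass ξ q) lam) := by
  rw [qPlancherel, Measure.sum_apply _ MeasurableSpace.measurableSet_top]
  refine tsum_congr fun lam => ?_
  rw [Measure.smul_apply, Measure.dirac_apply' _ MeasurableSpace.measurableSet_top, smul_eq_mul]
  by_cases h : lam ∈ S <;> simp [h]

theorem qPlancherel_real_eq_tsum (h0 : ∀ lam, 0 ≤ qPlancherelMass ξ q lam)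
    (hs : Summable (qPlancherelMass ξ q)) (S : Set YoungDiagram) :
    (qPlancherel ξ q).real S = ∑' lam : S, qPlancherelMass ξ q lam := by
  have h1 : ∀ lam, 0 ≤ S.indicator (qPlancherelMass ξ q) lam :=
    fun lam => Set.indicator_nonneg (fun _ _ => h0 _) lam
  rw [Measure.real, qPlancherel_apply, ← ENNReal.ofReal_tsum_of_nonneg h1 (hs.indicator S),
    ENNReal.toReal_ofReal (tsum_nonneg h1), tsum_subtype]

theorem isProbabilityMeasure_qPlancherel (h0 : ∀ lam, 0 ≤ qPlancherelMass ξ q lam)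
    (hs : HasSum (qPlancherelMass ξ q) 1) : IsProbabilityMeasure (qPlancherel ξ q) := by
  refine ⟨?_⟩
  rw [qPlancherel_apply, Set.indicator_univ, ← ENNReal.ofReal_tsum_of_nonneg h0 hs.summable,
    hs.tsum_eq, ENNReal.ofReal_one]

/-- Dominated convergence: each element belongs to all sufficiently late index sets. Used with `l`
the length and with `l` the largest part. -/
theorem tendsto_tsum_subtype_le {α : Type*} {w : α → ℝ} (hw0 : ∀ a, 0 ≤ w a) (hw : Summable w)
    (l : α → ℕ) :
    Tendsto (fun N => ∑' a : {a // l a ≤ N}, w a) atTop (𝓝 (∑' a, w a)) := by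
  have h1 : ∀ N, ∑' a : {a // l a ≤ N}, w a = ∑' a, {a | l a ≤ N}.indicator w a :=
    fun N => tsum_subtype {a | l a ≤ N} w
  simp only [h1]
  refine tendsto_tsum_of_dominated_convergence hw (fun a => ?_) (Eventually.of_forall fun N a => ?_)
  · refine tendsto_const_nhds.congr' ?_
    filter_upwards [eventually_ge_atTop (l a)] with N hN
    rw [Set.indicator_of_mem (by exact hN)]
  · rw [Real.norm_eq_abs, abs_of_nonneg (Set.indicator_nonneg (fun _ _ => hw0 _) a)]
    exact Set.indicator_le_self' (fun _ _ => hw0 _) a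

/-- The probabilistic statements follow from the expansions of the matrix integrals over
partitions. -/
theorem gap_probabilities_of_expansion {w : YoungDiagram → ℝ} (hw0 : ∀ lam, 0 ≤ w lam)
    (hM : 0 < macMahon ξ q) (hmass : ∀ lam, qPlancherelMass ξ q lam = (macMahon ξ q)⁻¹ * w lam)
    (hw : HasSum w (macMahon ξ q))
    (hZ : ∀ N, Zint ξ q N = ((∑' lam : {lam // partLength lam ≤ N}, w lam : ℝ) : ℂ))
    (hZc : ∀ N, ZintCheck ξ q N = ((∑' lam : {lam // largestPart lam ≤ N}, w lam : ℝ) : ℂ)) :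
    IsProbabilityMeasure (qPlancherel ξ q) ∧
    (∀ N : ℕ, (((qPlancherel ξ q).real {lam | partLength lam ≤ N} : ℝ) : ℂ) =
      Zint ξ q N / (macMahon ξ q : ℂ)) ∧
    (∀ N : ℕ, (((qPlancherel ξ q).real {lam | largestPart lam ≤ N} : ℝ) : ℂ) =
      ZintCheck ξ q N / (macMahon ξ q : ℂ)) ∧
    Tendsto (fun N : ℕ => Zint ξ q N) atTop (𝓝 (macMahon ξ q : ℂ)) ∧
    Tendsto (fun N : ℕ => ZintCheck ξ q N) atTop (𝓝 (macMahon ξ q : ℂ)) := by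
  have hmass0 : ∀ lam, 0 ≤ qPlancherelMass ξ q lam := fun lam => by
    rw [hmass]; exact mul_nonneg (inv_nonneg.2 hM.le) (hw0 lam)
  have hsum : HasSum (qPlancherelMass ξ q) 1 := by
    have := hw.mul_left (macMahon ξ q)⁻¹
    rw [inv_mul_cancel₀ hM.ne'] at this
    exact this.congr_fun hmass
  have hreal : ∀ S : Set YoungDiagram, (qPlancherel ξ q).real S =
      (∑' lam : S, w lam) / macMahon ξ q := by
    intro S
    rw [qPlancherel_real_eq_tsum hmass0 hsum.summable, tsum_congr fun lam : S => hmass lam,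
      tsum_mul_left, div_eq_inv_mul]
  have hlim : ∀ l : YoungDiagram → ℕ,
      Tendsto (fun N => ((∑' lam : {lam // l lam ≤ N}, w lam : ℝ) : ℂ)) atTop
        (𝓝 (macMahon ξ q : ℂ)) := by
    intro l
    have := tendsto_tsum_subtype_le hw0 hw.summable l
    rw [hw.tsum_eq] at this
    exact (Complex.continuous_ofReal.tendsto _).comp this
  refine ⟨isProbabilityMeasure_qPlancherel hmass0 hsum, fun N => ?_, fun N => ?_, ?_, ?_⟩
  · rw [hreal, hZ, Complex.ofReal_div]; rfl
  · rw [hreal, hZc, Complex.ofReal_div]; rfl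
  · simpa only [hZ] using hlim partLength
  · simpa only [hZc] using hlim largestPart

end Measure

/-! ### The two integrals as sums over partitions, and the degenerate parameters. -/

section Expansion

open MeasureTheory Filter Topology

variable {ξ q : ℝ}

/-- On the circle conjugation is inversion and the coefficients are real, so the factor of the
weight in `z⁻¹` is the conjugate of the factor in `z`, as Heine's identity requires. -/
theorem star_eq_of_hasSum {h : ℕ → ℝ} {z a b : ℂ} (hz : ‖z‖ = 1)
    (ha : HasSum (fun r => (h r : ℂ) * z ^ r) a) (hb : HasSum (fun r => (h r : ℂ) * z⁻¹ ^ r) b) :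
    star a = b := by
  refine HasSum.unique ?_ hb
  have h1 := ha.star
  have h2 : star z = z⁻¹ := by
    rw [Complex.inv_def, Complex.normSq_eq_norm_sq, hz]; simp
  simpa only [star_mul', star_pow, h2, Complex.star_def, Complex.conj_ofReal] using h1

/-- A matrix integral as a sum over partitions of bounded length. -/
theorem integral_det_matrixFun_eq_tsum {N : ℕ} {h : ℕ → ℝ} (hh : Summable fun r => |h r|)
    (h0 : h 0 ≠ 0) {f F : ℂ → ℂ}
    (hF : ∀ z, ‖z‖ = 1 → HasSum (fun r => (h r : ℂ) * z ^ r) (F z))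
    (hf : ∀ z, ‖z‖ = 1 → f z = F z * star (F z)) :
    ∫ U : Matrix.unitaryGroup (Fin N) ℂ,
      (matrixFun f (U : Matrix (Fin N) (Fin N) ℂ)).det ∂(haarU N) =
      ((∑' lam : {lam : YoungDiagram // partLength lam ≤ N},
        (Matrix.of fun i j : Fin N => shiftSeq h i (partSeq N lam.1 j)).det ^ 2 : ℝ) : ℂ) := by
  have hcb := hasSum_det_sq_partSeq (fun (i : Fin N) s => shiftSeq h i s)
    fun i j => summable_shiftSeq_mul hh i j
  rw [hcb.tsum_eq]
  exact integral_det_matrixFun hh h0 hF hf (hcb.nonneg fun _ => sq_nonneg _)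

theorem norm_mul_lt_one_of_norm_eq_one (hξ₀ : 0 ≤ ξ) (hξ₁ : ξ < 1) (hq1 : q < 1) {z : ℂ}
    (hz : ‖z‖ = 1) : ‖(ξ : ℂ) * √q * z‖ < 1 := by
  have hs1 : √q < 1 := by rw [Real.sqrt_lt' one_pos]; simpa using hq1
  rw [norm_mul, hz, mul_one, ← Complex.ofReal_mul, Complex.norm_real, Real.norm_eq_abs,
    abs_of_nonneg (mul_nonneg hξ₀ (Real.sqrt_nonneg q))]
  exact mul_lt_one_of_nonneg_of_lt_one_left hξ₀ hξ₁ hs1.le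

theorem Zint_eq_tsum (hξ₀ : 0 < ξ) (hξ₁ : ξ < 1) (hq0 : 0 < q) (hq1 : q < 1) (N : ℕ) :
    Zint ξ q N = ((∑' lam : {lam : YoungDiagram // partLength lam ≤ N},
      ((ξ * √q) ^ lam.1.card * hookWeight q lam.1) ^ 2 : ℝ) : ℂ) := by
  have hx : ξ * √q ≠ 0 := (mul_pos hξ₀ (Real.sqrt_pos.2 hq0)).ne'
  set h : ℕ → ℝ := fun r => (qFact q r)⁻¹ * (ξ * √q) ^ r with hh
  have hcoe : ∀ (r : ℕ) (z : ℂ), (h r : ℂ) * z ^ r = (qFact q r : ℂ)⁻¹ * (ξ * √q * z) ^ r := by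
    intro r z
    rw [hh]; push_cast; ring
  have hF : ∀ z : ℂ, ‖z‖ = 1 →
      HasSum (fun r => (h r : ℂ) * z ^ r) (qPochInf (ξ * √q * z) q)⁻¹ := by
    intro z hz
    simp only [hcoe]
    exact hasSum_inv_qPochInf hq0.le hq1 (norm_mul_lt_one_of_norm_eq_one hξ₀.le hξ₁ hq1 hz)
  have hsum : Summable fun r => |h r| := by
    have := (hF 1 norm_one).summable.norm
    simpa only [one_pow, mul_one, Complex.norm_real, Real.norm_eq_abs] using this
  rw [Zint, integral_det_matrixFun_eq_tsum hsum (by simp [hh, qFact_zero]) hF fun z hz => ?_,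
    tsum_congr fun lam => det_shiftSeq_inv_qFact_sq hq0 hq1 hx lam.2]
  rw [star_eq_of_hasSum hz (hF z hz) (hF z⁻¹ (by rw [norm_inv, hz, inv_one])), weight, mul_inv]

theorem ZintCheck_eq_tsum (hξ₀ : 0 < ξ) (hξ₁ : ξ < 1) (hq0 : 0 < q) (hq1 : q < 1) (N : ℕ) :
    ZintCheck ξ q N = ((∑' lam : {lam : YoungDiagram // largestPart lam ≤ N},
      ((ξ * √q) ^ lam.1.card * hookWeight q lam.1) ^ 2 : ℝ) : ℂ) := by
  have hx : ξ * √q ≠ 0 := (mul_pos hξ₀ (Real.sqrt_pos.2 hq0)).ne'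
  set h : ℕ → ℝ := fun r => q ^ r.choose 2 * (qFact q r)⁻¹ * (ξ * √q) ^ r with hh
  have hcoe : ∀ (r : ℕ) (z : ℂ), (h r : ℂ) * z ^ r =
      ((q : ℂ) ^ r.choose 2 * (qFact q r : ℂ)⁻¹) * (ξ * √q * z) ^ r := by
    intro r z
    rw [hh]; push_cast; ring
  have hF : ∀ z : ℂ, ‖z‖ = 1 →
      HasSum (fun r => (h r : ℂ) * z ^ r) (qPochInf (-(ξ * √q * z)) q) := by
    intro z hz
    simp only [hcoe]
    exact hasSum_qPochInf_neg hq0.le hq1 (norm_mul_lt_one_of_norm_eq_one hξ₀.le hξ₁ hq1 hz)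
  have hsum : Summable fun r => |h r| := by
    have := (hF 1 norm_one).summable.norm
    simpa only [one_pow, mul_one, Complex.norm_real, Real.norm_eq_abs] using this
  -- The expansion over minors produces transposed hook weights with bounded length; transposition
  -- converts this into a bound on the largest part.
  have htr : ∑' lam : {lam : YoungDiagram // largestPart lam ≤ N},
      ((ξ * √q) ^ lam.1.card * hookWeight q lam.1) ^ 2 =
      ∑' lam : {lam : YoungDiagram // partLength lam ≤ N},
        ((ξ * √q) ^ lam.1.transpose.card * hookWeight q lam.1.transpose) ^ 2 := by
    refine (Equiv.tsum_eq (YoungDiagram.transposeOrderIso.toEquiv.subtypeEquiv fun lam => ?_)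
      fun lam : {lam : YoungDiagram // largestPart lam ≤ N} =>
        ((ξ * √q) ^ lam.1.card * hookWeight q lam.1) ^ 2).symm
    change lam.colLen 0 ≤ N ↔ lam.transpose.rowLen 0 ≤ N
    rw [YoungDiagram.rowLen_transpose]
  rw [ZintCheck, integral_det_matrixFun_eq_tsum hsum (by simp [hh, qFact_zero]) hF fun z hz => ?_,
    tsum_congr fun lam => det_shiftSeq_choose_two_sq hq0 hq1 hx lam.2, htr]
  rw [star_eq_of_hasSum hz (hF z hz) (hF z⁻¹ (by rw [norm_inv, hz, inv_one])), weightCheck]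

theorem qPlancherelMass_eq (hq0 : 0 ≤ q) (lam : YoungDiagram) :
    qPlancherelMass ξ q lam =
      (macMahon ξ q)⁻¹ * ((ξ * √q) ^ lam.card * hookWeight q lam) ^ 2 := by
  have h1 : ξ ^ 2 * q = (ξ * √q) ^ 2 := by rw [mul_pow, Real.sq_sqrt hq0]
  rw [qPlancherelMass, hookWeight, h1]
  simp only [one_div, Finset.prod_inv_distrib, Finset.prod_pow]
  ring

theorem qPochInf_zero (q : ℝ) : qPochInf 0 q = 1 := by simp [qPochInf]

open scoped Matrix.Norms.L2Operator in
theorem integral_det_matrixFun_one (N : ℕ) :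
    ∫ U : Matrix.unitaryGroup (Fin N) ℂ,
      (matrixFun (fun _ => 1) (U : Matrix (Fin N) (Fin N) ℂ)).det ∂(haarU N) = 1 := by
  have h1 : ∀ U : Matrix.unitaryGroup (Fin N) ℂ,
      (matrixFun (fun _ => 1) (U : Matrix (Fin N) (Fin N) ℂ)).det = 1 := by
    intro U
    have hU : IsStarNormal (U : Matrix (Fin N) (Fin N) ℂ) :=
      ⟨(Unitary.coe_star_mul_self U).trans (Unitary.coe_mul_star_self U).symm⟩
    rw [matrixFun, cfc_const_one ℂ _ hU, Matrix.det_one]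
  simp [h1]

theorem gap_probabilities (hξ₀ : 0 ≤ ξ) (hξ₁ : ξ < 1) (hq₀ : 0 ≤ q) (hq₁ : q < 1) :
    IsProbabilityMeasure (qPlancherel ξ q) ∧
    (∀ N : ℕ, (((qPlancherel ξ q).real {lam | partLength lam ≤ N} : ℝ) : ℂ) =
      Zint ξ q N / (macMahon ξ q : ℂ)) ∧
    (∀ N : ℕ, (((qPlancherel ξ q).real {lam | largestPart lam ≤ N} : ℝ) : ℂ) =
      ZintCheck ξ q N / (macMahon ξ q : ℂ)) ∧
    Tendsto (fun N : ℕ => Zint ξ q N) atTop (𝓝 (macMahon ξ q : ℂ)) ∧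
    Tendsto (fun N : ℕ => ZintCheck ξ q N) atTop (𝓝 (macMahon ξ q : ℂ)) := by
  classical
  by_cases hx : 0 < ξ ∧ 0 < q
  · obtain ⟨hξ, hq⟩ := hx
    have hsum := hasSum_hookWeight_sq hξ hξ₁ hq hq₁
    refine gap_probabilities_of_expansion (fun lam => sq_nonneg _) ?_ (qPlancherelMass_eq hq₀) hsum
      (Zint_eq_tsum hξ hξ₁ hq hq₁) (ZintCheck_eq_tsum hξ hξ₁ hq hq₁)
    have := le_hasSum hsum ⊥ fun _ _ => sq_nonneg _
    rw [hookWeight_bot, show (⊥ : YoungDiagram).card = 0 from rfl, pow_zero, one_mul,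
      one_pow] at this
    exact one_pos.trans_le this
  -- The determinant formulas divide by `q` and by `ξ √q`, so vanishing parameters are separate:
  -- both weights are identically `1` and the measure is the point mass at the empty partition.
  · have hor : ξ = 0 ∨ q = 0 := by
      by_contra hne
      rw [not_or] at hne
      exact hx ⟨lt_of_le_of_ne hξ₀ (Ne.symm hne.1), lt_of_le_of_ne hq₀ (Ne.symm hne.2)⟩
    have hx0 : (ξ : ℂ) * √q = 0 := by rcases hor with rfl | rfl <;> simp
    have hM : macMahon ξ q = 1 := by rcases hor with rfl | rfl <;> simp [macMahon]
    have hone : ∀ l : YoungDiagram → ℕ, l ⊥ = 0 → ∀ N,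
        ∑' lam : {lam // l lam ≤ N}, (if lam.1 = ⊥ then (1 : ℝ) else 0) = 1 := by
      intro l hl N
      rw [tsum_eq_single ⟨⊥, by rw [hl]; exact Nat.zero_le _⟩ fun lam hne => ?_]
      · simp
      · exact if_neg fun h => hne (Subtype.ext h)
    refine gap_probabilities_of_expansion (w := fun lam => if lam = ⊥ then 1 else 0)
      (fun lam => by positivity) (by rw [hM]; exact one_pos) (fun lam => ?_) ?_ (fun N => ?_)
      fun N => ?_
    · rw [qPlancherelMass_eq hq₀]
      congr 1
      have hx0' : ξ * √q = 0 := by exact_mod_cast hx0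
      split_ifs with h
      · rw [h, hookWeight_bot, show (⊥ : YoungDiagram).card = 0 from rfl, pow_zero, one_mul, one_pow]
      · rw [hx0', zero_pow, zero_mul, zero_pow two_ne_zero]
        intro hcard
        exact h (YoungDiagram.ext (Finset.card_eq_zero.1 hcard))
    · rw [hM]
      exact hasSum_ite_eq ⊥ 1
    · rw [hone partLength partLength_bot, Complex.ofReal_one, ← integral_det_matrixFun_one N, Zint]
      congr! 5 with U z
      rw [weight, hx0]
      simp [qPochInf_zero]
    · rw [hone largestPart (rowLen_bot 0), Complex.ofReal_one, ← integral_det_matrixFun_one N,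
        ZintCheck]
      congr! 5 with U z
      rw [weightCheck, hx0]
      simp [qPochInf_zero]

end Expansion

theorem proposition3 (ξ q : ℝ) (hξ₀ : 0 ≤ ξ) (hξ₁ : ξ < 1) (hq₀ : 0 ≤ q) (hq₁ : q < 1) :
    -- the squared type q-Plancherel measure is a probability measure
    MeasureTheory.IsProbabilityMeasure (qPlancherel ξ q) ∧
    -- gap probabilities as unitary matrix integrals, with `Z_∞ = Ž_∞ = M(ξ;q)`
    (∀ N : ℕ, (((qPlancherel ξ q).real {lam | partLength lam ≤ N} : ℝ) : ℂ) =
      Zint ξ q N / (macMahon ξ q : ℂ)) ∧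
    (∀ N : ℕ, (((qPlancherel ξ q).real {lam | largestPart lam ≤ N} : ℝ) : ℂ) =
      ZintCheck ξ q N / (macMahon ξ q : ℂ)) ∧
    -- `Z_∞` and `Ž_∞` are the limits of `Z_N` and `Ž_N`
    Filter.Tendsto (fun N : ℕ => Zint ξ q N) Filter.atTop (nhds (macMahon ξ q : ℂ)) ∧
    Filter.Tendsto (fun N : ℕ => ZintCheck ξ q N) Filter.atTop (nhds (macMahon ξ q : ℂ)) ∧
    -- exponential formulas for the weights (on an annulus that contains the unit circle)
    (0 < q → ∀ z : ℂ, ξ * √q < ‖z‖ → ξ * √q * ‖z‖ < 1 →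
      Summable (fun n : ℕ => expTerm ξ q z (n + 1)) ∧
      weight ξ q z = Complex.exp (-∑' n : ℕ, expTerm ξ q z (n + 1)) ∧
      Summable (fun n : ℕ => expTerm (-ξ) q z (n + 1)) ∧
      weightCheck ξ q z = Complex.exp (∑' n : ℕ, expTerm (-ξ) q z (n + 1))) := by
  obtain ⟨h1, h2, h3, h4, h5⟩ := gap_probabilities hξ₀ hξ₁ hq₀ hq₁
  exact ⟨h1, h2, h3, h4, h5, fun hq z hz1 hz2 => exponential_formulas hξ₀ hq hq₁ hz1 hz2⟩
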